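/- Here $\mathbb N=\{1,2,\dots\}$, $c_{00}$ is the space of finitely supported real sequences $(x(n))_{n\in\mathbb N}$ with unit vectors $e_n$, and $f(x)=\sum_n f(n)x(n)$ for $f,x\in c_{00}$. **Families.** For a family $\mathcal A$ of finite subsets of $\mathbb N$, finite sets $E_1,\dots,E_d$ are $\mathcal A$-admissible if there is $\{p_1<\dots<p_d\}\in\mathcal A$ with $p_1\le E_1<p_2\le E_2<\dots<p_d\le E_d$. Let $\mathcal A[\mathcal B]$ be the family of all unions $E_1\cup\dots\cup E_d$ of $\mathcal A$-admissible sequences with all $E_i\in\mathcal B$. Let $\mathcal S=\{A:\#A\le\min A\}$ (with $\emptyset\in\mathcal S$), $\mathcal F_0=\{\{n\}:n\in\mathbb N\}$ and $\mathcal F_{n+1}=\mathcal S[\mathcal F_n]$. **Mixed Tsirelson norms.** Given families $\mathcal M_j$ and numbers $\theta_j\in(0,1)$, let $K^0_j=\{\pm e_n:n\in\mathbb N\}$ and $$K^{n+1}_j=K^n_j\cup\Big\{\theta_j(f_1+\dots+f_d): d\ge 1,\ f_1,\dots,f_d\in\bigcup_iK^n_i,\ (\operatorname{supp}f_1,\dots,\operatorname{supp}f_d)\text{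 is }\mathcal M_j\text{-admissible}\Big\},$$ $K_j=\bigcup_nK^n_j$ and $K=\bigcup_jK_j$. The space $T[(\mathcal M_j,\theta_j)_j]$ is the completion of $c_{00}$ under $\|x\|=\sup_{f\in K}f(x)$. The elements of $K$ extend to continuous functionals on this space. **The space $X_u$.** Let $(m_j)_{j\ge0}$ be integers with $m_0=2$ and $m_{j+1}>m_j^{m_j}$. Choose inductively families $\mathcal M_j$ and integers $k_j,s_j,l_j$ such that $\mathcal M_0=\mathcal F_1$ and, for all $j\ge0$: $\mathcal M_j\subset\mathcal F_{k_j}\subset\mathcal M_{j+1}$; $s_{j+1}>k_j$; every infinite $D\subset\mathbb N$ carries a convex combination $x$ of the $e_n$ with $\operatorname{supp}x\subset D$, $\operatorname{supp}x\in\mathcal F_{s_{j+1}}$, nonincreasing coefficients on its support, and norm less than $m_{j+2}^{-4}$ in $T[\mathcal F_{k_j},\frac12]$; $2^{-l_{j+1}}<\frac1{2m_{j+1}}$; and $\mathcal M_{j+1}=\mathcal F_{s_{j+1}}[\cdots[\mathcal F_{s_{j+1}}]\cdots]$ ($l_{j+1}$ copies). Put $X_u=T[(\mathcal M_j,\frac1{m_j})_{j\ge0}]$.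 **Theorem.** 1. For every sequence $(m_j)$ as above, such choices exist. For every such choice: 2. The norm of $X_u$ satisfies on $c_{00}$ the implicit equation $$\|x\|=\max\Big\{\|x\|_\infty,\ \sup_k\frac1{m_k}\sup\sum_{i=1}^d\|E_ix\|\Big\},$$ where the inner supremum is over all $\mathcal M_k$-admissible $(E_1,\dots,E_d)$ and $E_ix$ is the restriction of $x$ to $E_i$. 3. $(e_n)$ is a $1$-unconditional basis of $X_u$. 4. $X_u$ is arbitrarily distortable: for every $t>1$ there is an equivalent norm $p$ on $X_u$ such that $$\sup\{p(x)/p(y):x,y\in Y,\ \|x\|=\|y\|=1\}\ge t$$ for every infinite-dimensional subspace $Y$ of $X_u$. 5. For each $i_0\ge0$ the norm $|||x|||=\frac1{m_{i_0}}\|x\|+\sup\{\varphi(x):\varphi\in K_{i_0}\}$ satisfies $$\tfrac1{m_{i_0}}\|x\|\le|||x|||\le\big(\tfrac1{m_{i_0}}+1\big)\|x\|\quad\text{on }X_u,$$ and $$\sup\Big\{\frac{|||x|||}{|||y|||}:x,y\in Y,\ \|x\|=\|y\|=1\Big\}\ge c\,m_{i_0}$$ for every block subspace $Y$, that is, the closed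 linear span of a sequence of nonzero vectors of $c_{00}$ with successive supports. Here $c>0$ is an absolute constant, independent of $i_0$, of $Y$ and of the choices made. -/

import Mathlib

noncomputable section

/-- A sequence `E 0, …, E (d - 1)` of finite sets of positive integers is `A`-admissible if there is
`{m 0 < ⋯ < m (d - 1)} ∈ A` with `m 0 ≤ E 0 < m 1 ≤ E 1 < ⋯ < m (d - 1) ≤ E (d - 1)`. -/
def Admissible (A : Set (Finset ℕ+)) {d : ℕ} (E : Fin d → Finset ℕ+) : Prop :=
  ∃ m : Fin d → ℕ+, StrictMono m ∧ Finset.univ.image m ∈ A ∧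
    (∀ i, ∀ a ∈ E i, m i ≤ a) ∧ ∀ i j, i < j → ∀ a ∈ E i, a < m j

/-- The family `A[B]`. -/
def familyOp (A B : Set (Finset ℕ+)) : Set (Finset ℕ+) :=
  {F | ∃ (d : ℕ) (E : Fin d → Finset ℕ+),
    Admissible A E ∧ (∀ i, E i ∈ B) ∧ F = Finset.univ.biUnion E}

/-- `A[⋯[A]⋯]` with `l ≥ 1` copies of `A`. -/
def familyIter (A : Set (Finset ℕ+)) (l : ℕ) : Set (Finset ℕ+) :=
  (familyOp A)^[l - 1] A

/-- The Schreier family: finite sets with `#A ≤ min A`. -/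
def schreier : Set (Finset ℕ+) := {A | ∀ a ∈ A, A.card ≤ (a : ℕ)}

/-- The generalized Schreier families of finite order. -/
def schreierFam : ℕ → Set (Finset ℕ+)
  | 0 => {A | ∃ n, A = {n}}
  | n + 1 => familyOp schreier (schreierFam n)

/-- Families `fam k` and weights `weight k ∈ (0, 1)` that define a mixed Tsirelson norm. -/
structure TsirelsonData (ι : Type) where
  fam : ι → Set (Finset ℕ+)
  weight : ι → ℝ
  weight_pos : ∀ k, 0 < weight k
  weight_lt_one : ∀ k, weight k < 1

/-- The action `f(x) = ∑ f(n) x(n)` of a finitely supported functional. -/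
def pairing (f x : ℕ+ →₀ ℝ) : ℝ := ∑ n ∈ f.support, f n * x n

namespace TsirelsonData

variable {ι : Type} (T : TsirelsonData ι)

/-- The sets `K^n_j`: `K^0_j` consists of all `± e_k`, and `K^{n+1}_j` adds to `K^n_j` all
`θ_j (f_1 + ⋯ + f_d)` with `f_i ∈ ⋃_i K^n_i` and `(supp f_1, …, supp f_d)` admissible for the
`j`-th family. -/
def level : ℕ → ι → Set (ℕ+ →₀ ℝ)
  | 0, _ => {f | ∃ k, f = Finsupp.single k 1 ∨ f = Finsupp.single k (-1)}
  | n + 1, j => level n j ∪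
      {f | ∃ (d : ℕ) (g : Fin d → ℕ+ →₀ ℝ), 0 < d ∧ (∀ i, ∃ j', g i ∈ level n j') ∧
        Admissible (T.fam j) (fun i => (g i).support) ∧ f = T.weight j • ∑ i, g i}

/-- `K_j = ⋃_n K^n_j`. -/
def K (j : ι) : Set (ℕ+ →₀ ℝ) := ⋃ n, T.level n j

/-- The norming set `K = ⋃_j K_j`. -/
def normingSet : Set (ℕ+ →₀ ℝ) := ⋃ j, T.K j

/-- The mixed Tsirelson norm `‖x‖ = sup {f(x) : f ∈ K}` on `c₀₀`. -/
def tnorm (x : ℕ+ →₀ ℝ) : ℝ := sSup ((fun f => pairing f x) '' T.normingSet)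

theorem pairing_single (k : ℕ+) (a : ℝ) (x : ℕ+ →₀ ℝ) :
    pairing (Finsupp.single k a) x = a * x k := by
  unfold pairing
  rw [Finset.sum_subset (Finsupp.support_single_subset)]
  · simp
  · intro y _ hy
    simp [Finsupp.notMem_support_iff.mp hy]

theorem admissible_disjoint {A : Set (Finset ℕ+)} {d : ℕ} {E : Fin d → Finset ℕ+}
    (h : Admissible A E) {i j : Fin d} {a : ℕ+} (hi : a ∈ E i) (hj : a ∈ E j) : i = j := by
  obtain ⟨m, -, -, h1, h2⟩ := h
  rcases lt_trichotomy i j with hij | hij | hij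
  · exact absurd (h2 i j hij a hi) (not_lt.mpr (h1 j a hj))
  · exact hij
  · exact absurd (h2 j i hij a hj) (not_lt.mpr (h1 i a hi))

theorem level_abs_le (n : ℕ) : ∀ (j : ι) (f : ℕ+ →₀ ℝ), f ∈ T.level n j → ∀ k, |f k| ≤ 1 := by
  induction n with
  | zero =>
    rintro j f ⟨p, rfl | rfl⟩ k <;> rw [Finsupp.single_apply] <;> split_ifs <;> simp
  | succ n ih =>
    rintro j f (hf | ⟨d, g, -, hg, hadm, rfl⟩) k
    · exact ih j f hf k
    · have hs : |∑ i, g i k| ≤ 1 := by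
        by_cases hk : ∃ i, k ∈ (g i).support
        · obtain ⟨i, hi⟩ := hk
          rw [Finset.sum_eq_single i]
          · obtain ⟨j', hj'⟩ := hg i
            exact ih j' _ hj' k
          · intro i' _ hne
            by_contra hc
            exact hne (admissible_disjoint hadm (Finsupp.mem_support_iff.mpr hc) hi)
          · simp
        · push Not at hk
          rw [Finset.sum_eq_zero]
          · simp
          · intro i _
            exact Finsupp.notMem_support_iff.mp (hk i)
      have h0 := T.weight_pos j
      have h1 := T.weight_lt_one j
      simp only [Finsupp.smul_apply, Finsupp.finsetSum_apply, smul_eq_mul, abs_mul,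
        abs_of_pos h0]
      exact mul_le_one₀ h1.le (abs_nonneg _) hs

theorem level_neg (n : ℕ) : ∀ (j : ι) (f : ℕ+ →₀ ℝ), f ∈ T.level n j → -f ∈ T.level n j := by
  induction n with
  | zero =>
    rintro j f ⟨p, rfl | rfl⟩
    · exact ⟨p, Or.inr (by simp)⟩
    · exact ⟨p, Or.inl (by simp)⟩
  | succ n ih =>
    rintro j f (hf | ⟨d, g, hd, hg, hadm, rfl⟩)
    · exact Or.inl (ih j f hf)
    · refine Or.inr ⟨d, fun i => -g i, hd, fun i => ?_, ?_, ?_⟩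
      · obtain ⟨j', hj'⟩ := hg i
        exact ⟨j', ih j' _ hj'⟩
      · simpa using hadm
      · simp

theorem K_subset (j : ι) : T.K j ⊆ T.normingSet := Set.subset_iUnion T.K j

theorem abs_le_of_mem {f : ℕ+ →₀ ℝ} (hf : f ∈ T.normingSet) (k : ℕ+) : |f k| ≤ 1 := by
  simp only [normingSet, K, Set.mem_iUnion] at hf
  obtain ⟨j, n, hf⟩ := hf
  exact T.level_abs_le n j f hf k

theorem K_neg_mem {j : ι} {f : ℕ+ →₀ ℝ} (hf : f ∈ T.K j) : -f ∈ T.K j := by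
  simp only [K, Set.mem_iUnion] at hf ⊢
  obtain ⟨n, hf⟩ := hf
  exact ⟨n, T.level_neg n j f hf⟩

theorem neg_mem {f : ℕ+ →₀ ℝ} (hf : f ∈ T.normingSet) : -f ∈ T.normingSet := by
  simp only [normingSet, Set.mem_iUnion] at hf ⊢
  obtain ⟨j, hf⟩ := hf
  exact ⟨j, T.K_neg_mem hf⟩

theorem single_mem_K (j : ι) (k : ℕ+) : Finsupp.single k (1 : ℝ) ∈ T.K j :=
  Set.mem_iUnion.mpr ⟨0, k, Or.inl rfl⟩

theorem pairing_eq (f x : ℕ+ →₀ ℝ) : pairing f x = ∑ n ∈ x.support, f n * x n := by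
  unfold pairing
  rw [Finset.sum_subset Finset.subset_union_left (s₂ := f.support ∪ x.support),
    Finset.sum_subset Finset.subset_union_right (s₁ := x.support)]
  · intro n _ hn
    simp [Finsupp.notMem_support_iff.mp hn]
  · intro n _ hn
    simp [Finsupp.notMem_support_iff.mp hn]

theorem pairing_add (f x y : ℕ+ →₀ ℝ) : pairing f (x + y) = pairing f x + pairing f y := by
  simp [pairing, mul_add, Finset.sum_add_distrib]

theorem pairing_smul (f : ℕ+ →₀ ℝ) (c : ℝ) (x : ℕ+ →₀ ℝ) :
    pairing f (c • x) = c * pairing f x := by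
  simp only [pairing, Finsupp.smul_apply, smul_eq_mul, Finset.mul_sum]
  exact Finset.sum_congr rfl fun n _ => by ring

theorem pairing_neg_left (f x : ℕ+ →₀ ℝ) : pairing (-f) x = -pairing f x := by
  simp [pairing]

theorem bddAbove_pairing (x : ℕ+ →₀ ℝ) :
    BddAbove ((fun f => pairing f x) '' T.normingSet) := by
  refine ⟨∑ n ∈ x.support, |x n|, ?_⟩
  rintro _ ⟨f, hf, rfl⟩
  simp only [pairing_eq]
  refine Finset.sum_le_sum fun n _ => (le_abs_self _).trans ?_
  rw [abs_mul]
  exact mul_le_of_le_one_left (abs_nonneg _) (T.abs_le_of_mem hf n)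

theorem pairing_le_tnorm {f : ℕ+ →₀ ℝ} (hf : f ∈ T.normingSet) (x : ℕ+ →₀ ℝ) :
    pairing f x ≤ T.tnorm x :=
  le_csSup (T.bddAbove_pairing x) ⟨f, hf, rfl⟩

theorem abs_pairing_le_tnorm {f : ℕ+ →₀ ℝ} (hf : f ∈ T.normingSet) (x : ℕ+ →₀ ℝ) :
    |pairing f x| ≤ T.tnorm x := by
  refine abs_le'.mpr ⟨T.pairing_le_tnorm hf x, ?_⟩
  rw [← pairing_neg_left]
  exact T.pairing_le_tnorm (T.neg_mem hf) x

section Space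

variable [Nonempty ι]

theorem single_mem (k : ℕ+) : Finsupp.single k (1 : ℝ) ∈ T.normingSet :=
  T.K_subset (Classical.arbitrary ι) (T.single_mem_K _ k)

theorem normingSet_nonempty : T.normingSet.Nonempty := ⟨_, T.single_mem 1⟩

theorem abs_apply_le_tnorm (x : ℕ+ →₀ ℝ) (k : ℕ+) : |x k| ≤ T.tnorm x := by
  simpa [pairing_single] using T.abs_pairing_le_tnorm (T.single_mem k) x

theorem tnorm_le {x : ℕ+ →₀ ℝ} {c : ℝ} (h : ∀ f ∈ T.normingSet, pairing f x ≤ c) :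
    T.tnorm x ≤ c := by
  refine csSup_le (T.normingSet_nonempty.image _) ?_
  rintro _ ⟨f, hf, rfl⟩
  exact h f hf

end Space

/-- `c₀₀`, to be equipped with the mixed Tsirelson norm. -/
def Pre (_T : TsirelsonData ι) : Type := ℕ+ →₀ ℝ

instance : AddCommGroup T.Pre := inferInstanceAs (AddCommGroup (ℕ+ →₀ ℝ))

instance : Module ℝ T.Pre := inferInstanceAs (Module ℝ (ℕ+ →₀ ℝ))

/-- The finitely supported vector `x` as an element of the normed space `c₀₀`. -/
def toPre : (ℕ+ →₀ ℝ) ≃ₗ[ℝ] T.Pre := LinearEquiv.refl ℝ (ℕ+ →₀ ℝ)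

variable [Nonempty ι]

instance : Norm T.Pre := ⟨fun x => T.tnorm (T.toPre.symm x)⟩

theorem norm_toPre (x : ℕ+ →₀ ℝ) : ‖T.toPre x‖ = T.tnorm x := rfl

theorem norm_pre (x : T.Pre) : ‖x‖ = T.tnorm (T.toPre.symm x) := rfl

theorem preCore : NormedSpace.Core ℝ T.Pre where
  norm_nonneg x := (abs_nonneg _).trans (T.abs_apply_le_tnorm (T.toPre.symm x) 1)
  norm_smul c x := by
    simp only [norm_pre, map_smul, Real.norm_eq_abs]
    have key : ∀ (c : ℝ) (x : ℕ+ →₀ ℝ), T.tnorm (c • x) ≤ |c| * T.tnorm x := by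
      intro c x
      refine T.tnorm_le fun f hf => ?_
      rw [pairing_smul]
      refine (le_abs_self _).trans ?_
      rw [abs_mul]
      exact mul_le_mul_of_nonneg_left (T.abs_pairing_le_tnorm hf x) (abs_nonneg _)
    refine le_antisymm (key _ _) ?_
    rcases eq_or_ne c 0 with rfl | hc
    · simpa using (abs_nonneg _).trans (T.abs_apply_le_tnorm 0 1)
    · have h := key c⁻¹ (c • T.toPre.symm x)
      rw [smul_smul, inv_mul_cancel₀ hc, one_smul, abs_inv] at h
      rwa [← le_inv_mul_iff₀ (abs_pos.mpr hc)]
  norm_triangle x y := by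
    simp only [norm_pre, map_add]
    refine T.tnorm_le fun f hf => ?_
    rw [pairing_add]
    exact add_le_add (T.pairing_le_tnorm hf _) (T.pairing_le_tnorm hf _)
  norm_eq_zero_iff x := by
    constructor
    · intro h
      refine T.toPre.symm.injective (Finsupp.ext fun k => ?_)
      have := T.abs_apply_le_tnorm (T.toPre.symm x) k
      rw [← norm_pre, h] at this
      simpa using this
    · rintro rfl
      refine le_antisymm (T.tnorm_le fun f _ => ?_) ?_
      · simp [pairing]
      · exact (abs_nonneg _).trans (T.abs_apply_le_tnorm _ 1)

instance : NormedAddCommGroup T.Pre := NormedAddCommGroup.ofCore T.preCore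

instance : NormedSpace ℝ T.Pre := NormedSpace.ofCore T.preCore

/-- The mixed Tsirelson space `T[(M_k, θ_k)_k]`: the completion of `c₀₀`. -/
abbrev Space : Type := UniformSpace.Completion T.Pre

/-- The finitely supported vector `x` as an element of the mixed Tsirelson space. -/
def ofFinsupp (x : ℕ+ →₀ ℝ) : T.Space := (T.toPre x : T.Space)

/-- The unit vector basis. -/
def e (n : ℕ+) : T.Space := T.ofFinsupp (Finsupp.single n 1)

/-- A finitely supported functional as a continuous linear functional on `c₀₀`. -/
def preFunctional (f : ℕ+ →₀ ℝ) : T.Pre →L[ℝ] ℝ :=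
  LinearMap.mkContinuous
    { toFun := fun x => pairing f (T.toPre.symm x)
      map_add' := fun x y => by rw [map_add, pairing_add]
      map_smul' := fun c x => by rw [map_smul, pairing_smul]; rfl }
    (∑ n ∈ f.support, |f n|) (fun x => by
      change ‖pairing f (T.toPre.symm x)‖ ≤ _
      rw [Finset.sum_mul]
      refine (norm_sum_le _ _).trans (Finset.sum_le_sum fun n _ => ?_)
      rw [norm_mul]
      exact mul_le_mul_of_nonneg_left (T.abs_apply_le_tnorm _ n) (norm_nonneg _))

/-- The extension of a finitely supported functional to the mixed Tsirelson space. -/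
def functional (f : ℕ+ →₀ ℝ) : T.Space →L[ℝ] ℝ := (T.preFunctional f).fromCompletion

theorem functional_ofFinsupp (f x : ℕ+ →₀ ℝ) : T.functional f (T.ofFinsupp x) = pairing f x := by
  simp [functional, ofFinsupp, preFunctional]

theorem abs_functional_le {f : ℕ+ →₀ ℝ} (hf : f ∈ T.normingSet) (x : T.Space) :
    |T.functional f x| ≤ ‖x‖ := by
  induction x using UniformSpace.Completion.induction_on with
  | hp => exact isClosed_le (by fun_prop) (by fun_prop)
  | ih x =>
    rw [UniformSpace.Completion.norm_coe, norm_pre]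
    have h := T.functional_ofFinsupp f (T.toPre.symm x)
    rw [ofFinsupp, LinearEquiv.apply_symm_apply] at h
    rw [h]
    exact T.abs_pairing_le_tnorm hf _

theorem bddAbove_functional (j : ι) (x : T.Space) :
    BddAbove ((fun f => T.functional f x) '' T.K j) := by
  refine ⟨‖x‖, ?_⟩
  rintro _ ⟨f, hf, rfl⟩
  exact (le_abs_self _).trans (T.abs_functional_le (T.K_subset j hf) x)

theorem functional_neg (f : ℕ+ →₀ ℝ) (x : T.Space) : T.functional (-f) x = -T.functional f x := by
  induction x using UniformSpace.Completion.induction_on with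
  | hp => exact isClosed_eq (by fun_prop) (by fun_prop)
  | ih x =>
    have h := T.functional_ofFinsupp f (T.toPre.symm x)
    have h' := T.functional_ofFinsupp (-f) (T.toPre.symm x)
    rw [ofFinsupp, LinearEquiv.apply_symm_apply] at h h'
    rw [h, h', pairing_neg_left]

/-- The seminorm `x ↦ sup {φ(x) : φ ∈ K_j}`. -/
def supSeminorm (j : ι) : Seminorm ℝ T.Space :=
  Seminorm.ofSMulLE (fun x => sSup ((fun f => T.functional f x) '' T.K j))
    (by
      have : (fun f => T.functional f 0) '' T.K j = {0} := by
        simp only [map_zero]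
        exact Set.Nonempty.image_const ⟨_, T.single_mem_K j 1⟩ 0
      rw [this, csSup_singleton])
    (fun x y => by
      refine csSup_le (Set.Nonempty.image _ ⟨_, T.single_mem_K j 1⟩) ?_
      rintro _ ⟨f, hf, rfl⟩
      simp only [map_add]
      exact add_le_add (le_csSup (T.bddAbove_functional j x) ⟨f, hf, rfl⟩)
        (le_csSup (T.bddAbove_functional j y) ⟨f, hf, rfl⟩))
    (fun c x => by
      refine csSup_le (Set.Nonempty.image _ ⟨_, T.single_mem_K j 1⟩) ?_
      rintro _ ⟨f, hf, rfl⟩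
      simp only [map_smul, smul_eq_mul]
      refine (le_abs_self _).trans ?_
      rw [abs_mul, Real.norm_eq_abs]
      refine mul_le_mul_of_nonneg_left (abs_le'.mpr ⟨?_, ?_⟩) (abs_nonneg _)
      · exact le_csSup (T.bddAbove_functional j x) ⟨f, hf, rfl⟩
      · exact le_csSup (T.bddAbove_functional j x) ⟨-f, T.K_neg_mem hf, T.functional_neg f x⟩)

/-- The norm `|||x||| = θ_j ‖x‖ + sup {φ(x) : φ ∈ K_j}`. -/
def distortingNorm (j : ι) : Seminorm ℝ T.Space where
  toFun x := T.weight j * ‖x‖ + T.supSeminorm j x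
  map_zero' := by simp
  add_le' x y := by
    have h1 := mul_le_mul_of_nonneg_left (norm_add_le x y) (T.weight_pos j).le
    have h2 := map_add_le_add (T.supSeminorm j) x y
    linarith
  neg' x := by simp
  smul' c x := by
    simp only [norm_smul, map_smul_eq_mul]
    ring

theorem distortingNorm_apply (j : ι) (x : T.Space) :
    T.distortingNorm j x = T.weight j * ‖x‖ + sSup ((fun f => T.functional f x) '' T.K j) := rfl

/-- The closed linear span of a sequence of finitely supported vectors. -/
def closedSpan (x : ℕ → ℕ+ →₀ ℝ) : Submodule ℝ T.Space :=
  (Submodule.span ℝ (Set.range fun k => T.ofFinsupp (x k))).topologicalClosure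

end TsirelsonData

/-- Block sequences of the unit vector basis: successive nonzero finitely supported vectors. -/
def IsBlockSeq (x : ℕ → ℕ+ →₀ ℝ) : Prop :=
  (∀ k, x k ≠ 0) ∧ ∀ i j, i < j → ∀ a ∈ (x i).support, ∀ b ∈ (x j).support, a < b

/-- The data of the space `T[F_n, 1/2]`. -/
def schreierHalf (n : ℕ) : TsirelsonData Unit where
  fam _ := schreierFam n
  weight _ := 1 / 2
  weight_pos _ := by norm_num
  weight_lt_one _ := by norm_num

/-- `F_s` supports, inside every infinite set, convex combinations of the basis with decreasing
coefficients whose norm in `T[F_k, 1/2]` is smaller than `ε`. -/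
def HasSmallConvexCombinations (s k : ℕ) (ε : ℝ) : Prop :=
  ∀ D : Set ℕ+, D.Infinite → ∃ x : ℕ+ →₀ ℝ, (∀ n, 0 ≤ x n) ∧ ∑ n ∈ x.support, x n = 1 ∧
    (x.support : Set ℕ+) ⊆ D ∧ x.support ∈ schreierFam s ∧
    AntitoneOn x (x.support : Set ℕ+) ∧ (schreierHalf k).tnorm x < ε

/-- The requirements on the sequence `(m_j)`. -/
structure IsFastSeq (m : ℕ → ℕ) : Prop where
  zero : m 0 = 2
  succ : ∀ j, m j ^ m j < m (j + 1)

theorem IsFastSeq.two_le {m : ℕ → ℕ} (h : IsFastSeq m) (j : ℕ) : 2 ≤ m j := by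
  induction j with
  | zero => exact h.zero.ge
  | succ j ih =>
    exact (ih.trans (Nat.le_self_pow (by omega) _)).trans (h.succ j).le

/-- One run of the inductive choice of sequences `(m_j)`, `(k_j)`, `(s_j)`, `(l_j)` and families
`(M_j)` that defines a space `X_u`. The values `s 0` and `l 0` are not used. -/
structure XuChoice where
  m : ℕ → ℕ
  fast : IsFastSeq m
  k : ℕ → ℕ
  s : ℕ → ℕ
  l : ℕ → ℕ
  M : ℕ → Set (Finset ℕ+)
  M_zero : M 0 = schreierFam 1
  M_subset : ∀ j, M j ⊆ schreierFam (k j)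
  subset_M : ∀ j, schreierFam (k j) ⊆ M (j + 1)
  lt_s : ∀ j, k j < s (j + 1)
  small : ∀ j, HasSmallConvexCombinations (s (j + 1)) (k j) (1 / (m (j + 2) : ℝ) ^ 4)
  l_large : ∀ j, (1 : ℝ) / 2 ^ l (j + 1) < 1 / (2 * (m (j + 1) : ℝ))
  M_succ : ∀ j, M (j + 1) = familyIter (schreierFam (s (j + 1))) (l (j + 1))

/-- The data `(M_j, 1/m_j)_j` of the space `X_u = T[(M_j, 1/m_j)_j]`. -/
def XuChoice.data (C : XuChoice) : TsirelsonData ℕ where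
  fam := C.M
  weight j := 1 / (C.m j : ℝ)
  weight_pos j := by
    have : (2 : ℝ) ≤ C.m j := by exact_mod_cast C.fast.two_le j
    positivity
  weight_lt_one j := by
    have : (2 : ℝ) ≤ C.m j := by exact_mod_cast C.fast.two_le j
    rw [div_lt_one (by linarith)]
    linarith

/-- `sup {p x / p y : x, y ∈ Y, ‖x‖ = ‖y‖ = 1} ≥ t`. -/
def DistortsBy {X : Type*} [NormedAddCommGroup X] [NormedSpace ℝ X]
    (p : Seminorm ℝ X) (t : ℝ) (Y : Submodule ℝ X) : Prop :=
  ∀ r < t, ∃ x ∈ Y, ∃ y ∈ Y, ‖x‖ = 1 ∧ ‖y‖ = 1 ∧ r < p x / p y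

/-- `p` is an equivalent norm on `X`. -/
def IsEquivalentNorm {X : Type*} [NormedAddCommGroup X] [NormedSpace ℝ X]
    (p : Seminorm ℝ X) : Prop :=
  ∃ a b : ℝ, 0 < a ∧ 0 < b ∧ ∀ x, a * ‖x‖ ≤ p x ∧ p x ≤ b * ‖x‖

/-- `X` is arbitrarily distortable: for every `t > 1` it has an equivalent norm that distorts every
infinite-dimensional subspace by at least `t`. -/
def ArbitrarilyDistortable (X : Type*) [NormedAddCommGroup X] [NormedSpace ℝ X] : Prop :=
  ∀ t : ℝ, 1 < t → ∃ p : Seminorm ℝ X, IsEquivalentNorm p ∧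
    ∀ Y : Submodule ℝ X, ¬ FiniteDimensional ℝ Y → DistortsBy p t Y

/-- `e` is a `1`-unconditional basis of `X`. -/
def IsOneUnconditionalBasis {X : Type*} [NormedAddCommGroup X] [NormedSpace ℝ X]
    (e : ℕ+ → X) : Prop :=
  (∃ b : UnconditionalSchauderBasis ℕ+ ℝ X, ∀ n, b n = e n) ∧
    ∀ (A : Finset ℕ+) (a σ : ℕ+ → ℝ), (∀ n, σ n = 1 ∨ σ n = -1) →
      ‖∑ n ∈ A, (σ n * a n) • e n‖ = ‖∑ n ∈ A, a n • e n‖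

/-- The values whose least upper bound is the right-hand side
`max {‖x‖_∞, sup_k θ_k sup ∑ N(E_i x)}` of the implicit equation of the mixed Tsirelson norm. -/
def TsirelsonData.implicitValues {ι : Type} (T : TsirelsonData ι) (N : (ℕ+ →₀ ℝ) → ℝ)
    (x : ℕ+ →₀ ℝ) : Set ℝ :=
  {t | ∃ n, t = |x n|} ∪
    {t | ∃ (k : ι) (d : ℕ) (E : Fin d → Finset ℕ+), Admissible (T.fam k) E ∧
      t = T.weight k * ∑ i, N (x.filter (· ∈ E i))}

end

/-!
The families `F_n`, `n ≥ 1`, are hereditary and spreading, and `F_s[F_n] ⊆ F_{s+n}`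
(`familyOp_schreierFam_subset`). A functional of the norming set of `T[F_k, 1/2]` is at most
`2^{-N}` off a member of `F_{kN+1}` (`exists_mem_schreierFam_abs_le`), and repeated averages give
convex combinations with decreasing coefficients and small mass on all members of a given `F_n`
(`exists_isSpreadCombination`). Together they yield the small convex combinations that the inductive
choice asks for (`exists_xuChoice`).

For hereditary families `K_j ∪ {0}` is stable under multiplication by sequences with values in
`{-1, 0, 1}` (`pointwise_smul_mem_K`). This gives unconditionality, restrictions of norm one, and,
by combining almost norming functionals of pieces, the implicit equation (`exists_composite_lt`,
`isLUB_implicitValues`).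

The distortion rests on combinations `z = ∑ b_t w_t` of successive vectors of norm at most one.
The index `t` is a marker strictly above the support of `w_t` and not above the next support, and
`b` is a convex combination of level `j + 1`: its support is in `M_{j+1}`, and its norm `ε` in
`T[F_{k_j}, 1/2]` is below `m_{j+2}^{-4}`. Let `f = (g_1 + ⋯ + g_d) / m_i` with `i ≤ j`. The vectors
that meet at least two of the `g_s` carry mass at most `2ε`, because assigning to such a vector the
last part that it meets is injective, and `t` lies to the right of the marker of this part; the
other vectors are distributed among the `g_s` (`exists_split`). This has two consequences.

* Every such `f` satisfies `|f(z)| ≤ 1 / m_i + 2ε ≤ 2 / m_i`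
  (`abs_pairing_combo_le_of_composite`). Every block subspace contains such `z` with
  `‖z‖ > 1 / 4` far to the right: otherwise normalizing averages `l_{j+1}` times produces a unit
  vector with an `M_{j+1}`-admissible system of pieces whose norms sum up to at least
  `2^{l_{j+1}} > 2 m_{j+1}` (`exists_average`).
* Let the `w_t` be averages of this kind of rapidly increasing levels above `j`. A composite
  functional of index larger than `j` is then at most `2 / m_{j+1}` on all `w_t` but one, and
  splitting the remaining functionals `m_{j+1}` times gives `‖z‖ ≤ 4 / m_{j+1}` and
  `|f(z)| ≤ 4 / (m_i m_{j+1})` for `f ∈ K_i`, `i ≤ j`, while some member of `K_{j+1}` is at least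
  `1 / (16 m_{j+1})` at `z` (`exists_rapid_average`).

For `i₀ ≥ 1` the normalized averages of levels `i₀` and `i₀ + 1` therefore have norms `|||·|||` of
orders `1` and `1 / m_{i₀}` (`exists_distorted`); for `i₀ = 0` the ratio `1` is enough.
Only the existence of vectors of the subspace far to the right is used, so that perturbing a block
sequence settles arbitrary infinite-dimensional subspaces (`exists_hasTails_near`).
-/

/-! ### Hereditary and spreading families -/

/-- A family of finite sets is spreading if it is stable under moving the elements of a member to
the right, keeping their order. -/
def IsSpreading (A : Set (Finset ℕ+)) : Prop :=
  ∀ P ∈ A, ∀ φ : ℕ+ → ℕ+, StrictMonoOn φ (P : Set ℕ+) → (∀ p ∈ P, p ≤ φ p) → P.image φ ∈ A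

theorem IsSpreading.image_mem {A : Set (Finset ℕ+)} (hs : IsSpreading A) {ι : Type*}
    [LinearOrder ι] {s : Finset ι} {m m' : ι → ℕ+} (hm : StrictMonoOn m (s : Set ι))
    (hm' : StrictMonoOn m' (s : Set ι)) (hle : ∀ i ∈ s, m i ≤ m' i) (hA : s.image m ∈ A) :
    s.image m' ∈ A := by
  rcases s.eq_empty_or_nonempty with rfl | ⟨i₀, -⟩
  · simpa using hA
  have : Nonempty ι := ⟨i₀⟩
  have hinv : ∀ i ∈ s, Function.invFunOn m (s : Set ι) (m i) = i := fun i hi =>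
    hm.injOn.leftInvOn_invFunOn hi
  have h := hs _ hA (fun p => m' (Function.invFunOn m (s : Set ι) p)) ?_ ?_
  · rw [Finset.image_image] at h
    rwa [Finset.image_congr (g := m') fun i hi => by simp [hinv i hi]] at h
  · intro a ha b hb hab
    simp only [Finset.coe_image, Set.mem_image, Finset.mem_coe] at ha hb
    obtain ⟨i, hi, rfl⟩ := ha
    obtain ⟨j, hj, rfl⟩ := hb
    simp only [hinv i hi, hinv j hj]
    exact hm' hi hj ((hm.lt_iff_lt hi hj).1 hab)
  · intro p hp
    obtain ⟨i, hi, rfl⟩ := Finset.mem_image.1 hp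
    simpa only [hinv i hi] using hle i hi

/-- Admissibility of a family of sets indexed by a finite subset `s` of a linear order. -/
def AdmOn (A : Set (Finset ℕ+)) {ι : Type*} [LinearOrder ι] (s : Finset ι) (E : ι → Finset ℕ+) :
    Prop :=
  ∃ m : ι → ℕ+, StrictMonoOn m (s : Set ι) ∧ s.image m ∈ A ∧
    (∀ i ∈ s, ∀ a ∈ E i, m i ≤ a) ∧ ∀ i ∈ s, ∀ j ∈ s, i < j → ∀ a ∈ E i, a < m j

section AdmOn

variable {A B : Set (Finset ℕ+)} {ι : Type*} [LinearOrder ι] {s t : Finset ι}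
  {E E' : ι → Finset ℕ+}

theorem Admissible.admOn {d : ℕ} {E : Fin d → Finset ℕ+} (h : Admissible A E) :
    AdmOn A Finset.univ E := by
  obtain ⟨m, h1, h2, h3, h4⟩ := h
  exact ⟨m, h1.strictMonoOn _, h2, fun i _ => h3 i, fun i _ j _ => h4 i j⟩

theorem AdmOn.admissible (h : AdmOn A s E) :
    Admissible A fun i : Fin s.card => E (s.orderEmbOfFin rfl i) := by
  obtain ⟨m, h1, h2, h3, h4⟩ := h
  have hmem := Finset.orderEmbOfFin_mem s rfl
  refine ⟨fun i => m (s.orderEmbOfFin rfl i), fun i j hij => ?_, ?_, fun i => h3 _ (hmem i),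
    fun i j hij => h4 _ (hmem i) _ (hmem j) ((s.orderEmbOfFin rfl).strictMono hij)⟩
  · exact h1 (hmem i) (hmem j) ((s.orderEmbOfFin rfl).strictMono hij)
  · rw [show (fun i => m (s.orderEmbOfFin rfl i)) = m ∘ s.orderEmbOfFin rfl from rfl,
      ← Finset.image_image, Finset.image_orderEmbOfFin_univ]
    exact h2

theorem AdmOn.subset (h : AdmOn A s E) (hA : IsLowerSet A) (hts : t ⊆ s) : AdmOn A t E := by
  obtain ⟨m, h1, h2, h3, h4⟩ := h
  exact ⟨m, h1.mono (by exact_mod_cast hts), hA (Finset.image_subset_image hts) h2,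
    fun i hi => h3 i (hts hi), fun i hi j hj => h4 i (hts hi) j (hts hj)⟩

theorem AdmOn.mono (h : AdmOn A s E) (hE : ∀ i ∈ s, E' i ⊆ E i) : AdmOn A s E' := by
  obtain ⟨m, h1, h2, h3, h4⟩ := h
  exact ⟨m, h1, h2, fun i hi a ha => h3 i hi a (hE i hi ha),
    fun i hi j hj hij a ha => h4 i hi j hj hij a (hE i hi ha)⟩

/-- For a hereditary spreading family, nonempty successive sets that lie to the right of the
markers are admissible, even when a set reaches beyond the next marker: the minima of the sets
serve as new markers. -/
theorem AdmOn.of_weak (hs : IsSpreading A) {m : ι → ℕ+}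
    (hm : StrictMonoOn m (s : Set ι)) (hA : s.image m ∈ A) (h1 : ∀ i ∈ s, ∀ a ∈ E i, m i ≤ a)
    (h2 : ∀ i ∈ s, ∀ j ∈ s, i < j → ∀ a ∈ E i, ∀ b ∈ E j, a < b)
    (hne : ∀ i ∈ s, (E i).Nonempty) : AdmOn A s E := by
  classical
  set m' : ι → ℕ+ := fun i => if h : (E i).Nonempty then (E i).min' h else 1 with hm'
  have hm'mem : ∀ i ∈ s, m' i ∈ E i := fun i hi => by
    simp only [hm', hne i hi, dif_pos]
    exact Finset.min'_mem _ _
  have hm'le : ∀ i, ∀ a ∈ E i, m' i ≤ a := fun i a ha => by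
    have : (E i).Nonempty := ⟨a, ha⟩
    simp only [hm', this, dif_pos]
    exact Finset.min'_le _ _ ha
  have hmono : StrictMonoOn m' (s : Set ι) := fun i hi j hj hij =>
    h2 i hi j hj hij _ (hm'mem i hi) _ (hm'mem j hj)
  exact ⟨m', hmono, hs.image_mem hm hmono (fun i hi => h1 i hi _ (hm'mem i hi)) hA,
    fun i _ => hm'le i, fun i hi j hj hij a ha => h2 i hi j hj hij a ha _ (hm'mem j hj)⟩

theorem AdmOn.lt (h : AdmOn A s E) {i j : ι} (hi : i ∈ s) (hj : j ∈ s) (hij : i < j) {a b : ℕ+}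
    (ha : a ∈ E i) (hb : b ∈ E j) : a < b := by
  obtain ⟨m, -, -, h3, h4⟩ := h
  exact (h4 i hi j hj hij a ha).trans_le (h3 j hj b hb)

theorem Finset.sum_orderEmbOfFin {M : Type*} [AddCommMonoid M] (s : Finset ι) (F : ι → M) :
    ∑ i : Fin s.card, F (s.orderEmbOfFin rfl i) = ∑ i ∈ s, F i := by
  conv_rhs => rw [← Finset.image_orderEmbOfFin_univ s rfl]
  rw [Finset.sum_image fun i _ j _ h => (s.orderEmbOfFin rfl).injective h]

theorem AdmOn.biUnion_mem (h : AdmOn A s E) (hB : ∀ i ∈ s, E i ∈ B) :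
    s.biUnion E ∈ familyOp A B := by
  refine ⟨s.card, _, h.admissible, fun i => hB _ (Finset.orderEmbOfFin_mem s rfl i), ?_⟩
  conv_lhs => rw [← Finset.image_orderEmbOfFin_univ s rfl]
  rw [Finset.image_biUnion]

end AdmOn

section familyOp

variable {A B C : Set (Finset ℕ+)}

theorem IsLowerSet.familyOp (hB : IsLowerSet B) : IsLowerSet (familyOp A B) := by
  rintro F G hGF ⟨d, E, hE, hEB, rfl⟩
  refine ⟨d, fun i => E i ∩ G, ?_, fun i => hB Finset.inter_subset_left (hEB i), ?_⟩
  · obtain ⟨m, h1, h2, h3, h4⟩ := hE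
    exact ⟨m, h1, h2, fun i a ha => h3 i a (Finset.mem_inter.1 ha).1,
      fun i j hij a ha => h4 i j hij a (Finset.mem_inter.1 ha).1⟩
  · ext a
    have := @hGF a
    simp only [Finset.mem_biUnion, Finset.mem_univ, true_and, Finset.mem_inter] at this ⊢
    tauto

/-- Every member of `A[B]` is the union of a nonempty admissible system. -/
theorem exists_admOn_of_mem_familyOp (hA : IsLowerSet A) {F : Finset ℕ+} (hF : F ∈ familyOp A B) :
    ∃ (d : ℕ) (s : Finset (Fin d)) (E : Fin d → Finset ℕ+), AdmOn A s E ∧ (∀ i ∈ s, E i ∈ B) ∧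
      (∀ i ∈ s, (E i).Nonempty) ∧ F = s.biUnion E := by
  classical
  obtain ⟨d, E, hE, hEB, rfl⟩ := hF
  refine ⟨d, Finset.univ.filter fun i => (E i).Nonempty, E,
    hE.admOn.subset hA (Finset.filter_subset _ _), fun i _ => hEB i, by simp, ?_⟩
  ext a
  simp only [Finset.mem_biUnion, Finset.mem_univ, true_and, Finset.mem_filter]
  exact ⟨fun ⟨i, hi⟩ => ⟨i, ⟨a, hi⟩, hi⟩, fun ⟨i, _, hi⟩ => ⟨i, hi⟩⟩

theorem IsSpreading.familyOp (hA : IsLowerSet A) (hAs : IsSpreading A) (hBs : IsSpreading B) :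
    IsSpreading (familyOp A B) := by
  classical
  intro F hF φ hφ hle
  obtain ⟨d, s, E, hE, hEB, hne, rfl⟩ := exists_admOn_of_mem_familyOp hA hF
  have hsub : ∀ i ∈ s, ∀ a ∈ E i, a ∈ (s.biUnion E : Finset ℕ+) := fun i hi a ha =>
    Finset.mem_biUnion.2 ⟨i, hi, ha⟩
  rw [Finset.biUnion_image]
  refine AdmOn.biUnion_mem ?_ fun i hi =>
    hBs _ (hEB i hi) φ (hφ.mono fun a ha => hsub i hi a ha) fun p hp => hle p (hsub i hi p hp)
  have hE' := hE
  obtain ⟨m, h1, h2, h3, h4⟩ := hE'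
  refine AdmOn.of_weak hAs h1 h2 ?_ ?_ fun i hi => (hne i hi).image φ
  · intro i hi a ha
    obtain ⟨b, hb, rfl⟩ := Finset.mem_image.1 ha
    exact (h3 i hi b hb).trans (hle b (hsub i hi b hb))
  · intro i hi j hj hij a ha b hb
    obtain ⟨a, ha', rfl⟩ := Finset.mem_image.1 ha
    obtain ⟨b, hb', rfl⟩ := Finset.mem_image.1 hb
    exact hφ (hsub i hi a ha') (hsub j hj b hb') (hE.lt hi hj hij ha' hb')

theorem familyOp_mono_right (h : B ⊆ C) : familyOp A B ⊆ familyOp A C := by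
  rintro F ⟨d, E, hE, hEB, rfl⟩
  exact ⟨d, E, hE, fun i => h (hEB i), rfl⟩

/-- Half of the associativity `A[B][C] = A[B[C]]`. -/
theorem familyOp_familyOp_subset (hA : IsLowerSet A) (hAs : IsSpreading A) :
    familyOp (familyOp A B) C ⊆ familyOp A (familyOp B C) := by
  classical
  rintro F ⟨d, E, ⟨m, h1, h2, h3, h4⟩, hEC, rfl⟩
  obtain ⟨d', s, P, hP, hPB, hPne, hPU⟩ := exists_admOn_of_mem_familyOp hA h2
  have hPm : ∀ j ∈ s, ∀ p ∈ P j, ∃ i, m i = p := fun j hj p hp => by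
    have : p ∈ Finset.univ.image m := hPU ▸ Finset.mem_biUnion.2 ⟨j, hj, hp⟩
    simpa using this
  set I : Fin d' → Finset (Fin d) := fun j => Finset.univ.filter fun i => m i ∈ P j with hI
  have hF : Finset.univ.biUnion E = s.biUnion fun j => (I j).biUnion E := by
    ext a
    simp only [Finset.mem_biUnion, Finset.mem_univ, true_and, hI, Finset.mem_filter]
    constructor
    · rintro ⟨i, hi⟩
      have : m i ∈ s.biUnion P := hPU ▸ Finset.mem_image_of_mem _ (Finset.mem_univ i)
      obtain ⟨j, hj, hij⟩ := Finset.mem_biUnion.1 this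
      exact ⟨j, hj, i, hij, hi⟩
    · rintro ⟨j, _, i, _, hi⟩
      exact ⟨i, hi⟩
  rw [hF]
  obtain ⟨q, hq1, hq2, hq3, hq4⟩ := hP
  -- The minima of the inner marker sets become the outer markers.
  have hmin : ∀ j ∈ s, ∃ p, p ∈ P j ∧ ∀ p' ∈ P j, p ≤ p' := fun j hj =>
    ⟨_, Finset.min'_mem _ (hPne j hj), fun p hp => Finset.min'_le _ _ hp⟩
  choose! r hr1 hr2 using hmin
  have hmono : StrictMonoOn r (s : Set (Fin d')) := fun i hi j hj hij =>
    (hq4 i hi j hj hij _ (hr1 i hi)).trans_le (hq3 j hj _ (hr1 j hj))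
  refine AdmOn.biUnion_mem ⟨r, hmono,
    hAs.image_mem hq1 hmono (fun j hj => hq3 j hj _ (hr1 j hj)) hq2, ?_, ?_⟩ ?_
  · intro j hj a ha
    obtain ⟨i, hi, ha⟩ := Finset.mem_biUnion.1 ha
    exact (hr2 j hj _ (Finset.mem_filter.1 hi).2).trans (h3 i a ha)
  · intro j hj j' hj' hjj a ha
    obtain ⟨i, hi, ha⟩ := Finset.mem_biUnion.1 ha
    obtain ⟨i', hi'⟩ := hPm j' hj' _ (hr1 j' hj')
    rw [← hi']
    refine h4 i i' (h1.lt_iff_lt.1 ?_) a ha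
    rw [hi']
    exact (hq4 j hj j' hj' hjj _ (Finset.mem_filter.1 hi).2).trans_le (hq3 j' hj' _ (hr1 j' hj'))
  · intro j hj
    refine AdmOn.biUnion_mem ⟨m, h1.strictMonoOn _, ?_, fun i _ => h3 i,
      fun i _ i' _ => h4 i i'⟩ fun i _ => hEC i
    convert hPB j hj using 1
    ext p
    simp only [Finset.mem_image, hI, Finset.mem_filter, Finset.mem_univ, true_and]
    constructor
    · rintro ⟨i, hi, rfl⟩
      exact hi
    · intro hp
      obtain ⟨i, rfl⟩ := hPm j hj p hp
      exact ⟨i, hp, rfl⟩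

theorem isLowerSet_schreier : IsLowerSet schreier := fun _ _ hPQ hQ a ha =>
  (Finset.card_le_card hPQ).trans (hQ a (hPQ ha))

theorem isSpreading_schreier : IsSpreading schreier := by
  intro P hP φ _ hle a ha
  obtain ⟨p, hp, rfl⟩ := Finset.mem_image.1 ha
  exact Finset.card_image_le.trans ((hP p hp).trans (by exact_mod_cast hle p hp))

theorem isSpreading_schreierFam (n : ℕ) : IsSpreading (schreierFam n) := by
  induction n with
  | zero =>
    rintro P ⟨p, rfl⟩ φ _ _
    exact ⟨φ p, by simp⟩
  | succ n ih => exact isSpreading_schreier.familyOp isLowerSet_schreier ih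

theorem familyOp_schreierFam_zero_subset (hA : IsLowerSet A) (hAs : IsSpreading A) :
    familyOp A (schreierFam 0) ⊆ A := by
  classical
  intro F hF
  obtain ⟨d, s, E, hE, hE0, hne, rfl⟩ := exists_admOn_of_mem_familyOp hA hF
  have : ∀ i ∈ s, ∃ n, E i = {n} := hE0
  choose! n hn using this
  have hE' := hE
  obtain ⟨m, h1, h2, h3, h4⟩ := hE'
  have hmem : ∀ i ∈ s, n i ∈ E i := fun i hi => by simp [hn i hi]
  have : s.biUnion E = s.image n := by
    ext a
    simp only [Finset.mem_biUnion, Finset.mem_image]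
    refine exists_congr fun i => and_congr_right fun hi => ?_
    rw [hn i hi, Finset.mem_singleton, eq_comm]
  rw [this]
  exact hAs.image_mem h1 (fun i hi j hj hij => hE.lt hi hj hij (hmem i hi) (hmem j hj))
    (fun i hi => h3 i hi _ (hmem i hi)) h2

theorem subset_familyOp (hB : schreierFam 0 ⊆ B) : A ⊆ familyOp A B := by
  intro P hP
  have := AdmOn.biUnion_mem (A := A) (B := B) (s := P) (E := fun p => {p})
    ⟨id, strictMono_id.strictMonoOn _, by simpa using hP, by simp, by simp +contextual⟩
    fun p _ => hB ⟨p, rfl⟩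
  simpa using this

theorem schreierFam_one : schreierFam 1 = schreier :=
  (familyOp_schreierFam_zero_subset isLowerSet_schreier isSpreading_schreier).antisymm
    (subset_familyOp subset_rfl)

theorem isLowerSet_schreierFam {n : ℕ} (hn : n ≠ 0) : IsLowerSet (schreierFam n) := by
  obtain ⟨n, rfl⟩ := Nat.exists_eq_succ_of_ne_zero hn
  clear hn
  induction n with
  | zero =>
    rw [schreierFam_one]
    exact isLowerSet_schreier
  | succ n ih => exact ih.familyOp

theorem schreierFam_subset_succ (n : ℕ) : schreierFam n ⊆ schreierFam (n + 1) := by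
  intro F hF
  rcases F.eq_empty_or_nonempty with rfl | hne
  · exact ⟨0, fun _ => ∅, ⟨fun _ => 1, fun i => i.elim0, by simp [schreier], by simp, by simp⟩,
      fun i => i.elim0, by simp⟩
  · have := AdmOn.biUnion_mem (A := schreier) (B := schreierFam n) (s := {()}) (E := fun _ => F)
      ⟨fun _ => F.min' hne, by simp, by simp [schreier, Nat.one_le_iff_ne_zero],
        fun _ _ a ha => F.min'_le a ha, by simp⟩ fun _ _ => hF
    rwa [Finset.singleton_biUnion] at this

theorem schreierFam_mono : Monotone schreierFam := monotone_nat_of_le_succ schreierFam_subset_succ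

theorem empty_mem_schreierFam {n : ℕ} (hn : n ≠ 0) : ∅ ∈ schreierFam n := by
  refine schreierFam_mono (Nat.one_le_iff_ne_zero.2 hn) ?_
  simp [schreierFam_one, schreier]

theorem singleton_mem_schreierFam (n : ℕ) (a : ℕ+) : {a} ∈ schreierFam n :=
  schreierFam_mono (Nat.zero_le n) ⟨a, rfl⟩

theorem familyOp_schreierFam_subset (s n : ℕ) :
    familyOp (schreierFam s) (schreierFam n) ⊆ schreierFam (s + n) := by
  induction s with
  | zero =>
    rintro F ⟨d, E, ⟨m, h1, ⟨p, hp⟩, -, -⟩, hE, rfl⟩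
    have hd : d = 1 := by
      have := congrArg Finset.card hp
      rwa [Finset.card_image_of_injective _ h1.injective, Finset.card_fin,
        Finset.card_singleton] at this
    subst hd
    simpa using hE 0
  | succ s ih =>
    rw [Nat.succ_add]
    exact (familyOp_familyOp_subset isLowerSet_schreier isSpreading_schreier).trans
      (familyOp_mono_right ih)

theorem isLowerSet_familyIter (hA : IsLowerSet A) (l : ℕ) : IsLowerSet (familyIter A l) := by
  unfold familyIter
  induction l - 1 with
  | zero => exact hA
  | succ n ih =>
    rw [Function.iterate_succ_apply']
    exact ih.familyOp

theorem isSpreading_familyIter (hA : IsLowerSet A) (hAs : IsSpreading A) (l : ℕ) :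
    IsSpreading (familyIter A l) := by
  unfold familyIter
  induction l - 1 with
  | zero => exact hAs
  | succ n ih =>
    rw [Function.iterate_succ_apply']
    exact hAs.familyOp hA ih

theorem subset_familyIter (hA : schreierFam 0 ⊆ A) (l : ℕ) : A ⊆ familyIter A l := by
  unfold familyIter
  induction l - 1 with
  | zero => exact subset_rfl
  | succ n ih =>
    rw [Function.iterate_succ_apply']
    exact subset_familyOp (hA.trans ih)

/-- Since `F_s[F_n] ⊆ F_{s+n}`, iterating `l` copies of `F_s` stays inside `F_{sl}`. -/
theorem familyIter_schreierFam_subset (s : ℕ) {l : ℕ} (hl : l ≠ 0) :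
    familyIter (schreierFam s) l ⊆ schreierFam (s * l) := by
  obtain ⟨l, rfl⟩ := Nat.exists_eq_succ_of_ne_zero hl
  unfold familyIter
  rw [Nat.succ_sub_one]
  clear hl
  induction l with
  | zero => simp
  | succ n ih =>
    rw [Function.iterate_succ_apply', show s * (n + 1).succ = s + s * n.succ by
      simp only [Nat.succ_eq_add_one]; ring]
    exact (familyOp_mono_right ih).trans (familyOp_schreierFam_subset _ _)

/-- Iterating `F ↦ A[F]` from the singletons stays inside the iterated family. -/
theorem iterate_familyOp_schreierFam_zero_subset (hA : IsLowerSet A) (hAs : IsSpreading A) {l : ℕ}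
    (hl : l ≠ 0) : (familyOp A)^[l] (schreierFam 0) ⊆ familyIter A l := by
  obtain ⟨l, rfl⟩ := Nat.exists_eq_succ_of_ne_zero hl
  unfold familyIter
  rw [Function.iterate_succ_apply, Nat.succ_sub_one]
  clear hl
  induction l with
  | zero => exact familyOp_schreierFam_zero_subset hA hAs
  | succ n ih =>
    rw [Function.iterate_succ_apply', Function.iterate_succ_apply']
    exact familyOp_mono_right ih

end familyOp

/-! ### The pairing and restrictions of finitely supported vectors -/

/-- The restriction of a finitely supported vector to a set of coordinates. -/
noncomputable def restr (E : Set ℕ+) (x : ℕ+ →₀ ℝ) : ℕ+ →₀ ℝ := E.indicator (1 : ℕ+ → ℝ) • x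

open scoped Classical in
theorem restr_apply (E : Set ℕ+) (x : ℕ+ →₀ ℝ) (n : ℕ+) :
    restr E x n = if n ∈ E then x n else 0 := by
  simp [restr, Set.indicator_apply]

theorem restr_apply_of_mem {E : Set ℕ+} {n : ℕ+} (h : n ∈ E) (x : ℕ+ →₀ ℝ) : restr E x n = x n := by
  simp [restr_apply, h]

theorem restr_apply_of_notMem {E : Set ℕ+} {n : ℕ+} (h : n ∉ E) (x : ℕ+ →₀ ℝ) :
    restr E x n = 0 := by
  simp [restr_apply, h]

theorem filter_eq_restr (p : ℕ+ → Prop) [DecidablePred p] (x : ℕ+ →₀ ℝ) :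
    x.filter p = restr {n | p n} x := by
  ext n
  simp [Finsupp.filter_apply, restr_apply]

theorem restr_eq_self {E : Set ℕ+} {x : ℕ+ →₀ ℝ} (h : (x.support : Set ℕ+) ⊆ E) :
    restr E x = x := by
  ext n
  by_cases hn : n ∈ E
  · exact restr_apply_of_mem hn x
  · rw [restr_apply_of_notMem hn]
    by_contra hx
    exact hn (h (Finsupp.mem_support_iff.2 (Ne.symm hx)))

theorem restr_restr (E F : Set ℕ+) (x : ℕ+ →₀ ℝ) : restr E (restr F x) = restr (E ∩ F) x := by
  classical
  ext n
  by_cases h1 : n ∈ E <;> by_cases h2 : n ∈ F <;> simp [restr_apply, h1, h2]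

theorem restr_smul (E : Set ℕ+) (c : ℝ) (x : ℕ+ →₀ ℝ) : restr E (c • x) = c • restr E x := by
  classical
  ext n
  simp [restr_apply]

theorem restr_sum {κ : Type*} (E : Set ℕ+) (s : Finset κ) (x : κ → ℕ+ →₀ ℝ) :
    restr E (∑ i ∈ s, x i) = ∑ i ∈ s, restr E (x i) := Finset.smul_sum

theorem support_restr_subset (E : Set ℕ+) (x : ℕ+ →₀ ℝ) :
    ((restr E x).support : Set ℕ+) ⊆ E := fun n hn => by
  by_contra h
  exact Finsupp.mem_support_iff.1 hn (restr_apply_of_notMem h x)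

theorem support_pointwise_smul_subset (τ : ℕ+ → ℝ) (x : ℕ+ →₀ ℝ) :
    (τ • x).support ⊆ x.support := fun n hn => by
  rw [Finsupp.mem_support_iff] at hn ⊢
  intro h
  simp [h] at hn

theorem pairing_eq_of_subset {s : Finset ℕ+} {f : ℕ+ →₀ ℝ} (h : f.support ⊆ s) (x : ℕ+ →₀ ℝ) :
    pairing f x = ∑ n ∈ s, f n * x n := by
  unfold pairing
  refine Finset.sum_subset h fun n _ hn => ?_
  simp [Finsupp.notMem_support_iff.mp hn]

theorem pairing_comm (f x : ℕ+ →₀ ℝ) : pairing f x = pairing x f := by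
  rw [TsirelsonData.pairing_eq]
  exact Finset.sum_congr rfl fun n _ => mul_comm _ _

theorem pairing_smul_left (c : ℝ) (f x : ℕ+ →₀ ℝ) : pairing (c • f) x = c * pairing f x := by
  rw [pairing_comm, TsirelsonData.pairing_smul, pairing_comm]

theorem pairing_sum_right {κ : Type*} (s : Finset κ) (f : ℕ+ →₀ ℝ) (x : κ → ℕ+ →₀ ℝ) :
    pairing f (∑ i ∈ s, x i) = ∑ i ∈ s, pairing f (x i) :=
  map_sum ({ toFun := pairing f
             map_zero' := by simp [pairing]
             map_add' := TsirelsonData.pairing_add f } : (ℕ+ →₀ ℝ) →+ ℝ) x s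

theorem pairing_sum_left {κ : Type*} (s : Finset κ) (f : κ → ℕ+ →₀ ℝ) (x : ℕ+ →₀ ℝ) :
    pairing (∑ i ∈ s, f i) x = ∑ i ∈ s, pairing (f i) x := by
  rw [pairing_comm, pairing_sum_right]
  exact Finset.sum_congr rfl fun i _ => pairing_comm _ _

theorem pairing_pointwise_smul (τ : ℕ+ → ℝ) (f x : ℕ+ →₀ ℝ) :
    pairing (τ • f) x = pairing f (τ • x) := by
  rw [pairing_eq_of_subset (support_pointwise_smul_subset τ f), pairing]
  refine Finset.sum_congr rfl fun n _ => ?_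
  simp only [Finsupp.coe_pointwise_smul, Pi.smul_apply', smul_eq_mul]
  ring

theorem pairing_restr (E : Set ℕ+) (f x : ℕ+ →₀ ℝ) :
    pairing (restr E f) x = pairing f (restr E x) := pairing_pointwise_smul _ f x

theorem pairing_eq_zero {f x : ℕ+ →₀ ℝ} (h : ∀ n ∈ f.support, n ∉ x.support) :
    pairing f x = 0 :=
  Finset.sum_eq_zero fun n hn => by simp [Finsupp.notMem_support_iff.1 (h n hn)]

theorem indicator_one_mem (E : Set ℕ+) (n : ℕ+) :
    E.indicator (1 : ℕ+ → ℝ) n = -1 ∨ E.indicator (1 : ℕ+ → ℝ) n = 0 ∨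
      E.indicator (1 : ℕ+ → ℝ) n = 1 := by
  by_cases h : n ∈ E <;> simp [h]

/-! ### The norming set and the norm of a mixed Tsirelson space -/

namespace TsirelsonData

variable {ι : Type} (T : TsirelsonData ι)

/-- The functionals `θ_j (f_1 + ⋯ + f_d)` with `f_i ∈ K` and `M_j`-admissible supports, that is, the
members of `K_j` that are produced by the `j`-th operation and are not merely unit vectors. -/
def Composite (j : ι) : Set (ℕ+ →₀ ℝ) :=
  {f | ∃ (d : ℕ) (g : Fin d → ℕ+ →₀ ℝ), 0 < d ∧ (∀ i, g i ∈ T.normingSet) ∧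
    Admissible (T.fam j) (fun i => (g i).support) ∧ f = T.weight j • ∑ i, g i}

theorem mem_normingSet {f : ℕ+ →₀ ℝ} : f ∈ T.normingSet ↔ ∃ j, f ∈ T.K j := Set.mem_iUnion

theorem mem_K {j : ι} {f : ℕ+ →₀ ℝ} : f ∈ T.K j ↔ ∃ n, f ∈ T.level n j := Set.mem_iUnion

theorem level_mono (j : ι) : Monotone fun n => T.level n j :=
  monotone_nat_of_le_succ fun _ _ hf => Or.inl hf

theorem composite_subset_K (j : ι) : T.Composite j ⊆ T.K j := by
  rintro f ⟨d, g, hd, hg, hadm, rfl⟩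
  have : ∀ i, ∃ j' n, g i ∈ T.level n j' := fun i => by
    obtain ⟨j', h⟩ := T.mem_normingSet.1 (hg i)
    exact ⟨j', T.mem_K.1 h⟩
  choose j' n hn using this
  refine T.mem_K.2 ⟨Finset.univ.sup n + 1, Or.inr ⟨d, g, hd, fun i => ⟨j' i, ?_⟩, hadm, rfl⟩⟩
  exact T.level_mono (j' i) (Finset.le_sup (Finset.mem_univ i)) (hn i)

theorem composite_subset_normingSet (j : ι) : T.Composite j ⊆ T.normingSet :=
  (T.composite_subset_K j).trans (T.K_subset j)

/-- Induction over the construction of the norming set: unit vectors up to sign, and the operations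
`θ_j (g_1 + ⋯ + g_d)`. -/
theorem K_induction {p : ι → (ℕ+ →₀ ℝ) → Prop}
    (hsingle : ∀ j k (c : ℝ), c = 1 ∨ c = -1 → p j (Finsupp.single k c))
    (hcomp : ∀ (j : ι) (d : ℕ) (g : Fin d → ℕ+ →₀ ℝ), 0 < d →
      (∀ i, ∃ j', g i ∈ T.K j' ∧ p j' (g i)) → Admissible (T.fam j) (fun i => (g i).support) →
      p j (T.weight j • ∑ i, g i)) {j : ι} {f : ℕ+ →₀ ℝ} (hf : f ∈ T.K j) : p j f := by
  obtain ⟨n, hf⟩ := T.mem_K.1 hf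
  clear * - hf hsingle hcomp
  induction n generalizing j f with
  | zero =>
    obtain ⟨k, rfl | rfl⟩ := hf
    · exact hsingle _ _ _ (Or.inl rfl)
    · exact hsingle _ _ _ (Or.inr rfl)
  | succ n ih =>
    obtain hf | ⟨d, g, hd, hg, hadm, rfl⟩ := hf
    · exact ih hf
    · refine hcomp j d g hd (fun i => ?_) hadm
      obtain ⟨j', hj'⟩ := hg i
      exact ⟨j', T.mem_K.2 ⟨n, hj'⟩, ih hj'⟩

theorem K_cases {j : ι} {f : ℕ+ →₀ ℝ} (hf : f ∈ T.K j) :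
    (∃ k, ∃ c : ℝ, (c = 1 ∨ c = -1) ∧ f = Finsupp.single k c) ∨ f ∈ T.Composite j :=
  T.K_induction (p := fun j f => (∃ k, ∃ c : ℝ, (c = 1 ∨ c = -1) ∧ f = Finsupp.single k c) ∨
      f ∈ T.Composite j) (fun _ k c hc => Or.inl ⟨k, c, hc, rfl⟩)
    (fun _ d g hd hg hadm => Or.inr ⟨d, g, hd,
      fun i => T.mem_normingSet.2 ⟨_, (hg i).choose_spec.1⟩, hadm, rfl⟩) hf

theorem composite_of_admOn {κ : Type*} [LinearOrder κ] {s : Finset κ} (hs : s.Nonempty)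
    {g : κ → ℕ+ →₀ ℝ} {j : ι} (hg : ∀ i ∈ s, g i ∈ T.normingSet)
    (h : AdmOn (T.fam j) s fun i => (g i).support) :
    T.weight j • ∑ i ∈ s, g i ∈ T.Composite j := by
  refine ⟨s.card, fun i => g (s.orderEmbOfFin rfl i), hs.card_pos,
    fun i => hg _ (Finset.orderEmbOfFin_mem s rfl i), h.admissible, ?_⟩
  rw [Finset.sum_orderEmbOfFin s g]

/-- `K_j ∪ {0}` is stable under multiplication by sequences with values in `{-1, 0, 1}`. -/
theorem pointwise_smul_mem_K (hA : ∀ j, IsLowerSet (T.fam j)) {τ : ℕ+ → ℝ}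
    (hτ : ∀ n, τ n = -1 ∨ τ n = 0 ∨ τ n = 1) {j : ι} {f : ℕ+ →₀ ℝ} (hf : f ∈ T.K j) :
    τ • f = 0 ∨ τ • f ∈ T.K j := by
  classical
  refine T.K_induction (p := fun j f => τ • f = 0 ∨ τ • f ∈ T.K j) ?_ ?_ hf
  · intro j k c hc
    have h1 := T.single_mem_K j k
    have h2 := T.K_neg_mem h1
    have h3 : τ • Finsupp.single k c = Finsupp.single k (τ k * c) := by
      ext n
      rcases eq_or_ne n k with rfl | hn
      · simp
      · simp [Finsupp.single_eq_of_ne hn]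
    rw [← Finsupp.single_neg] at h2
    rw [h3]
    rcases hτ k with h | h | h <;> rcases hc with rfl | rfl <;>
      simp [-Finsupp.single_neg, h, h1, h2]
  · intro j d g _ hg hadm
    set s := Finset.univ.filter fun i => τ • g i ≠ 0
    have hsum : τ • (T.weight j • ∑ i, g i) = T.weight j • ∑ i ∈ s, τ • g i := by
      rw [Finset.sum_filter_ne_zero, ← Finset.smul_sum]
      ext n
      simp only [Finsupp.coe_pointwise_smul, Pi.smul_apply', Finsupp.smul_apply, smul_eq_mul]
      ring
    rw [hsum]
    rcases s.eq_empty_or_nonempty with hs | hs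
    · left
      simp [hs]
    · right
      refine T.composite_subset_K j (T.composite_of_admOn hs (fun i hi => ?_) ?_)
      · obtain ⟨j', -, h⟩ := hg i
        exact T.K_subset j' (h.resolve_left (Finset.mem_filter.1 hi).2)
      · exact (hadm.admOn.subset (hA j) (Finset.subset_univ s)).mono
          fun i _ => support_pointwise_smul_subset τ _

theorem pointwise_smul_mem (hA : ∀ j, IsLowerSet (T.fam j)) {τ : ℕ+ → ℝ}
    (hτ : ∀ n, τ n = -1 ∨ τ n = 0 ∨ τ n = 1) {f : ℕ+ →₀ ℝ} (hf : f ∈ T.normingSet) :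
    τ • f = 0 ∨ τ • f ∈ T.normingSet := by
  obtain ⟨j, hj⟩ := T.mem_normingSet.1 hf
  exact (T.pointwise_smul_mem_K hA hτ hj).imp_right fun h => T.K_subset j h

section Norm

variable [Nonempty ι]

theorem tnorm_nonneg (x : ℕ+ →₀ ℝ) : 0 ≤ T.tnorm x := by
  rw [← norm_toPre]
  exact norm_nonneg _

theorem tnorm_zero : T.tnorm 0 = 0 := by
  rw [← norm_toPre, map_zero, norm_zero]

theorem tnorm_smul (c : ℝ) (x : ℕ+ →₀ ℝ) : T.tnorm (c • x) = |c| * T.tnorm x := by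
  rw [← norm_toPre, map_smul, norm_smul, norm_toPre, Real.norm_eq_abs]

theorem tnorm_sum_le {κ : Type*} (s : Finset κ) (x : κ → ℕ+ →₀ ℝ) :
    T.tnorm (∑ i ∈ s, x i) ≤ ∑ i ∈ s, T.tnorm (x i) := by
  simp only [← norm_toPre, map_sum]
  exact norm_sum_le _ _

theorem tnorm_pos {x : ℕ+ →₀ ℝ} (hx : x ≠ 0) : 0 < T.tnorm x := by
  rw [← norm_toPre, norm_pos_iff]
  simpa using hx

theorem norm_ofFinsupp (x : ℕ+ →₀ ℝ) : ‖T.ofFinsupp x‖ = T.tnorm x := by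
  rw [ofFinsupp, UniformSpace.Completion.norm_coe, norm_toPre]

theorem exists_lt_pairing {x : ℕ+ →₀ ℝ} {c : ℝ} (h : c < T.tnorm x) :
    ∃ f ∈ T.normingSet, c < pairing f x := by
  obtain ⟨_, ⟨f, hf, rfl⟩, hc⟩ := exists_lt_of_lt_csSup (T.normingSet_nonempty.image _) h
  exact ⟨f, hf, hc⟩

variable {T}

theorem tnorm_pointwise_smul_le (hA : ∀ j, IsLowerSet (T.fam j)) {τ : ℕ+ → ℝ}
    (hτ : ∀ n, τ n = -1 ∨ τ n = 0 ∨ τ n = 1) (x : ℕ+ →₀ ℝ) : T.tnorm (τ • x) ≤ T.tnorm x := by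
  refine T.tnorm_le fun f hf => ?_
  rw [← pairing_pointwise_smul]
  rcases T.pointwise_smul_mem hA hτ hf with h | h
  · rw [h]
    simpa [pairing] using T.tnorm_nonneg x
  · exact T.pairing_le_tnorm h x

theorem tnorm_restr_le (hA : ∀ j, IsLowerSet (T.fam j)) (E : Set ℕ+) (x : ℕ+ →₀ ℝ) :
    T.tnorm (restr E x) ≤ T.tnorm x :=
  tnorm_pointwise_smul_le hA (indicator_one_mem E) x

/-- Almost norming functionals of the pieces `E_i x` combine to a member of `K_j`. -/
theorem exists_composite_lt (hA : ∀ j, IsLowerSet (T.fam j)) {κ : Type*} [LinearOrder κ]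
    {s : Finset κ} {E : κ → Finset ℕ+} {j : ι} (h : AdmOn (T.fam j) s E) {x : ℕ+ →₀ ℝ} {c : ℝ}
    (hc : 0 ≤ c) (hlt : c < ∑ i ∈ s, T.tnorm (restr (E i) x)) :
    ∃ φ ∈ T.Composite j, T.weight j * c < pairing φ x := by
  classical
  set δ : ℝ := (∑ i ∈ s, T.tnorm (restr (E i) x) - c) / (s.card + 1) with hδ
  have hcard : (0 : ℝ) < s.card + 1 := by positivity
  have hδ0 : 0 < δ := div_pos (by linarith) hcard
  have key : ∀ i ∈ s, ∃ g : ℕ+ →₀ ℝ, (g = 0 ∨ g ∈ T.normingSet) ∧ g.support ⊆ E i ∧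
      T.tnorm (restr (E i) x) - δ ≤ pairing g x := by
    intro i _
    obtain ⟨f, hf, hlt⟩ := T.exists_lt_pairing (sub_lt_self (T.tnorm (restr (E i) x)) hδ0)
    refine ⟨restr (E i) f, T.pointwise_smul_mem hA (indicator_one_mem _) hf, ?_, ?_⟩
    · exact_mod_cast support_restr_subset (E i : Set ℕ+) f
    · rw [pairing_restr]
      exact hlt.le
  choose! g hg hgE hgx using key
  set t := s.filter fun i => g i ≠ 0
  have hsum : ∑ i ∈ t, pairing (g i) x = ∑ i ∈ s, pairing (g i) x := by
    rw [Finset.sum_filter]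
    refine Finset.sum_congr rfl fun i _ => ?_
    by_cases h0 : g i = 0 <;> simp [h0, pairing]
  have hbig : c < ∑ i ∈ t, pairing (g i) x := by
    have h1 : ∑ i ∈ s, (T.tnorm (restr (E i) x) - δ) ≤ ∑ i ∈ s, pairing (g i) x :=
      Finset.sum_le_sum hgx
    rw [Finset.sum_sub_distrib, Finset.sum_const, nsmul_eq_mul] at h1
    have h2 : (s.card + 1 : ℝ) * δ = ∑ i ∈ s, T.tnorm (restr (E i) x) - c := by
      rw [hδ]
      field_simp
    rw [hsum]
    linarith
  have ht : t.Nonempty := by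
    by_contra hne
    rw [Finset.not_nonempty_iff_eq_empty.1 hne, Finset.sum_empty] at hbig
    exact hbig.not_ge hc
  refine ⟨_, T.composite_of_admOn ht (fun i hi => ?_)
    ((h.subset (hA j) (Finset.filter_subset _ s)).mono
      fun i hi => hgE i (Finset.mem_filter.1 hi).1), ?_⟩
  · have := Finset.mem_filter.1 hi
    exact (hg i this.1).resolve_left this.2
  · rw [pairing_smul_left, pairing_sum_left]
    exact mul_lt_mul_of_pos_left hbig (T.weight_pos j)

theorem weight_mul_sum_le (hA : ∀ j, IsLowerSet (T.fam j)) {κ : Type*} [LinearOrder κ]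
    {s : Finset κ} {E : κ → Finset ℕ+} {j : ι} (h : AdmOn (T.fam j) s E) (x : ℕ+ →₀ ℝ) :
    T.weight j * ∑ i ∈ s, T.tnorm (restr (E i) x) ≤ T.tnorm x := by
  by_contra! hlt
  have hw := T.weight_pos j
  obtain ⟨φ, hφ, hlt'⟩ := exists_composite_lt hA h (c := T.tnorm x / T.weight j)
    (div_nonneg (T.tnorm_nonneg x) hw.le) ((div_lt_iff₀' hw).2 hlt)
  rw [mul_div_cancel₀ _ hw.ne'] at hlt'
  exact hlt'.not_ge (T.pairing_le_tnorm (T.composite_subset_normingSet j hφ) x)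

/-- For a hereditary spreading family, the upper estimate holds for successive sets that merely lie
to the right of the markers. -/
theorem weight_mul_sum_le_of_weak (hA : ∀ j, IsLowerSet (T.fam j)) {κ : Type*} [LinearOrder κ]
    {s : Finset κ} {E : κ → Finset ℕ+} {j : ι} (hs : IsSpreading (T.fam j)) {m : κ → ℕ+}
    (hm : StrictMonoOn m (s : Set κ)) (hmA : s.image m ∈ T.fam j)
    (h1 : ∀ i ∈ s, ∀ a ∈ E i, m i ≤ a)
    (h2 : ∀ i ∈ s, ∀ i' ∈ s, i < i' → ∀ a ∈ E i, ∀ b ∈ E i', a < b) (x : ℕ+ →₀ ℝ) :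
    T.weight j * ∑ i ∈ s, T.tnorm (restr (E i) x) ≤ T.tnorm x := by
  classical
  set t := s.filter fun i => (E i).Nonempty with ht
  have hts : t ⊆ s := Finset.filter_subset _ _
  have hadm : AdmOn (T.fam j) t E := AdmOn.of_weak hs (hm.mono (by exact_mod_cast hts))
    (hA j (Finset.image_subset_image hts) hmA) (fun i hi => h1 i (hts hi))
    (fun i hi i' hi' => h2 i (hts hi) i' (hts hi')) fun i hi => (Finset.mem_filter.1 hi).2
  have hsum : ∑ i ∈ t, T.tnorm (restr (E i) x) = ∑ i ∈ s, T.tnorm (restr (E i) x) := by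
    refine Finset.sum_subset hts fun i hi hit => ?_
    have : E i = ∅ := by
      by_contra hne
      exact hit (Finset.mem_filter.2 ⟨hi, Finset.nonempty_iff_ne_empty.2 hne⟩)
    rw [this, show restr (↑(∅ : Finset ℕ+)) x = 0 by ext n; simp [restr_apply], tnorm_zero]
  rw [← hsum]
  exact weight_mul_sum_le hA hadm x

/-- The implicit equation of the norm of a mixed Tsirelson space with hereditary families. -/
theorem isLUB_implicitValues (hA : ∀ j, IsLowerSet (T.fam j)) (x : ℕ+ →₀ ℝ) :
    IsLUB (T.implicitValues (fun y => ‖T.ofFinsupp y‖) x) ‖T.ofFinsupp x‖ := by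
  simp only [norm_ofFinsupp]
  constructor
  · rintro t (⟨n, rfl⟩ | ⟨k, d, E, hE, rfl⟩)
    · exact T.abs_apply_le_tnorm x n
    · have := weight_mul_sum_le hA hE.admOn x
      simp only [filter_eq_restr]
      exact this
  · intro b hb
    refine T.tnorm_le fun f hf => ?_
    obtain ⟨j, hj⟩ := T.mem_normingSet.1 hf
    rcases T.K_cases hj with ⟨k, c, hc, rfl⟩ | ⟨d, g, -, hg, hadm, rfl⟩
    · refine le_trans ?_ (hb (Or.inl ⟨k, rfl⟩))
      rw [pairing_single]
      refine (le_abs_self _).trans ?_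
      rcases hc with rfl | rfl <;> simp
    · refine le_trans ?_ (hb (Or.inr ⟨j, d, _, hadm, rfl⟩))
      rw [pairing_smul_left, pairing_sum_left]
      refine mul_le_mul_of_nonneg_left (Finset.sum_le_sum fun i _ => ?_) (T.weight_pos j).le
      rw [filter_eq_restr]
      refine le_trans (le_of_eq ?_) (T.pairing_le_tnorm (hg i) _)
      rw [← pairing_restr, restr_eq_self]
      intro n hn
      exact hn

end Norm

end TsirelsonData

/-! ### Repeated averages and the choice of the families -/

theorem exists_seq_of_invariant {α : Type*} {I : α → Prop} {R : α → α → Prop} {a₀ : α} (h₀ : I a₀)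
    (h : ∀ a, I a → ∃ b, I b ∧ R a b) :
    ∃ f : ℕ → α, f 0 = a₀ ∧ (∀ n, I (f n)) ∧ ∀ n, R (f n) (f (n + 1)) := by
  choose! g hg1 hg2 using h
  have hI : ∀ n, I (g^[n] a₀) := fun n => by
    induction n with
    | zero => exact h₀
    | succ n ih =>
      rw [Function.iterate_succ_apply']
      exact hg1 _ ih
  refine ⟨fun n => g^[n] a₀, rfl, hI, fun n => ?_⟩
  simp only [Function.iterate_succ_apply']
  exact hg2 _ (hI n)

theorem exists_forall_mem_lt (S : Finset ℕ+) : ∃ N : ℕ+, ∀ a ∈ S, a < N := by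
  obtain ⟨M, hM⟩ := S.bddAbove
  exact ⟨M + 1, fun a ha => (hM ha).trans_lt (PNat.lt_add_right M 1)⟩

theorem Set.Infinite.inter_Ici {D : Set ℕ+} (hD : D.Infinite) (N : ℕ+) :
    (D ∩ Set.Ici N).Infinite := by
  have : D ∩ Set.Ici N = D \ Set.Iio N := by
    ext a
    simp
  rw [this]
  exact hD.sdiff (Set.finite_Iio N)

/-- A convex combination of the unit vectors with support in `D` and in `F_{n+1}`, with decreasing
coefficients, such that every member of `F_n` has mass less than `ε`. -/
structure IsSpreadCombination (n : ℕ) (D : Set ℕ+) (ε : ℝ) (x : ℕ+ →₀ ℝ) : Prop where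
  nonneg : ∀ a, 0 ≤ x a
  sum_eq : ∑ a ∈ x.support, x a = 1
  subset : (x.support : Set ℕ+) ⊆ D
  support_mem : x.support ∈ schreierFam (n + 1)
  antitone : AntitoneOn x (x.support : Set ℕ+)
  mass_lt : ∀ G ∈ schreierFam n, ∑ a ∈ G, x a < ε

theorem IsSpreadCombination.support_nonempty {n : ℕ} {D : Set ℕ+} {ε : ℝ} {x : ℕ+ →₀ ℝ}
    (h : IsSpreadCombination n D ε x) : x.support.Nonempty := by
  by_contra hne
  have := h.sum_eq
  simp [Finset.not_nonempty_iff_eq_empty.1 hne] at this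

theorem sum_le_one_of_nonneg {x : ℕ+ →₀ ℝ} (h0 : ∀ a, 0 ≤ x a) (h1 : ∑ a ∈ x.support, x a = 1)
    (G : Finset ℕ+) : ∑ a ∈ G, x a ≤ 1 := by
  classical
  rw [← h1, ← Finset.sum_filter_of_ne (p := fun a => a ∈ x.support)
    fun a _ ha => Finsupp.mem_support_iff.2 ha]
  refine Finset.sum_le_sum_of_subset_of_nonneg (fun a ha => (Finset.mem_filter.1 ha).2)
    fun a _ _ => h0 a

/-- For order zero, `q` equal coefficients to the right of `q` suffice. -/
theorem exists_isSpreadCombination_zero {D : Set ℕ+} (hD : D.Infinite) {ε : ℝ} (hε : 0 < ε) :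
    ∃ x, IsSpreadCombination 0 D ε x := by
  classical
  obtain ⟨q, hq⟩ := exists_nat_one_div_lt hε
  obtain ⟨S, hS, hcard⟩ := (hD.inter_Ici q.succPNat).exists_subset_card_eq (q + 1)
  have hpos : (0 : ℝ) < 1 / (q + 1) := by positivity
  set x : ℕ+ →₀ ℝ := Finsupp.indicator S fun _ _ => 1 / ((q : ℝ) + 1) with hx
  have hxa : ∀ a, x a = if a ∈ S then 1 / ((q : ℝ) + 1) else 0 := fun a => by
    simp [hx, Finsupp.indicator_apply]
  have hsupp : x.support = S := by
    ext a
    rw [Finsupp.mem_support_iff, hxa]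
    by_cases h : a ∈ S <;> simp [h]
    positivity
  refine ⟨x, fun a => ?_, ?_, ?_, ?_, ?_, ?_⟩
  · rw [hxa]
    split_ifs <;> positivity
  · rw [hsupp, Finset.sum_congr rfl fun a ha => (hxa a).trans (if_pos ha), Finset.sum_const, hcard]
    simp only [nsmul_eq_mul, Nat.cast_add, Nat.cast_one]
    field_simp
  · rw [hsupp]
    exact hS.trans Set.inter_subset_left
  · rw [hsupp, schreierFam_one]
    intro a ha
    rw [hcard]
    have := (hS ha).2
    exact_mod_cast this
  · rw [hsupp]
    intro a ha b hb _
    rw [hxa, hxa, if_pos (by exact_mod_cast hb), if_pos (by exact_mod_cast ha)]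
  · rintro _ ⟨a, rfl⟩
    rw [Finset.sum_singleton, hxa]
    split_ifs <;> assumption

/-- The inductive step: an average of `q` successive combinations of order `n`, each of which has
small mass on the members of `F_n` compared with the end of the preceding one. -/
theorem exists_isSpreadCombination_succ {n : ℕ}
    (ih : ∀ D : Set ℕ+, D.Infinite → ∀ ε : ℝ, 0 < ε → ∃ x, IsSpreadCombination n D ε x)
    {D : Set ℕ+} (hD : D.Infinite) {ε : ℝ} (hε : 0 < ε) :
    ∃ x, IsSpreadCombination (n + 1) D ε x := by
  classical
  obtain ⟨q', hq'⟩ := exists_nat_one_div_lt (half_pos hε)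
  obtain ⟨q, hqq⟩ : ∃ q : ℕ, q = q' + 1 := ⟨_, rfl⟩
  have hq0 : (0 : ℝ) < q := by rw [hqq]; positivity
  have hqε : 2 / (q : ℝ) < ε := by
    rw [hqq]
    push_cast
    have : 2 / ((q' : ℝ) + 1) = 2 * (1 / ((q' : ℝ) + 1)) := by ring
    linarith
  -- A state consists of a combination, a strict upper bound of its support, and a positive lower
  -- bound of its coefficients.
  obtain ⟨f, hf0, hfI, hfR⟩ := exists_seq_of_invariant
    (α := (ℕ+ →₀ ℝ) × ℕ+ × ℝ) (I := fun st => 0 < st.2.2)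
    (R := fun st st' => IsSpreadCombination n (D ∩ Set.Ici st.2.1)
        (min st.2.2 (1 / (q * (st.2.1 : ℝ)))) st'.1 ∧ (∀ a ∈ st'.1.support, a < st'.2.1) ∧
        st.2.1 < st'.2.1 ∧ st'.2.2 ≤ st.2.2 ∧ ∀ a ∈ st'.1.support, st'.2.2 ≤ st'.1 a)
    (a₀ := (0, q'.succPNat, 1)) one_pos (by
      rintro ⟨x₀, N, δ⟩ hδ
      change 0 < δ at hδ
      have hN : (0 : ℝ) < (N : ℝ) := by exact_mod_cast N.pos
      obtain ⟨x, hx⟩ := ih _ (hD.inter_Ici N) (min δ (1 / (q * (N : ℝ))))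
        (lt_min hδ (by positivity))
      obtain ⟨N', hN'⟩ := exists_forall_mem_lt (insert N x.support)
      obtain ⟨a, ha, hamin⟩ := x.support.exists_min_image x hx.support_nonempty
      have hapos : 0 < x a := lt_of_le_of_ne (hx.nonneg a) (Finsupp.mem_support_iff.1 ha).symm
      exact ⟨(x, N', min δ (x a)), lt_min hδ hapos, hx,
        fun b hb => hN' b (Finset.mem_insert_of_mem hb), hN' N (Finset.mem_insert_self _ _),
        min_le_left _ _, fun b hb => (min_le_right _ _).trans (hamin b hb)⟩)
  set X : ℕ → ℕ+ →₀ ℝ := fun i => (f (i + 1)).1 with hX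
  set N : ℕ → ℕ+ := fun i => (f i).2.1 with hN
  set δ : ℕ → ℝ := fun i => (f i).2.2 with hδ
  have hXs : ∀ i, IsSpreadCombination n (D ∩ Set.Ici (N i))
      (min (δ i) (1 / (q * (N i : ℝ)))) (X i) := fun i => (hfR i).1
  have hXlt : ∀ i, ∀ a ∈ (X i).support, a < N (i + 1) := fun i => (hfR i).2.1
  have hNmono : StrictMono N := strictMono_nat_of_lt_succ fun i => (hfR i).2.2.1
  have hδanti : Antitone δ := antitone_nat_of_succ_le fun i => (hfR i).2.2.2.1
  have hδX : ∀ i, ∀ a ∈ (X i).support, δ (i + 1) ≤ X i a := fun i => (hfR i).2.2.2.2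
  have hXge : ∀ i, ∀ a ∈ (X i).support, N i ≤ a := fun i a ha => ((hXs i).subset ha).2
  have hXδ : ∀ i a, X i a ≤ δ i := fun i a => by
    have := (hXs i).mass_lt {a} (singleton_mem_schreierFam n a)
    rw [Finset.sum_singleton] at this
    exact this.le.trans (min_le_left _ _)
  have hNq : ∀ i, q ≤ N i := fun i => by
    have h0 : N 0 = q'.succPNat := by simp [hN, hf0]
    have h1 : (N 0 : ℕ) ≤ N i := by exact_mod_cast hNmono.monotone (Nat.zero_le i)
    rw [h0] at h1
    rw [hqq]
    exact h1
  have hlt : ∀ i j, i < j → ∀ a ∈ (X i).support, a < N j := fun i j hij a ha =>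
    (hXlt i a ha).trans_le (hNmono.monotone hij)
  have huniq : ∀ i j a, a ∈ (X i).support → a ∈ (X j).support → i = j := fun i j a hi hj => by
    rcases lt_trichotomy i j with h | h | h
    · exact absurd (hlt i j h a hi) (hXge j a hj).not_gt
    · exact h
    · exact absurd (hlt j i h a hj) (hXge i a hi).not_gt
  set z : ℕ+ →₀ ℝ := (1 / (q : ℝ)) • ∑ i ∈ Finset.range q, X i with hz
  have hza : ∀ a, z a = 1 / (q : ℝ) * ∑ i ∈ Finset.range q, X i a := fun a => by
    simp [hz]
  have hzX : ∀ i, i < q → ∀ a ∈ (X i).support, z a = 1 / (q : ℝ) * X i a := fun i hi a ha => by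
    rw [hza, Finset.sum_eq_single i]
    · intro j _ hji
      by_contra hne
      exact hji (huniq j i a (Finsupp.mem_support_iff.2 hne) ha)
    · intro h
      exact absurd (Finset.mem_range.2 hi) h
  have hsupp : z.support = (Finset.range q).biUnion fun i => (X i).support := by
    ext a
    simp only [Finset.mem_biUnion, Finset.mem_range]
    constructor
    · intro ha
      by_contra! hno
      refine Finsupp.mem_support_iff.1 ha ?_
      rw [hza, Finset.sum_eq_zero, mul_zero]
      intro i hi
      exact Finsupp.notMem_support_iff.1 (hno i (Finset.mem_range.1 hi))
    · rintro ⟨i, hi, ha⟩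
      rw [Finsupp.mem_support_iff, hzX i hi a ha]
      exact mul_ne_zero (by positivity) (Finsupp.mem_support_iff.1 ha)
  have hmem : ∀ a ∈ z.support, ∃ i < q, a ∈ (X i).support := fun a ha => by
    rw [hsupp] at ha
    simpa using ha
  refine ⟨z, fun a => ?_, ?_, ?_, ?_, ?_, ?_⟩
  · rw [hza]
    exact mul_nonneg (by positivity) (Finset.sum_nonneg fun i _ => (hXs i).nonneg a)
  · simp only [hza]
    rw [← Finset.mul_sum, Finset.sum_comm]
    have : ∀ i ∈ Finset.range q, ∑ a ∈ z.support, X i a = 1 := fun i hi => by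
      rw [← (hXs i).sum_eq]
      refine (Finset.sum_subset ?_ fun a _ ha => Finsupp.notMem_support_iff.1 ha).symm
      rw [hsupp]
      exact Finset.subset_biUnion_of_mem (fun i => (X i).support) hi
    rw [Finset.sum_congr rfl this, Finset.sum_const, Finset.card_range, nsmul_eq_mul, mul_one]
    field_simp
  · intro a ha
    obtain ⟨i, -, hi⟩ := hmem a ha
    exact ((hXs i).subset hi).1
  · rw [hsupp]
    refine AdmOn.biUnion_mem (A := schreier) ⟨N, hNmono.strictMonoOn _, ?_, fun i _ => hXge i,
      fun i _ j _ hij => hlt i j hij⟩ fun i _ => (hXs i).support_mem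
    intro a ha
    obtain ⟨i, -, rfl⟩ := Finset.mem_image.1 ha
    exact Finset.card_image_le.trans ((Finset.card_range q).le.trans (hNq i))
  · intro a ha b hb hab
    obtain ⟨i, hi, hai⟩ := hmem a ha
    obtain ⟨j, hj, hbj⟩ := hmem b hb
    rw [hzX i hi a hai, hzX j hj b hbj]
    refine mul_le_mul_of_nonneg_left ?_ (by positivity)
    rcases lt_trichotomy i j with h | rfl | h
    · exact (hXδ j b).trans ((hδanti h).trans (hδX i a hai))
    · exact (hXs i).antitone hai hbj hab
    · exact absurd (hlt j i h b hbj) (not_lt.2 ((hXge i a hai).trans hab))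
  · intro G hG
    -- After the first block that meets `G`, the number of pieces of `G` is controlled.
    have hsmall : ∀ i j, i < j → (∃ a ∈ G, a ∈ (X i).support) → ∑ a ∈ G, X j a ≤ 1 / q := by
      rintro i j hij ⟨a, haG, hai⟩
      obtain ⟨d, s, E, hE, hEB, -, rfl⟩ := exists_admOn_of_mem_familyOp isLowerSet_schreier hG
      have hdisj : (s : Set (Fin d)).PairwiseDisjoint E := by
        intro u hu v hv huv
        refine Finset.disjoint_left.2 fun b hbu hbv => ?_
        rcases lt_or_gt_of_ne huv with h | h
        · exact (hE.lt hu hv h hbu hbv).false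
        · exact (hE.lt hv hu h hbv hbu).false
      obtain ⟨u, hu, hau⟩ := Finset.mem_biUnion.1 haG
      obtain ⟨m, h1, h2, h3, -⟩ := hE
      have hcard : s.card ≤ (N j : ℕ) := by
        have h4 := h2 (m u) (Finset.mem_image_of_mem m hu)
        rw [Finset.card_image_of_injOn h1.injOn] at h4
        have h5 : m u ≤ N j := (h3 u hu a hau).trans (hlt i j hij a hai).le
        exact h4.trans (by exact_mod_cast h5)
      have hNj : (0 : ℝ) < (N j : ℝ) := by exact_mod_cast (N j).pos
      rw [Finset.sum_biUnion hdisj]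
      calc ∑ v ∈ s, ∑ a ∈ E v, X j a ≤ ∑ v ∈ s, 1 / (q * (N j : ℝ)) :=
            Finset.sum_le_sum fun v hv =>
              ((hXs j).mass_lt (E v) (hEB v hv)).le.trans (min_le_right _ _)
        _ = s.card * (1 / (q * (N j : ℝ))) := by rw [Finset.sum_const, nsmul_eq_mul]
        _ ≤ (N j : ℝ) * (1 / (q * (N j : ℝ))) :=
            mul_le_mul_of_nonneg_right (by exact_mod_cast hcard) (by positivity)
        _ = 1 / q := by field_simp
    have htotal : ∑ i ∈ Finset.range q, ∑ a ∈ G, X i a ≤ 2 := by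
      by_cases hex : ∃ i, ∃ a ∈ G, a ∈ (X i).support
      · set i₀ := Nat.find hex
        have hb : ∀ i ∈ Finset.range q, ∑ a ∈ G, X i a ≤
            (if i = i₀ then 1 else 0) + 1 / (q : ℝ) := by
          intro i _
          rcases lt_trichotomy i i₀ with h | h | h
          · rw [Finset.sum_eq_zero, if_neg h.ne]
            · positivity
            · intro a ha
              have := Nat.find_min hex h
              push Not at this
              exact Finsupp.notMem_support_iff.1 (this a ha)
          · rw [if_pos h]
            have := sum_le_one_of_nonneg (hXs i).nonneg (hXs i).sum_eq G
            have hq1 : 0 ≤ 1 / (q : ℝ) := by positivity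
            linarith
          · rw [if_neg h.ne', zero_add]
            exact hsmall i₀ i h (Nat.find_spec hex)
        refine (Finset.sum_le_sum hb).trans ?_
        rw [Finset.sum_add_distrib, Finset.sum_const, Finset.card_range, nsmul_eq_mul,
          mul_one_div_cancel hq0.ne', Finset.sum_ite_eq']
        split_ifs <;> norm_num
      · push Not at hex
        rw [Finset.sum_eq_zero]
        · norm_num
        · exact fun i _ => Finset.sum_eq_zero fun a ha =>
            Finsupp.notMem_support_iff.1 (hex i a ha)
    simp only [hza]
    rw [← Finset.mul_sum, Finset.sum_comm]
    refine lt_of_le_of_lt (mul_le_mul_of_nonneg_left htotal (by positivity)) ?_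
    rwa [one_div_mul_eq_div]

theorem exists_isSpreadCombination (n : ℕ) : ∀ D : Set ℕ+, D.Infinite → ∀ ε : ℝ, 0 < ε →
    ∃ x, IsSpreadCombination n D ε x := by
  induction n with
  | zero => exact fun D hD ε hε => exists_isSpreadCombination_zero hD hε
  | succ n ih => exact fun D hD ε hε => exists_isSpreadCombination_succ ih hD hε

/-- A functional of the norming set of `T[F_k, 1/2]` exceeds `2^{-N}` only on a member of
`F_{kN+1}`: each operation halves the coefficients. -/
theorem exists_mem_schreierFam_abs_le (k N : ℕ) : ∀ f ∈ (schreierHalf k).normingSet,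
    ∃ G ∈ schreierFam (k * N + 1), ∀ a ∉ G, |f a| ≤ (1 / 2) ^ N := by
  classical
  induction N with
  | zero =>
    intro f hf
    exact ⟨∅, empty_mem_schreierFam (by simp), fun a _ => by
      simpa using (schreierHalf k).abs_le_of_mem hf a⟩
  | succ N ih =>
    intro f hf
    obtain ⟨j, hj⟩ := (schreierHalf k).mem_normingSet.1 hf
    rcases (schreierHalf k).K_cases hj with ⟨b, c, -, rfl⟩ | ⟨d, g, -, hg, hadm, rfl⟩
    · refine ⟨{b}, singleton_mem_schreierFam _ b, fun a ha => ?_⟩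
      rw [Finset.notMem_singleton] at ha
      rw [Finsupp.single_eq_of_ne ha, abs_zero]
      positivity
    · choose G hG hGa using fun i => ih (g i) (hg i)
      have hmem : (Finset.univ.biUnion fun i => G i ∩ (g i).support) ∈
          familyOp (schreierFam k) (schreierFam (k * N + 1)) :=
        AdmOn.biUnion_mem (hadm.admOn.mono fun i _ => Finset.inter_subset_right)
          fun i _ => isLowerSet_schreierFam (by simp) Finset.inter_subset_left (hG i)
      refine ⟨_, by
        have := familyOp_schreierFam_subset _ _ hmem
        rwa [show k + (k * N + 1) = k * (N + 1) + 1 by ring] at this, fun a ha => ?_⟩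
      simp only [Finset.mem_biUnion, Finset.mem_univ, true_and, Finset.mem_inter, not_exists,
        not_and] at ha
      have hw : (schreierHalf k).weight j = 1 / 2 := rfl
      rw [Finsupp.smul_apply, Finsupp.finsetSum_apply, hw, smul_eq_mul, abs_mul, pow_succ',
        abs_of_pos (by norm_num : (0 : ℝ) < 1 / 2)]
      refine mul_le_mul_of_nonneg_left ?_ (by norm_num)
      by_cases hex : ∃ i, a ∈ (g i).support
      · obtain ⟨i, hi⟩ := hex
        rw [Finset.sum_eq_single i]
        · exact hGa i a fun h => ha i h hi
        · intro i' _ hne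
          by_contra hc
          exact hne (TsirelsonData.admissible_disjoint hadm (Finsupp.mem_support_iff.2 hc) hi)
        · simp
      · push Not at hex
        rw [Finset.sum_eq_zero fun i _ => Finsupp.notMem_support_iff.1 (hex i), abs_zero]
        positivity

theorem exists_hasSmallConvexCombinations (k : ℕ) {ε : ℝ} (hε : 0 < ε) :
    ∃ s, k < s ∧ HasSmallConvexCombinations s k ε := by
  classical
  obtain ⟨N, hN⟩ := exists_pow_lt_of_lt_one (half_pos hε) (by norm_num : (1 / 2 : ℝ) < 1)
  refine ⟨k * N + 1 + k + 1, by omega, fun D hD => ?_⟩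
  obtain ⟨x, hx⟩ := exists_isSpreadCombination (k * N + 1 + k) D hD (ε / 2) (half_pos hε)
  refine ⟨x, hx.nonneg, hx.sum_eq, hx.subset, hx.support_mem, hx.antitone, ?_⟩
  refine lt_of_le_of_lt ((schreierHalf k).tnorm_le (c := ε / 2 + (1 / 2) ^ N) fun f hf => ?_)
    (by linarith)
  obtain ⟨G, hG, hGa⟩ := exists_mem_schreierFam_abs_le k N f hf
  rw [TsirelsonData.pairing_eq]
  have hterm : ∀ a ∈ x.support, f a * x a ≤ (if a ∈ G then x a else 0) + (1 / 2) ^ N * x a := by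
    intro a _
    have h0 := hx.nonneg a
    have hp : (0 : ℝ) ≤ (1 / 2) ^ N * x a := mul_nonneg (by positivity) h0
    split_ifs with h
    · have := (abs_le.1 ((schreierHalf k).abs_le_of_mem hf a)).2
      nlinarith
    · have := mul_le_mul_of_nonneg_right ((le_abs_self _).trans (hGa a h)) h0
      linarith
  refine (Finset.sum_le_sum hterm).trans ?_
  rw [Finset.sum_add_distrib, ← Finset.mul_sum, hx.sum_eq, mul_one, ← Finset.sum_filter]
  refine add_le_add_left (le_trans ?_
    (hx.mass_lt G (schreierFam_mono (by omega) hG)).le) _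
  exact Finset.sum_le_sum_of_subset_of_nonneg (fun a ha => (Finset.mem_filter.1 ha).2)
    fun a _ _ => hx.nonneg a

/-- The inductive choice: given `k_j`, the number `s_{j+1}` comes from the repeated averages, and
`k_{j+1} = s_{j+1} l_{j+1}` works since `F_s[⋯[F_s]⋯]` with `l` copies lies in `F_{sl}`. -/
theorem exists_xuChoice {m : ℕ → ℕ} (hm : IsFastSeq m) : ∃ C : XuChoice, C.m = m := by
  have hm0 : ∀ j, (0 : ℝ) < m j := fun j => by
    exact_mod_cast lt_of_lt_of_le two_pos (hm.two_le j)
  choose S hS1 hS2 using fun k j : ℕ => exists_hasSmallConvexCombinations k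
    (ε := 1 / (m (j + 2) : ℝ) ^ 4) (by have := hm0 (j + 2); positivity)
  choose l hl using fun j => exists_pow_lt_of_lt_one
    (show (0 : ℝ) < 1 / (2 * (m j : ℝ)) by have := hm0 j; positivity)
    (by norm_num : (1 / 2 : ℝ) < 1)
  have hl0 : ∀ j, l j ≠ 0 := fun j h => by
    have h1 := hl j
    have h2 : (2 : ℝ) ≤ m j := by exact_mod_cast hm.two_le j
    rw [h, pow_zero, lt_div_iff₀ (by linarith)] at h1
    linarith
  let k : ℕ → ℕ := fun j => Nat.rec 1 (fun j k => S k j * l (j + 1)) j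
  let s : ℕ → ℕ := fun j => Nat.casesOn j 0 fun j => S (k j) j
  let M : ℕ → Set (Finset ℕ+) := fun j =>
    Nat.casesOn j (schreierFam 1) fun j => familyIter (schreierFam (s (j + 1))) (l (j + 1))
  refine ⟨⟨m, hm, k, s, l, M, rfl, ?_, ?_, fun j => hS1 _ _, fun j => hS2 _ _, fun j => ?_,
    fun j => rfl⟩, rfl⟩
  · rintro (_ | j)
    · exact subset_rfl
    · exact familyIter_schreierFam_subset _ (hl0 _)
  · intro j
    exact (schreierFam_mono (hS1 (k j) j).le).trans
      (subset_familyIter (schreierFam_mono (Nat.zero_le _)) _)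
  · have := hl (j + 1)
    rwa [one_div_pow] at this

/-! ### The unit vector basis -/

namespace TsirelsonData

variable {ι : Type} (T : TsirelsonData ι) [Nonempty ι]

/-- The inclusion of `c₀₀` into the mixed Tsirelson space as a linear map. -/
noncomputable def ofFinsuppₗ : (ℕ+ →₀ ℝ) →ₗ[ℝ] T.Space :=
  (UniformSpace.Completion.toComplₗᵢ (𝕜 := ℝ) (E := T.Pre)).toLinearMap ∘ₗ T.toPre.toLinearMap

theorem ofFinsuppₗ_apply (x : ℕ+ →₀ ℝ) : T.ofFinsuppₗ x = T.ofFinsupp x := rfl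

theorem denseRange_ofFinsupp : DenseRange T.ofFinsupp := by
  have h : DenseRange ((↑) : T.Pre → T.Space) := UniformSpace.Completion.denseRange_coe
  exact h.comp T.toPre.surjective.denseRange (UniformSpace.Completion.continuous_coe _)

theorem exists_norm_sub_ofFinsupp_lt (x : T.Space) {ε : ℝ} (hε : 0 < ε) :
    ∃ y, ‖x - T.ofFinsupp y‖ < ε := by
  obtain ⟨y, hy⟩ := T.denseRange_ofFinsupp.exists_dist_lt x hε
  exact ⟨y, by rwa [← dist_eq_norm]⟩

theorem sum_smul_e (A : Finset ℕ+) (a : ℕ+ → ℝ) :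
    ∑ n ∈ A, a n • T.e n = T.ofFinsupp (∑ n ∈ A, Finsupp.single n (a n)) := by
  rw [← ofFinsuppₗ_apply, map_sum]
  refine Finset.sum_congr rfl fun n _ => ?_
  rw [← mul_one (a n), ← smul_eq_mul, ← Finsupp.smul_single, map_smul, smul_eq_mul, mul_one]
  rfl

/-- The projection of the mixed Tsirelson space onto a finite set of coordinates. -/
noncomputable def coordProj (A : Finset ℕ+) (x : T.Space) : T.Space :=
  ∑ n ∈ A, T.functional (Finsupp.single n 1) x • T.e n

theorem coordProj_ofFinsupp (A : Finset ℕ+) (x : ℕ+ →₀ ℝ) :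
    T.coordProj A (T.ofFinsupp x) = T.ofFinsupp (restr A x) := by
  classical
  rw [coordProj, sum_smul_e]
  congr 1
  ext k
  simp only [functional_ofFinsupp, pairing_single, one_mul, Finsupp.finsetSum_apply,
    Finsupp.single_apply, restr_apply, Finset.mem_coe]
  rw [Finset.sum_ite_eq' A k]

theorem coordProj_sub (A : Finset ℕ+) (x y : T.Space) :
    T.coordProj A (x - y) = T.coordProj A x - T.coordProj A y := by
  simp only [coordProj, map_sub, sub_smul, Finset.sum_sub_distrib]

variable {T}

theorem norm_coordProj_le (hA : ∀ j, IsLowerSet (T.fam j)) (A : Finset ℕ+) (x : T.Space) :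
    ‖T.coordProj A x‖ ≤ ‖x‖ := by
  refine T.denseRange_ofFinsupp.induction_on (p := fun x => ‖T.coordProj A x‖ ≤ ‖x‖) x ?_ ?_
  · refine isClosed_le ?_ (by fun_prop)
    unfold coordProj
    fun_prop
  · intro y
    rw [coordProj_ofFinsupp, norm_ofFinsupp, norm_ofFinsupp]
    exact tnorm_restr_le hA _ y

theorem isOneUnconditionalBasis (hA : ∀ j, IsLowerSet (T.fam j)) : IsOneUnconditionalBasis T.e := by
  classical
  refine ⟨⟨⟨T.e, fun n => T.functional (Finsupp.single n 1), fun i j => ?_, fun x => ?_⟩,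
    fun n => rfl⟩, fun A a σ hσ => ?_⟩
  · rw [e, functional_ofFinsupp, pairing_single, one_mul]
    rcases eq_or_ne i j with rfl | hij
    · simp
    · rw [Finsupp.single_eq_of_ne hij]
      simp [hij]
  · change Filter.Tendsto (fun A => T.coordProj A x) Filter.atTop _
    rw [Metric.tendsto_atTop]
    intro ε hε
    obtain ⟨y, hy⟩ := T.exists_norm_sub_ofFinsupp_lt x (half_pos hε)
    refine ⟨y.support, fun A hAy => ?_⟩
    have h1 : T.coordProj A (T.ofFinsupp y) = T.ofFinsupp y := by
      rw [coordProj_ofFinsupp, restr_eq_self (by exact_mod_cast hAy)]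
    have h2 : T.coordProj A x - x = T.coordProj A (x - T.ofFinsupp y) - (x - T.ofFinsupp y) := by
      rw [coordProj_sub, h1]
      abel
    rw [dist_eq_norm, h2]
    have h3 := norm_sub_le (T.coordProj A (x - T.ofFinsupp y)) (x - T.ofFinsupp y)
    have h4 := norm_coordProj_le hA A (x - T.ofFinsupp y)
    linarith
  · have hσ' : ∀ n, σ n = -1 ∨ σ n = 0 ∨ σ n = 1 := fun n => by
      rcases hσ n with h | h <;> simp [h]
    set v : ℕ+ →₀ ℝ := ∑ n ∈ A, Finsupp.single n (a n) with hv
    have h1 : ∑ n ∈ A, Finsupp.single n (σ n * a n) = σ • v := by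
      rw [hv, Finset.smul_sum]
      refine Finset.sum_congr rfl fun n _ => ?_
      ext k
      rcases eq_or_ne k n with rfl | hk
      · simp
      · simp [Finsupp.single_eq_of_ne hk]
    have h2 : σ • σ • v = v := by
      ext k
      rcases hσ k with h | h <;> simp [h]
    rw [sum_smul_e T A fun n => σ n * a n, sum_smul_e, norm_ofFinsupp, norm_ofFinsupp, h1, ← hv]
    refine le_antisymm (tnorm_pointwise_smul_le hA hσ' v) ?_
    conv_lhs => rw [← h2]
    exact tnorm_pointwise_smul_le hA hσ' _

end TsirelsonData

namespace XuChoice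

variable (C : XuChoice)

theorem s_ne_zero (j : ℕ) : C.s (j + 1) ≠ 0 := (Nat.zero_le _).trans_lt (C.lt_s j) |>.ne'

theorem isLowerSet_M (j : ℕ) : IsLowerSet (C.M j) := by
  cases j with
  | zero =>
    rw [C.M_zero]
    exact isLowerSet_schreierFam one_ne_zero
  | succ j =>
    rw [C.M_succ]
    exact isLowerSet_familyIter (isLowerSet_schreierFam (C.s_ne_zero j)) _

theorem isLowerSet_fam (j : ℕ) : IsLowerSet (C.data.fam j) := C.isLowerSet_M j

theorem two_le_m (j : ℕ) : (2 : ℝ) ≤ C.m j := by exact_mod_cast C.fast.two_le j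

theorem m_pos (j : ℕ) : (0 : ℝ) < C.m j := two_pos.trans_le (C.two_le_m j)

theorem pow_lt_m_succ (j : ℕ) : (C.m j : ℝ) ^ C.m j < C.m (j + 1) := by
  exact_mod_cast C.fast.succ j

theorem sq_le_m_succ (j : ℕ) : (C.m j : ℝ) ^ 2 ≤ C.m (j + 1) :=
  (pow_le_pow_right₀ (by linarith [C.two_le_m j]) (C.fast.two_le j)).trans (C.pow_lt_m_succ j).le

theorem m_strictMono : StrictMono C.m := strictMono_nat_of_lt_succ fun j =>
  (Nat.le_self_pow (by have := C.fast.two_le j; omega) _).trans_lt (C.fast.succ j)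

theorem M_mono : Monotone C.M := monotone_nat_of_le_succ fun j =>
  (C.M_subset j).trans (C.subset_M j)

theorem k_ne_zero (j : ℕ) : C.k j ≠ 0 := fun h => by
  have h1 : schreierFam 1 ⊆ C.M j := C.M_zero ▸ C.M_mono (Nat.zero_le j)
  obtain ⟨n, hn⟩ : ∅ ∈ schreierFam 0 :=
    h ▸ C.M_subset j (h1 (empty_mem_schreierFam one_ne_zero))
  exact Finset.singleton_ne_empty n hn.symm

theorem weight_eq (j : ℕ) : C.data.weight j = 1 / (C.m j : ℝ) := rfl

end XuChoice

/-! ### Successive vectors with markers -/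

/-- The vectors `w t`, `t ∈ A`, are successive: `w t` is supported in `[lo t, t)`, and these
intervals are successive. Thus every vector is labelled by a marker strictly above its support. -/
structure Marked (A : Finset ℕ+) (lo : ℕ+ → ℕ+) (w : ℕ+ → ℕ+ →₀ ℝ) : Prop where
  lo_lt : ∀ t ∈ A, lo t < t
  le_lo : ∀ t ∈ A, ∀ t' ∈ A, t < t' → t ≤ lo t'
  supp : ∀ t ∈ A, ∀ a ∈ (w t).support, lo t ≤ a ∧ a < t

/-- The combination `∑ b_t w_t` over the markers `t ∈ J`. -/
noncomputable def combo (b : ℕ+ →₀ ℝ) (w : ℕ+ → ℕ+ →₀ ℝ) (J : Finset ℕ+) : ℕ+ →₀ ℝ :=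
  ∑ t ∈ J, b t • w t

theorem pairing_combo (f b : ℕ+ →₀ ℝ) (w : ℕ+ → ℕ+ →₀ ℝ) (J : Finset ℕ+) :
    pairing f (combo b w J) = ∑ t ∈ J, b t * pairing f (w t) := by
  rw [combo, pairing_sum_right]
  simp only [TsirelsonData.pairing_smul]

namespace Marked

variable {A : Finset ℕ+} {lo : ℕ+ → ℕ+} {w : ℕ+ → ℕ+ →₀ ℝ}

theorem strictMonoOn_lo (h : Marked A lo w) : StrictMonoOn lo (A : Set ℕ+) :=
  fun t ht t' ht' htt => (h.lo_lt t ht).trans_le (h.le_lo t ht t' ht' htt)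

theorem eq_of_mem (h : Marked A lo w) {t t' a : ℕ+} (ht : t ∈ A) (ht' : t' ∈ A)
    (h1 : lo t ≤ a) (h2 : a < t) (h1' : lo t' ≤ a) (h2' : a < t') : t = t' := by
  rcases lt_trichotomy t t' with hlt | heq | hlt
  · exact absurd (h2.trans_le (h.le_lo t ht t' ht' hlt)) (not_lt.2 h1')
  · exact heq
  · exact absurd (h2'.trans_le (h.le_lo t' ht' t ht hlt)) (not_lt.2 h1)

theorem combo_apply (h : Marked A lo w) (b : ℕ+ →₀ ℝ) {t a : ℕ+} (ht : t ∈ A) (h1 : lo t ≤ a)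
    (h2 : a < t) : combo b w A a = b t * w t a := by
  rw [combo, Finsupp.finsetSum_apply, Finset.sum_eq_single t]
  · simp
  · intro t' ht' hne
    have : w t' a = 0 := by
      by_contra hc
      obtain ⟨h1', h2'⟩ := h.supp t' ht' a (Finsupp.mem_support_iff.2 hc)
      exact hne (h.eq_of_mem ht' ht h1' h2' h1 h2)
    simp [this]
  · exact fun hn => absurd ht hn

/-- The lower markers of all vectors but the first one are a spread of the upper markers of all
vectors but the last one. -/
theorem image_lo_mem (h : Marked A lo w) (hne : A.Nonempty) {F : Set (Finset ℕ+)}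
    (hF : IsLowerSet F) (hFs : IsSpreading F) (hA : A ∈ F) :
    (A.erase (A.min' hne)).image lo ∈ F := by
  classical
  set s := A.erase (A.min' hne) with hs
  have hsA : s ⊆ A := Finset.erase_subset _ _
  have hprev : ∀ t ∈ s, ∃ t' ∈ A, t' < t ∧ ∀ u ∈ A, u < t → u ≤ t' := by
    intro t ht
    have hn : (A.filter (· < t)).Nonempty := ⟨A.min' hne, Finset.mem_filter.2
      ⟨A.min'_mem hne, lt_of_le_of_ne (A.min'_le t (hsA ht)) (Finset.ne_of_mem_erase ht).symm⟩⟩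
    have h1 := Finset.mem_filter.1 (Finset.max'_mem _ hn)
    exact ⟨_, h1.1, h1.2, fun u hu hut => Finset.le_max' _ u (Finset.mem_filter.2 ⟨hu, hut⟩)⟩
  choose! prev hp1 hp2 hp3 using hprev
  have hmono : StrictMonoOn prev (s : Set ℕ+) := fun t ht t' ht' htt =>
    (hp2 t ht).trans_le (hp3 t' ht' t (hsA ht) htt)
  refine hFs.image_mem hmono (h.strictMonoOn_lo.mono (by exact_mod_cast hsA))
    (fun t ht => h.le_lo _ (hp1 t ht) t (hsA ht) (hp2 t ht)) (hF ?_ hA)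
  intro t ht
  obtain ⟨t', ht', rfl⟩ := Finset.mem_image.1 ht
  exact hp1 t' ht'

end Marked

/-! ### Splitting a functional along successive vectors -/

namespace TsirelsonData

variable {ι : Type} {T : TsirelsonData ι}

theorem abs_apply_le_weight {i : ι} {f : ℕ+ →₀ ℝ} (hf : f ∈ T.Composite i) (k : ℕ+) :
    |f k| ≤ T.weight i := by
  obtain ⟨d, g, -, hg, hadm, rfl⟩ := hf
  rw [Finsupp.smul_apply, Finsupp.finsetSum_apply, smul_eq_mul, abs_mul,
    abs_of_pos (T.weight_pos i)]
  refine mul_le_of_le_one_right (T.weight_pos i).le ?_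
  by_cases hk : ∃ s, k ∈ (g s).support
  · obtain ⟨s, hs⟩ := hk
    rw [Finset.sum_eq_single s]
    · exact T.abs_le_of_mem (hg s) k
    · intro s' _ hne
      by_contra hc
      exact hne (admissible_disjoint hadm (Finsupp.mem_support_iff.mpr hc) hs)
    · simp
  · push Not at hk
    rw [Finset.sum_eq_zero fun s _ => Finsupp.notMem_support_iff.mp (hk s)]
    simp

theorem abs_pairing_le_weight_mul {i : ι} {f : ℕ+ →₀ ℝ} (hf : f ∈ T.Composite i) (x : ℕ+ →₀ ℝ) :
    |pairing f x| ≤ T.weight i * ∑ n ∈ x.support, |x n| := by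
  rw [pairing_eq, Finset.mul_sum]
  refine (Finset.abs_sum_le_sum_abs _ _).trans (Finset.sum_le_sum fun n _ => ?_)
  rw [abs_mul]
  exact mul_le_mul_of_nonneg_right (abs_apply_le_weight hf n) (abs_nonneg _)

theorem isLowerSet_schreierHalf {κ : ℕ} (hκ : κ ≠ 0) :
    ∀ u, IsLowerSet ((schreierHalf κ).fam u) := fun _ => isLowerSet_schreierFam hκ

theorem apply_le_schreierHalf_tnorm (κ : ℕ) (b : ℕ+ →₀ ℝ) {J : Finset ℕ+} {t : ℕ+} (ht : t ∈ J) :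
    b t ≤ (schreierHalf κ).tnorm (restr J b) := by
  have h := (schreierHalf κ).abs_apply_le_tnorm (restr J b) t
  rw [restr_apply_of_mem (by exact_mod_cast ht)] at h
  exact (le_abs_self _).trans h

/-- Splitting a composite functional `f = θ_i ∑ g_s` along successive vectors `w_t`. The set `J' s`
consists of the `t` such that `g_s` is the only part of `f` whose support meets that of `w_t`, and
`S` of the `t` such that at least two parts meet `w_t`. Both systems are dominated by the norm of
the coefficients in `T[F_κ, 1/2]`, since `t` lies above every marker of a part that meets `w_t`. -/
theorem exists_split {κ : ℕ} (hκ : κ ≠ 0) {i : ι} (hfam : T.fam i ⊆ schreierFam κ)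
    {A : Finset ℕ+} {lo : ℕ+ → ℕ+} {w : ℕ+ → ℕ+ →₀ ℝ} (hw : Marked A lo w) {b : ℕ+ →₀ ℝ}
    (hb : ∀ t, 0 ≤ b t) {J : Finset ℕ+} (hJ : J ⊆ A) {f : ℕ+ →₀ ℝ} (hf : f ∈ T.Composite i) :
    ∃ (d : ℕ) (g : Fin d → ℕ+ →₀ ℝ) (J' : Fin d → Finset ℕ+) (S : Finset ℕ+),
      (∀ s, g s ∈ T.normingSet) ∧ S ⊆ J ∧ (∀ s, J' s ⊆ J) ∧
      pairing f (combo b w J) = T.weight i * ∑ s, pairing (g s) (combo b w (J' s)) +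
        ∑ t ∈ S, b t * pairing f (w t) ∧
      ∑ s, ∑ t ∈ J' s, b t ≤ ∑ t ∈ J, b t ∧
      ∑ s, (schreierHalf κ).tnorm (restr (J' s) b) ≤ 2 * (schreierHalf κ).tnorm (restr J b) ∧
      ∑ t ∈ S, b t ≤ 2 * (schreierHalf κ).tnorm (restr J b) := by
  classical
  obtain ⟨d, g, -, hg, ⟨m, hm1, hm2, hm3, hm4⟩, rfl⟩ := hf
  set hit : Fin d → ℕ+ → Prop := fun s t => ∃ a ∈ (w t).support, a ∈ (g s).support with hhit
  set J' : Fin d → Finset ℕ+ := fun s => J.filter fun t => hit s t ∧ ∀ s', hit s' t → s' = s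
    with hJ'
  set S : Finset ℕ+ := J.filter fun t => ∃ s s', s ≠ s' ∧ hit s t ∧ hit s' t with hS
  have hJ'J : ∀ s, J' s ⊆ J := fun s => Finset.filter_subset _ _
  have hSJ : S ⊆ J := Finset.filter_subset _ _
  have hzero : ∀ s t, ¬ hit s t → pairing (g s) (w t) = 0 := fun s t h =>
    pairing_eq_zero fun n hn hn' => h ⟨n, hn', hn⟩
  -- Parts of the functional and the vectors that they meet are in the same order.
  have horder : ∀ s s' t t', s < s' → t ∈ J → t' ∈ J → hit s t → hit s' t' → t ≤ t' := by
    rintro s s' t t' hs ht ht' ⟨a, ha, ha'⟩ ⟨c, hc, hc'⟩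
    by_contra! hlt
    have h1 : a < c := (hm4 s s' hs a ha').trans_le (hm3 s' c hc')
    have h2 : c < a := ((hw.supp t' (hJ ht') c hc).2.trans_le
      (hw.le_lo t' (hJ ht') t (hJ ht) hlt)).trans_le (hw.supp t (hJ ht) a ha).1
    exact h1.asymm h2
  have hmarker : ∀ s, ∀ t ∈ J, hit s t → m s ≤ t := by
    rintro s t ht ⟨a, ha, ha'⟩
    exact (hm3 s a ha').trans (hw.supp t (hJ ht) a ha).2.le
  have hmem : Finset.univ.image m ∈ (schreierHalf κ).fam () := hfam hm2
  -- The upper estimate in `T[F_κ, 1/2]` for systems of sets of vectors met by given parts.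
  have haux : ∀ E : Fin d → Finset ℕ+, (∀ s, ∀ t ∈ E s, t ∈ J ∧ hit s t) →
      (∀ s s', s < s' → ∀ t, t ∈ E s → t ∈ E s' → False) →
      ∑ s, (schreierHalf κ).tnorm (restr (E s) b) ≤ 2 * (schreierHalf κ).tnorm (restr J b) := by
    intro E hE hdisj
    have h := weight_mul_sum_le_of_weak (T := schreierHalf κ) (isLowerSet_schreierHalf hκ)
      (isSpreading_schreierFam κ) (s := Finset.univ) (E := E) (j := ()) (hm1.strictMonoOn _) hmem
      (fun s _ t ht => hmarker s t (hE s t ht).1 (hE s t ht).2)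
      (fun s _ s' _ hss t ht t' ht' => lt_of_le_of_ne
        (horder s s' t t' hss (hE s t ht).1 (hE s' t' ht').1 (hE s t ht).2 (hE s' t' ht').2)
        (fun heq => hdisj s s' hss t ht (heq ▸ ht'))) (restr J b)
    have h2 : ∀ s, restr (E s) (restr J b) = restr (E s) b := fun s => by
      rw [restr_restr, Set.inter_eq_left.2]
      exact fun t ht => (hE s t ht).1
    simp only [h2] at h
    change 1 / 2 * _ ≤ _ at h
    linarith
  have hJ'disj : ∀ s s' t, t ∈ J' s → t ∈ J' s' → s = s' := fun s s' t h h' =>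
    (Finset.mem_filter.1 h').2.2 s (Finset.mem_filter.1 h).2.1
  refine ⟨d, g, J', S, hg, hSJ, hJ'J, ?_, ?_, ?_, ?_⟩
  · have hterm : ∀ t ∈ J, b t * pairing (T.weight i • ∑ s, g s) (w t) =
        T.weight i * ∑ s, (if hit s t ∧ ∀ s', hit s' t → s' = s then b t * pairing (g s) (w t)
          else 0) + if ∃ s s', s ≠ s' ∧ hit s t ∧ hit s' t then
            b t * pairing (T.weight i • ∑ s, g s) (w t) else 0 := by
      intro t _
      by_cases hsp : ∃ s s', s ≠ s' ∧ hit s t ∧ hit s' t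
      · have hz : ∀ s, ¬ (hit s t ∧ ∀ s', hit s' t → s' = s) := by
          rintro s ⟨-, h⟩
          obtain ⟨s₁, s₂, hne, h1, h2⟩ := hsp
          exact hne ((h s₁ h1).trans (h s₂ h2).symm)
        simp only [if_pos hsp, if_neg (hz _), Finset.sum_const_zero, mul_zero, zero_add]
      · rw [if_neg hsp, add_zero, pairing_smul_left, pairing_sum_left, mul_left_comm,
          Finset.mul_sum]
        congr 1
        refine Finset.sum_congr rfl fun s _ => ?_
        by_cases h : hit s t
        · rw [if_pos ⟨h, fun s' h' => by
            by_contra hne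
            exact hsp ⟨s', s, hne, h', h⟩⟩]
        · rw [if_neg fun h' => h h'.1, hzero s t h, mul_zero]
    simp only [pairing_combo]
    rw [Finset.sum_congr rfl hterm, Finset.sum_add_distrib, ← Finset.mul_sum, Finset.sum_comm,
      hS, Finset.sum_filter]
    simp only [hJ', Finset.sum_filter]
  · rw [← Finset.sum_biUnion]
    · exact Finset.sum_le_sum_of_subset_of_nonneg
        (Finset.biUnion_subset.2 fun s _ => hJ'J s) fun t _ _ => hb t
    · intro s _ s' _ hne
      exact Finset.disjoint_left.2 fun t h h' => hne (hJ'disj s s' t h h')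
  · refine haux J' (fun s t ht => ⟨hJ'J s ht, (Finset.mem_filter.1 ht).2.1⟩) ?_
    exact fun s s' hss t h h' => hss.ne (hJ'disj s s' t h h')
  · -- A vector met by several parts is assigned to the last of them.
    set E : Fin d → Finset ℕ+ := fun s => S.filter fun t => hit s t ∧ ∀ s', hit s' t → s' ≤ s
      with hE
    refine le_trans ?_ (haux E (fun s t ht => ?_) fun s s' hss t h h' => ?_)
    · have hcover : S ⊆ Finset.univ.biUnion E := by
        intro t ht
        obtain ⟨s₀, -, -, hs₀, -⟩ := (Finset.mem_filter.1 ht).2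
        have hne : (Finset.univ.filter fun s => hit s t).Nonempty := ⟨s₀, by simp [hs₀]⟩
        refine Finset.mem_biUnion.2 ⟨_, Finset.mem_univ _, Finset.mem_filter.2 ⟨ht,
          (Finset.mem_filter.1 (Finset.max'_mem _ hne)).2, fun s' hs' =>
            Finset.le_max' _ s' (by simp [hs'])⟩⟩
      refine (Finset.sum_le_sum_of_subset_of_nonneg hcover fun t _ _ => hb t).trans ?_
      rw [Finset.sum_biUnion]
      · refine Finset.sum_le_sum fun s _ => ?_
        rcases (E s).eq_empty_or_nonempty with h0 | ⟨t, ht⟩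
        · rw [h0, Finset.sum_empty]
          exact tnorm_nonneg _ _
        · have hsub : E s = {t} := by
            refine Finset.eq_singleton_iff_unique_mem.2 ⟨ht, fun t' ht' => ?_⟩
            -- Of two vectors assigned to the same part, the later one is met by an earlier part.
            have key : ∀ u ∈ E s, ∀ u' ∈ E s, u' ≤ u := by
              intro u hu u' hu'
              obtain ⟨huS, hsu, -⟩ := Finset.mem_filter.1 hu
              obtain ⟨hu'S, hsu', hmax⟩ := Finset.mem_filter.1 hu'
              obtain ⟨hu'J, s₁, s₂, hne, h1, h2⟩ := Finset.mem_filter.1 hu'S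
              obtain ⟨s₃, hs₃, h3⟩ : ∃ s₃, s₃ < s ∧ hit s₃ u' := by
                rcases lt_or_eq_of_le (hmax s₁ h1) with hlt | rfl
                · exact ⟨s₁, hlt, h1⟩
                · exact ⟨s₂, lt_of_le_of_ne (hmax s₂ h2) hne.symm, h2⟩
              exact horder s₃ s u' u hs₃ hu'J (hSJ huS) h3 hsu
            exact le_antisymm (key t ht t' ht') (key t' ht' t ht)
          rw [hsub, Finset.sum_singleton]
          exact apply_le_schreierHalf_tnorm κ b (Finset.mem_singleton_self t)
      · intro s _ s' _ hne
        refine Finset.disjoint_left.2 fun t h h' => hne ?_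
        have h1 := (Finset.mem_filter.1 h).2
        have h2 := (Finset.mem_filter.1 h').2
        exact le_antisymm (h2.2 s h1.1) (h1.2 s' h2.1)
    · have := Finset.mem_filter.1 ht
      exact ⟨hSJ this.1, this.2.1⟩
    · have h1 := (Finset.mem_filter.1 h).2
      have h2 := (Finset.mem_filter.1 h').2
      exact (h1.2 s' h2.1).not_gt hss

/-! ### Estimates on combinations with small coefficients -/

section Estimates

variable {κ : ℕ} {A : Finset ℕ+} {lo : ℕ+ → ℕ+} {w : ℕ+ → ℕ+ →₀ ℝ} {b : ℕ+ →₀ ℝ}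

theorem abs_pairing_combo_le (hb : ∀ t, 0 ≤ b t) {J : Finset ℕ+} {f : ℕ+ →₀ ℝ}
    {c : ℝ} (hc : ∀ t ∈ J, |pairing f (w t)| ≤ c) :
    |pairing f (combo b w J)| ≤ c * ∑ t ∈ J, b t := by
  rw [pairing_combo, Finset.mul_sum]
  refine (Finset.abs_sum_le_sum_abs _ _).trans (Finset.sum_le_sum fun t ht => ?_)
  rw [abs_mul, abs_of_nonneg (hb t), mul_comm]
  exact mul_le_mul_of_nonneg_right (hc t ht) (hb t)

/-- A composite functional of weight `θ_i` acts on an average of successive vectors of norm at most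
one by at most `θ_i`, up to the norm of the coefficients in the auxiliary space. -/
theorem abs_pairing_combo_le_of_composite (hκ : κ ≠ 0) {i : ι} (hfam : T.fam i ⊆ schreierFam κ)
    (hw : Marked A lo w) (hb : ∀ t, 0 ≤ b t) (hnorm : ∀ t ∈ A, T.tnorm (w t) ≤ 1)
    {f : ℕ+ →₀ ℝ} (hf : f ∈ T.Composite i) :
    |pairing f (combo b w A)| ≤
      T.weight i * ∑ t ∈ A, b t + 2 * (schreierHalf κ).tnorm (restr A b) := by
  obtain ⟨d, g, J', S, hg, hSJ, hJ'J, heq, h1, h2, h3⟩ := exists_split hκ hfam hw hb subset_rfl hf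
  have hle : ∀ f ∈ T.normingSet, ∀ t ∈ A, |pairing f (w t)| ≤ 1 := fun f hf t ht =>
    (T.abs_pairing_le_tnorm hf _).trans (hnorm t ht)
  rw [heq]
  refine (abs_add_le _ _).trans (add_le_add ?_ ?_)
  · rw [abs_mul, abs_of_pos (T.weight_pos i)]
    refine mul_le_mul_of_nonneg_left (le_trans ?_ h1) (T.weight_pos i).le
    refine (Finset.abs_sum_le_sum_abs _ _).trans (Finset.sum_le_sum fun s _ => ?_)
    have := abs_pairing_combo_le (f := g s) (c := 1) hb fun t ht => hle _ (hg s) t (hJ'J s ht)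
    rwa [one_mul] at this
  · have := abs_pairing_combo_le (f := f) (c := 1) hb fun t ht =>
      hle f (T.composite_subset_normingSet i hf) t (hSJ ht)
    rw [one_mul, pairing_combo] at this
    exact this.trans h3

/-- The estimate for functionals that are small on all vectors but one. -/
theorem abs_pairing_combo_le_of_one_bad (hb : ∀ t, 0 ≤ b t)
    (hnorm : ∀ t ∈ A, T.tnorm (w t) ≤ 1) {f : ℕ+ →₀ ℝ} (hf : f ∈ T.normingSet) {η : ℝ} (hη : 0 ≤ η)
    {t₀ : ℕ+} (ht₀ : ∀ t ∈ A, t ≠ t₀ → |pairing f (w t)| ≤ η) {J : Finset ℕ+} (hJ : J ⊆ A) :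
    |pairing f (combo b w J)| ≤ η * ∑ t ∈ J, b t + (schreierHalf κ).tnorm (restr J b) := by
  classical
  have hterm : ∀ t ∈ J, |b t * pairing f (w t)| ≤ η * b t + if t = t₀ then b t else 0 := by
    intro t ht
    have h0 := hb t
    rw [abs_mul, abs_of_nonneg h0]
    split_ifs with h
    · have := mul_le_mul_of_nonneg_left
        ((T.abs_pairing_le_tnorm hf (w t)).trans (hnorm t (hJ ht))) h0
      have := mul_nonneg hη h0
      linarith
    · have := mul_le_mul_of_nonneg_left (ht₀ t (hJ ht) h) h0
      linarith
  rw [pairing_combo]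
  refine (Finset.abs_sum_le_sum_abs _ _).trans ((Finset.sum_le_sum hterm).trans ?_)
  rw [Finset.sum_add_distrib, ← Finset.mul_sum, Finset.sum_ite_eq']
  refine add_le_add_right ?_ _
  split_ifs with h
  · exact apply_le_schreierHalf_tnorm κ b h
  · exact tnorm_nonneg _ _

theorem exists_forall_pairing_single_eq_zero (hw : Marked A lo w) (k : ℕ+) (c : ℝ) :
    ∃ t₀, ∀ t ∈ A, t ≠ t₀ → pairing (Finsupp.single k c) (w t) = 0 := by
  by_cases h : ∃ t ∈ A, lo t ≤ k ∧ k < t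
  · obtain ⟨t₀, ht₀, h1, h2⟩ := h
    refine ⟨t₀, fun t ht hne => ?_⟩
    rw [pairing_single]
    have : w t k = 0 := by
      by_contra hc
      obtain ⟨h1', h2'⟩ := hw.supp t ht k (Finsupp.mem_support_iff.2 hc)
      exact hne (hw.eq_of_mem ht ht₀ h1' h2' h1 h2)
    rw [this, mul_zero]
  · refine ⟨1, fun t ht _ => ?_⟩
    rw [pairing_single]
    have : w t k = 0 := by
      by_contra hc
      exact h ⟨t, ht, hw.supp t ht k (Finsupp.mem_support_iff.2 hc)⟩
    rw [this, mul_zero]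

theorem abs_pairing_single_combo_le [Nonempty ι] (hw : Marked A lo w) (hb : ∀ t, 0 ≤ b t)
    (hnorm : ∀ t ∈ A, T.tnorm (w t) ≤ 1) {k : ℕ+} {c : ℝ} (hc : c = 1 ∨ c = -1) :
    |pairing (Finsupp.single k c) (combo b w A)| ≤ (schreierHalf κ).tnorm (restr A b) := by
  obtain ⟨t₀, ht₀⟩ := exists_forall_pairing_single_eq_zero hw k c
  have hmem : Finsupp.single k c ∈ T.normingSet := by
    rcases hc with rfl | rfl
    · exact T.single_mem k
    · have := T.neg_mem (T.single_mem k)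
      rwa [← Finsupp.single_neg] at this
  have := abs_pairing_combo_le_of_one_bad (κ := κ) hb hnorm hmem le_rfl (t₀ := t₀)
    (fun t ht hne => by rw [ht₀ t ht hne, abs_zero]) subset_rfl
  rwa [zero_mul, zero_add] at this

/-- One step of the analysis of a functional: the estimate for its parts improves by the
factor `θ_i`. -/
theorem abs_pairing_combo_le_step (hκ : κ ≠ 0) {i : ι} (hfam : T.fam i ⊆ schreierFam κ)
    (hwt : T.weight i ≤ 1 / 2) (hw : Marked A lo w) (hb : ∀ t, 0 ≤ b t)
    (hnorm : ∀ t ∈ A, T.tnorm (w t) ≤ 1) {α β : ℝ} (hα : 0 ≤ α) (hβ : 0 ≤ β)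
    (ih : ∀ f ∈ T.normingSet, ∀ J ⊆ A, |pairing f (combo b w J)| ≤
      α * ∑ t ∈ J, b t + β * (schreierHalf κ).tnorm (restr J b))
    {f : ℕ+ →₀ ℝ} (hf : f ∈ T.Composite i) {J : Finset ℕ+} (hJ : J ⊆ A) :
    |pairing f (combo b w J)| ≤
      T.weight i * α * ∑ t ∈ J, b t + (β + 2) * (schreierHalf κ).tnorm (restr J b) := by
  obtain ⟨d, g, J', S, hg, hSJ, hJ'J, heq, h1, h2, h3⟩ := exists_split hκ hfam hw hb hJ hf
  have hS : |∑ t ∈ S, b t * pairing f (w t)| ≤ 2 * (schreierHalf κ).tnorm (restr J b) := by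
    have := abs_pairing_combo_le (f := f) (c := 1) hb fun t (ht : t ∈ S) =>
      (T.abs_pairing_le_tnorm (T.composite_subset_normingSet i hf) _).trans
        (hnorm t (hJ (hSJ ht)))
    rw [one_mul, pairing_combo] at this
    exact this.trans h3
  have hw0 := T.weight_pos i
  have hsum : |∑ s, pairing (g s) (combo b w (J' s))| ≤
      α * ∑ t ∈ J, b t + β * (2 * (schreierHalf κ).tnorm (restr J b)) := by
    refine (Finset.abs_sum_le_sum_abs _ _).trans ((Finset.sum_le_sum fun s _ =>
      ih (g s) (hg s) (J' s) ((hJ'J s).trans hJ)).trans ?_)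
    rw [Finset.sum_add_distrib, ← Finset.mul_sum, ← Finset.mul_sum]
    exact add_le_add (mul_le_mul_of_nonneg_left h1 hα) (mul_le_mul_of_nonneg_left h2 hβ)
  have haux := tnorm_nonneg (schreierHalf κ) (restr J b)
  have hβaux := mul_nonneg hβ haux
  rw [heq]
  refine (abs_add_le _ _).trans ?_
  rw [abs_mul, abs_of_pos hw0]
  have h4 := mul_le_mul_of_nonneg_left hsum hw0.le
  have h5 := mul_le_mul_of_nonneg_right hwt hβaux
  linarith

/-- The basic estimate for combinations of a rapidly increasing sequence, after `h` steps. Here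
`L` is the set of the indices whose families lie in `F_κ`, and functionals of other weights are
assumed to be small on all vectors but one. -/
theorem abs_pairing_combo_le_of_rapid (hκ : κ ≠ 0) {L : Set ι}
    (hfam : ∀ i ∈ L, T.fam i ⊆ schreierFam κ) (hwt : ∀ i ∈ L, T.weight i ≤ 1 / 2)
    (hw : Marked A lo w) (hb : ∀ t, 0 ≤ b t) (hnorm : ∀ t ∈ A, T.tnorm (w t) ≤ 1) {η : ℝ}
    (hη : 0 ≤ η) (hrapid : ∀ i ∉ L, ∀ f ∈ T.Composite i, ∃ t₀, ∀ t ∈ A, t ≠ t₀ →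
      |pairing f (w t)| ≤ η) (h : ℕ) : ∀ f ∈ T.normingSet, ∀ J ⊆ A, |pairing f (combo b w J)| ≤
      (η + (1 / 2) ^ h) * ∑ t ∈ J, b t + 2 * h * (schreierHalf κ).tnorm (restr J b) := by
  induction h with
  | zero =>
    intro f hf J hJ
    have h1 := abs_pairing_combo_le (c := 1) hb fun t (ht : t ∈ J) =>
      (T.abs_pairing_le_tnorm hf _).trans (hnorm t (hJ ht))
    have h2 := mul_nonneg hη (Finset.sum_nonneg fun t (_ : t ∈ J) => hb t)
    simp only [pow_zero, Nat.cast_zero, mul_zero, zero_mul, add_zero]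
    linarith
  | succ h ih =>
    intro f hf J hJ
    have hsum : 0 ≤ ∑ t ∈ J, b t := Finset.sum_nonneg fun t _ => hb t
    have haux := tnorm_nonneg (schreierHalf κ) (restr J b)
    have hpow : (0 : ℝ) ≤ (1 / 2) ^ h := by positivity
    have hbad : (∃ t₀, ∀ t ∈ A, t ≠ t₀ → |pairing f (w t)| ≤ η) →
        |pairing f (combo b w J)| ≤ (η + (1 / 2) ^ (h + 1)) * ∑ t ∈ J, b t +
          2 * ↑(h + 1) * (schreierHalf κ).tnorm (restr J b) := by
      rintro ⟨t₀, ht₀⟩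
      refine (abs_pairing_combo_le_of_one_bad (κ := κ) hb hnorm hf hη ht₀ hJ).trans ?_
      push_cast
      have h1 : (0 : ℝ) ≤ (1 / 2) ^ (h + 1) * ∑ t ∈ J, b t := mul_nonneg (by positivity) hsum
      have h2 := mul_nonneg (Nat.cast_nonneg (α := ℝ) h) haux
      linarith
    obtain ⟨i, hi⟩ := T.mem_normingSet.1 hf
    rcases T.K_cases hi with ⟨k, c, -, rfl⟩ | hcomp
    · obtain ⟨t₀, ht₀⟩ := exists_forall_pairing_single_eq_zero hw k c
      exact hbad ⟨t₀, fun t ht hne => by rwa [ht₀ t ht hne, abs_zero]⟩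
    · by_cases hiL : i ∈ L
      · refine (abs_pairing_combo_le_step hκ (hfam i hiL) (hwt i hiL) hw hb hnorm
          (add_nonneg hη hpow) (by positivity) ih hcomp hJ).trans ?_
        have h1 := mul_le_mul_of_nonneg_right (hwt i hiL) (mul_nonneg (add_nonneg hη hpow) hsum)
        have h2 := mul_nonneg hη hsum
        rw [pow_succ]
        push_cast
        linarith
      · exact hbad (hrapid i hiL f hcomp)

/-- The lower estimate: all vectors but the first one form an admissible system. -/
theorem exists_composite_lt_combo [Nonempty ι] (hA : ∀ j, IsLowerSet (T.fam j)) {j : ι}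
    (hs : IsSpreading (T.fam j)) (hw : Marked A lo w) (hb : ∀ t, 0 ≤ b t) (hne : A.Nonempty)
    (hAj : A ∈ T.fam j) {c : ℝ} (hc : 0 ≤ c)
    (hlt : c < ∑ t ∈ A.erase (A.min' hne), b t * T.tnorm (w t)) :
    ∃ φ ∈ T.Composite j, T.weight j * c < pairing φ (combo b w A) := by
  have hsub : A.erase (A.min' hne) ⊆ A := Finset.erase_subset _ _
  have hadm : AdmOn (T.fam j) (A.erase (A.min' hne)) fun t => Finset.Ico (lo t) t :=
    ⟨lo, hw.strictMonoOn_lo.mono (by exact_mod_cast hsub), hw.image_lo_mem hne (hA j) hs hAj,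
      fun t _ a ha => (Finset.mem_Ico.1 ha).1, fun t ht t' ht' htt a ha =>
        (Finset.mem_Ico.1 ha).2.trans_le (hw.le_lo t (hsub ht) t' (hsub ht') htt)⟩
  refine exists_composite_lt hA hadm hc (hlt.trans_le (le_of_eq ?_))
  refine Finset.sum_congr rfl fun t ht => ?_
  have : restr (Finset.Ico (lo t) t : Finset ℕ+) (combo b w A) = b t • w t := by
    ext a
    by_cases ha : a ∈ Finset.Ico (lo t) t
    · rw [restr_apply_of_mem (by exact_mod_cast ha), Finsupp.smul_apply, smul_eq_mul]
      exact hw.combo_apply b (hsub ht) (Finset.mem_Ico.1 ha).1 (Finset.mem_Ico.1 ha).2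
    · rw [restr_apply_of_notMem (by exact_mod_cast ha), Finsupp.smul_apply]
      have : w t a = 0 := by
        by_contra hc
        exact ha (Finset.mem_Ico.2 (hw.supp t (hsub ht) a (Finsupp.mem_support_iff.2 hc)))
      rw [this, smul_zero]
  rw [this, tnorm_smul, abs_of_nonneg (hb t)]

end Estimates

end TsirelsonData

/-! ### Extraction of successive vectors -/

/-- Dependent choice of successive intervals `[lo, hi)` with data attached. The objects obtained are
indexed by their upper ends `hi`, which form an infinite set `D`. -/
theorem exists_infinite_markers {α : Type*} {lo hi : α → ℕ+} {I : α → Prop} {R : α → α → Prop}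
    (hI : ∀ a, I a → lo a < hi a) (hR : ∀ a b, R a b → hi a ≤ lo b)
    (htrans : ∀ a b c, I b → R a b → R b c → R a c) {a₀ : α} (h₀ : I a₀)
    (h : ∀ a, I a → ∃ b, I b ∧ R a b) :
    ∃ (D : Set ℕ+) (c : ℕ+ → α), D.Infinite ∧ ∀ t ∈ D, I (c t) ∧ hi (c t) = t ∧ R a₀ (c t) ∧
      ∀ t' ∈ D, t < t' → R (c t) (c t') := by
  obtain ⟨f, hf0, hfI, hfR⟩ := exists_seq_of_invariant h₀ h
  have hlt : ∀ n k, R (f n) (f (n + k + 1)) := fun n k => by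
    induction k with
    | zero => exact hfR n
    | succ k ih => exact htrans _ _ _ (hfI _) ih (hfR _)
  have hmono : StrictMono fun n => hi (f n) := strictMono_nat_of_lt_succ fun n =>
    (hR _ _ (hfR n)).trans_lt (hI _ (hfI (n + 1)))
  refine ⟨Set.range fun n => hi (f (n + 1)), fun t => f (Function.invFun (fun n => hi (f n)) t),
    Set.infinite_range_of_injective fun a b hab => ?_, ?_⟩
  · simpa using hmono.injective hab
  · have hinv : ∀ n, Function.invFun (fun n => hi (f n)) (hi (f n)) = n :=
      Function.leftInverse_invFun hmono.injective
    rintro _ ⟨n, rfl⟩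
    simp only [hinv]
    refine ⟨hfI _, trivial, ?_, ?_⟩
    · have := hlt 0 n
      rwa [hf0, Nat.zero_add] at this
    · rintro _ ⟨n', rfl⟩ hnn
      have hn : n < n' := by simpa using hmono.lt_iff_lt.1 hnn
      obtain ⟨k, rfl⟩ := Nat.exists_eq_add_of_lt hn
      simp only [hinv]
      have := hlt (n + 1) k
      rwa [show n + 1 + k + 1 = n + k + 1 + 1 by ring] at this

/-- A subspace of `c₀₀` that contains nonzero vectors supported arbitrarily far to the right. -/
def HasTails (V : Submodule ℝ (ℕ+ →₀ ℝ)) : Prop :=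
  ∀ N : ℕ+, ∃ v ∈ V, v ≠ 0 ∧ ∀ a ∈ v.support, N ≤ a

/-- A vector together with an interval `[lo, hi)` that contains its support. -/
structure MarkedVector where
  /-- The lower end of the interval. -/
  lo : ℕ+
  /-- The strict upper end of the interval. -/
  hi : ℕ+
  /-- The vector. -/
  vec : ℕ+ →₀ ℝ
  lo_lt_hi : lo < hi
  supp : ∀ a ∈ vec.support, lo ≤ a ∧ a < hi

theorem exists_markedVector {N : ℕ+} {v : ℕ+ →₀ ℝ} (hv : ∀ a ∈ v.support, N ≤ a) :
    ∃ x : MarkedVector, x.lo = N ∧ x.vec = v := by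
  obtain ⟨M, hM⟩ := exists_forall_mem_lt (insert N v.support)
  exact ⟨⟨N, M, v, hM N (Finset.mem_insert_self _ _),
    fun a ha => ⟨hv a ha, hM a (Finset.mem_insert_of_mem ha)⟩⟩, rfl, rfl⟩

/-! ### Sums of the norms of pieces -/

/-- The part of the half-line `[p, ∞)` below the next marker in `P`. -/
def cell (P : Finset ℕ+) (p : ℕ+) : Set ℕ+ := {a | p ≤ a ∧ ∀ q ∈ P, p < q → a < q}

namespace TsirelsonData

variable {ι : Type} (T : TsirelsonData ι)

/-- The sum of the norms of the pieces into which the markers in `P` cut the vector `v`. -/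
noncomputable def pieceSum (P : Finset ℕ+) (v : ℕ+ →₀ ℝ) : ℝ :=
  ∑ p ∈ P, T.tnorm (restr (cell P p) v)

variable {T} [Nonempty ι]

theorem pieceSum_smul (P : Finset ℕ+) (c : ℝ) (v : ℕ+ →₀ ℝ) :
    T.pieceSum P (c • v) = |c| * T.pieceSum P v := by
  simp only [pieceSum, restr_smul, tnorm_smul, Finset.mul_sum]

theorem weight_mul_pieceSum_le (hA : ∀ j, IsLowerSet (T.fam j)) {j : ι} {P : Finset ℕ+}
    (hP : P ∈ T.fam j) (v : ℕ+ →₀ ℝ) : T.weight j * T.pieceSum P v ≤ T.tnorm v := by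
  classical
  have hadm : AdmOn (T.fam j) P fun p => v.support.filter (· ∈ cell P p) :=
    ⟨id, strictMono_id.strictMonoOn _, by simpa using hP,
      fun p _ a ha => (Finset.mem_filter.1 ha).2.1,
      fun p _ q hq hpq a ha => (Finset.mem_filter.1 ha).2.2 q hq hpq⟩
  refine le_trans (le_of_eq ?_) (weight_mul_sum_le hA hadm v)
  rw [pieceSum]
  congr 1
  refine Finset.sum_congr rfl fun p _ => congrArg T.tnorm ?_
  ext a
  by_cases hv : v a = 0
  · simp [restr_apply, hv]
  · simp [restr_apply, hv]

/-- The pieces of successive vectors are pieces of their combinations. -/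
theorem sum_mul_pieceSum_le (hA : ∀ j, IsLowerSet (T.fam j)) {A : Finset ℕ+} {lo : ℕ+ → ℕ+}
    {w : ℕ+ → ℕ+ →₀ ℝ} (hw : Marked A lo w) {b : ℕ+ →₀ ℝ} (hb : ∀ t, 0 ≤ b t) {s : Finset ℕ+}
    (hs : s ⊆ A) {Q : ℕ+ → Finset ℕ+} (hQ : ∀ t ∈ s, ∀ p ∈ Q t, lo t ≤ p ∧ p < t) :
    ∑ t ∈ s, b t * T.pieceSum (Q t) (w t) ≤ T.pieceSum (s.biUnion Q) (combo b w A) := by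
  classical
  rw [pieceSum, Finset.sum_biUnion]
  · refine Finset.sum_le_sum fun t ht => ?_
    rw [pieceSum, Finset.mul_sum]
    refine Finset.sum_le_sum fun p hp => ?_
    have hcell : ∀ a, lo t ≤ a → a < t → (a ∈ cell (s.biUnion Q) p ↔ a ∈ cell (Q t) p) := by
      intro a h1 h2
      refine and_congr_right fun _ => ⟨fun h q hq => h q (Finset.mem_biUnion.2 ⟨t, ht, hq⟩),
        fun h q hq hpq => ?_⟩
      obtain ⟨t', ht', hq'⟩ := Finset.mem_biUnion.1 hq
      rcases lt_trichotomy t t' with hlt | rfl | hlt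
      · exact h2.trans_le ((hw.le_lo t (hs ht) t' (hs ht') hlt).trans (hQ t' ht' q hq').1)
      · exact h q hq' hpq
      · exact absurd (((hQ t' ht' q hq').2.trans_le (hw.le_lo t' (hs ht') t (hs ht) hlt)).trans_le
          (hQ t ht p hp).1) hpq.asymm
    have heq : restr (Set.Ico (lo t) t) (restr (cell (s.biUnion Q) p) (combo b w A)) =
        b t • restr (cell (Q t) p) (w t) := by
      ext a
      rw [Finsupp.smul_apply, smul_eq_mul]
      by_cases ha : a ∈ Set.Ico (lo t) t
      · rw [restr_apply_of_mem ha]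
        by_cases hac : a ∈ cell (s.biUnion Q) p
        · rw [restr_apply_of_mem hac, restr_apply_of_mem ((hcell a ha.1 ha.2).1 hac),
            hw.combo_apply b (hs ht) ha.1 ha.2]
        · rw [restr_apply_of_notMem hac, restr_apply_of_notMem (mt (hcell a ha.1 ha.2).2 hac),
            mul_zero]
      · rw [restr_apply_of_notMem ha]
        have : w t a = 0 := by
          by_contra hc
          exact ha (hw.supp t (hs ht) a (Finsupp.mem_support_iff.2 hc))
        rw [restr_apply, this, ite_self, mul_zero]
    have := tnorm_restr_le hA (Set.Ico (lo t) t) (restr (cell (s.biUnion Q) p) (combo b w A))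
    rwa [heq, tnorm_smul, abs_of_nonneg (hb t)] at this
  · intro t ht t' ht' hne
    refine Finset.disjoint_left.2 fun p hp hp' => hne ?_
    obtain ⟨h1, h2⟩ := hQ t ht p hp
    obtain ⟨h1', h2'⟩ := hQ t' ht' p hp'
    exact hw.eq_of_mem (hs ht) (hs ht') h1 h2 h1' h2'

end TsirelsonData

/-! ### Averages of successive vectors in block subspaces -/

namespace XuChoice

open TsirelsonData

variable (C : XuChoice)

theorem M_subset_of_le {i j : ℕ} (h : i ≤ j) : C.M i ⊆ schreierFam (C.k j) :=
  (C.M_mono h).trans (C.M_subset j)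

theorem weight_le_half (j : ℕ) : C.data.weight j ≤ 1 / 2 :=
  one_div_le_one_div_of_le two_pos (C.two_le_m j)

theorem isSpreading_M (j : ℕ) : IsSpreading (C.M j) := by
  cases j with
  | zero =>
    rw [C.M_zero]
    exact isSpreading_schreierFam 1
  | succ j =>
    rw [C.M_succ]
    exact isSpreading_familyIter (isLowerSet_schreierFam (C.s_ne_zero j))
      (isSpreading_schreierFam _) _

theorem schreierFam_s_subset (j : ℕ) : schreierFam (C.s (j + 1)) ⊆ C.M (j + 1) := by
  rw [C.M_succ]
  exact subset_familyIter (schreierFam_mono (Nat.zero_le _)) _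

theorem m_le {i j : ℕ} (h : i ≤ j) : (C.m i : ℝ) ≤ C.m j := by
  exact_mod_cast C.m_strictMono.monotone h

/-- Coefficients of level `j + 1` on an infinite set of markers: a convex combination with support
in `F_{s_{j+1}}` and tiny norm in `T[F_{k_j}, 1/2]`. No single coefficient exceeds this norm, so
that at least half of the mass lies off the first marker. -/
theorem small_coefficients (j : ℕ) {D : Set ℕ+} (hD : D.Infinite) :
    ∃ b : ℕ+ →₀ ℝ, (∀ t, 0 ≤ b t) ∧ ∑ t ∈ b.support, b t = 1 ∧ (b.support : Set ℕ+) ⊆ D ∧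
      b.support ∈ schreierFam (C.s (j + 1)) ∧
      (schreierHalf (C.k j)).tnorm (restr b.support b) ≤ 1 / (C.m (j + 2) : ℝ) ^ 4 ∧
      ∃ hne : b.support.Nonempty, 1 / 2 ≤ ∑ t ∈ b.support.erase (b.support.min' hne), b t := by
  obtain ⟨b, hb0, hb1, hbD, hbF, -, hlt⟩ := C.small j D hD
  have hb : restr b.support b = b := restr_eq_self subset_rfl
  have hne : b.support.Nonempty := by
    by_contra hne
    rw [Finset.not_nonempty_iff_eq_empty.1 hne, Finset.sum_empty] at hb1
    exact zero_ne_one hb1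
  refine ⟨b, hb0, hb1, hbD, hbF, hb.symm ▸ hlt.le, hne, ?_⟩
  have h1 := apply_le_schreierHalf_tnorm (C.k j) b (b.support.min'_mem hne)
  rw [hb] at h1
  have h2 := Finset.add_sum_erase b.support b (b.support.min'_mem hne)
  have h3 : 1 / (C.m (j + 2) : ℝ) ^ 4 ≤ 1 / 2 := by
    refine one_div_le_one_div_of_le two_pos ?_
    have := pow_le_pow_left₀ two_pos.le (C.two_le_m (j + 2)) 4
    linarith
  linarith

/-- A normalized vector of `V` in an interval, and a member of `B` in this interval that cuts it
into pieces whose norms have sum at least `c`. -/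
def IsCut (V : Submodule ℝ (ℕ+ →₀ ℝ)) (B : Set (Finset ℕ+)) (c : ℝ) (x : MarkedVector) : Prop :=
  x.vec ∈ V ∧ C.data.tnorm x.vec = 1 ∧
    ∃ P ∈ B, (∀ p ∈ P, x.lo ≤ p ∧ p < x.hi) ∧ c ≤ C.data.pieceSum P x.vec

variable {C} {V : Submodule ℝ (ℕ+ →₀ ℝ)}

theorem _root_.combo_mem {w : ℕ+ → ℕ+ →₀ ℝ} {A : Finset ℕ+} (hw : ∀ t ∈ A, w t ∈ V) (b : ℕ+ →₀ ℝ) :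
    combo b w A ∈ V := V.sum_mem fun t ht => V.smul_mem _ (hw t ht)

theorem _root_.support_combo {w : ℕ+ → ℕ+ →₀ ℝ} {A : Finset ℕ+} {b : ℕ+ →₀ ℝ} {p : ℕ+ → Prop}
    (hw : ∀ t ∈ A, ∀ a ∈ (w t).support, p a) : ∀ a ∈ (combo b w A).support, p a := by
  intro a ha
  by_contra hp
  refine Finsupp.mem_support_iff.1 ha ?_
  rw [combo, Finsupp.finsetSum_apply]
  refine Finset.sum_eq_zero fun t ht => ?_
  have : w t a = 0 := by
    by_contra hc
    exact hp (hw t ht a (Finsupp.mem_support_iff.2 hc))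
  rw [Finsupp.smul_apply, this, smul_zero]

theorem _root_.TsirelsonData.tnorm_combo_le {ι : Type} {T : TsirelsonData ι} [Nonempty ι]
    {w : ℕ+ → ℕ+ →₀ ℝ} {A : Finset ℕ+} {b : ℕ+ →₀ ℝ} (hb : ∀ t, 0 ≤ b t)
    (hw : ∀ t ∈ A, T.tnorm (w t) ≤ 1) : T.tnorm (combo b w A) ≤ ∑ t ∈ A, b t := by
  refine (T.tnorm_sum_le _ _).trans (Finset.sum_le_sum fun t ht => ?_)
  rw [tnorm_smul, abs_of_nonneg (hb t)]
  exact mul_le_of_le_one_right (hb t) (hw t ht)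

theorem exists_isCut_zero (hV : HasTails V) (N : ℕ+) :
    ∃ x : MarkedVector, N ≤ x.lo ∧ C.IsCut V (schreierFam 0) 1 x := by
  obtain ⟨v, hvV, hv0, hvN⟩ := hV N
  have hpos := C.data.tnorm_pos hv0
  set u := (C.data.tnorm v)⁻¹ • v with hu
  have huN : ∀ a ∈ u.support, N ≤ a := fun a ha => hvN a (Finsupp.support_smul ha)
  obtain ⟨x, hxN, hxv⟩ := exists_markedVector huN
  have h1 : C.data.tnorm u = 1 := by
    rw [hu, tnorm_smul, abs_of_pos (inv_pos.2 hpos), inv_mul_cancel₀ hpos.ne']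
  refine ⟨x, hxN.ge, hxv ▸ V.smul_mem _ hvV, hxv ▸ h1, {x.lo}, ⟨_, rfl⟩, ?_, ?_⟩
  · intro p hp
    rw [Finset.mem_singleton.1 hp]
    exact ⟨le_rfl, x.lo_lt_hi⟩
  · rw [pieceSum, Finset.sum_singleton, restr_eq_self, hxv, h1]
    intro a ha
    exact ⟨(x.supp a ha).1, fun q hq h => absurd h (by simp [Finset.mem_singleton.1 hq])⟩

/-- If no average of successive vectors of `V` is large, then normalizing averages doubles the sum
of the norms of the pieces, at the cost of one more operation `F_s[·]`. -/
theorem exists_isCut_succ {j : ℕ} {B : Set (Finset ℕ+)} {c : ℝ} (hc : 0 < c)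
    (hB : ∀ N : ℕ+, ∃ x : MarkedVector, N ≤ x.lo ∧ C.IsCut V B c x) {N₀ : ℕ+}
    (hsmall : ∀ v ∈ V, (∀ a ∈ v.support, N₀ ≤ a) → C.data.tnorm v ≤ 1 →
      (∀ i ≤ j, ∀ f ∈ C.data.Composite i, |pairing f v| ≤ 2 / C.m i) → C.data.tnorm v ≤ 1 / 4)
    (N : ℕ+) : ∃ x : MarkedVector, N ≤ x.lo ∧
      C.IsCut V (familyOp (schreierFam (C.s (j + 1))) B) (2 * c) x := by
  classical
  obtain ⟨x₀, hx₀, hx₀'⟩ := hB (max N N₀)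
  obtain ⟨D, x, hD, hx⟩ := exists_infinite_markers (lo := MarkedVector.lo) (hi := MarkedVector.hi)
    (I := C.IsCut V B c) (R := fun x y => x.hi ≤ y.lo) (fun x _ => x.lo_lt_hi)
    (fun _ _ h => h) (fun _ y _ _ h h' => (h.trans y.lo_lt_hi.le).trans h') hx₀'
    fun y _ => (hB y.hi).imp fun _ h => ⟨h.2, h.1⟩
  obtain ⟨b, hb0, hb1, hbD, hbF, haux, hne, hhalf⟩ := C.small_coefficients j hD
  set A := b.support
  have hAD : ∀ t ∈ A, t ∈ D := fun t ht => hbD ht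
  have hw : Marked A (fun t => (x t).lo) fun t => (x t).vec := by
    refine ⟨fun t ht => ?_, fun t ht t' ht' h => ?_, fun t ht a ha => ?_⟩
    · have := (x t).lo_lt_hi
      rwa [(hx t (hAD t ht)).2.1] at this
    · have := (hx t (hAD t ht)).2.2.2 t' (hAD t' ht') h
      rwa [(hx t (hAD t ht)).2.1] at this
    · have := (x t).supp a ha
      rwa [(hx t (hAD t ht)).2.1] at this
  have hnorm : ∀ t ∈ A, C.data.tnorm (x t).vec ≤ 1 := fun t ht => (hx t (hAD t ht)).1.2.1.le
  have hlo : ∀ t ∈ A, max N N₀ ≤ (x t).lo := fun t ht =>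
    hx₀.trans (x₀.lo_lt_hi.le.trans (hx t (hAD t ht)).2.2.1)
  set z := combo b (fun t => (x t).vec) A with hz
  have hzV : z ∈ V := combo_mem (fun t ht => (hx t (hAD t ht)).1.1) b
  have hzN : ∀ a ∈ z.support, max N N₀ ≤ a := support_combo fun t ht a ha =>
    (hlo t ht).trans ((x t).supp a ha).1
  have hz4 : C.data.tnorm z ≤ 1 / 4 := by
    refine hsmall z hzV (fun a ha => (le_max_right _ _).trans (hzN a ha))
      ((tnorm_combo_le hb0 hnorm).trans hb1.le) fun i hi f hf => ?_
    refine (abs_pairing_combo_le_of_composite (C.k_ne_zero j) (C.M_subset_of_le hi) hw hb0 hnorm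
      hf).trans ?_
    rw [hb1, mul_one, C.weight_eq]
    have h1 : 2 * (1 / (C.m (j + 2) : ℝ) ^ 4) ≤ 1 / C.m i := by
      have h2 := C.two_le_m (j + 2)
      have h3 := C.m_le (show i ≤ j + 2 by omega)
      rw [mul_one_div, div_le_div_iff₀ (by positivity) (C.m_pos i)]
      have h4 : (2 : ℝ) ^ 3 ≤ (C.m (j + 2) : ℝ) ^ 3 := pow_le_pow_left₀ two_pos.le h2 3
      have h5 := mul_le_mul_of_nonneg_right h4 (C.m_pos (j + 2)).le
      rw [← pow_succ] at h5
      norm_num at h5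
      have := C.m_pos i
      linarith
    have h2 : (2 : ℝ) / C.m i = 1 / C.m i + 1 / C.m i := by ring
    linarith
  -- The sets that cut the vectors, those of the first vector excepted, form a member of `F_s[B]`.
  have hcut : ∀ t ∈ A, ∃ P ∈ B, (∀ p ∈ P, (x t).lo ≤ p ∧ p < t) ∧
      c ≤ C.data.pieceSum P (x t).vec := fun t ht => by
    obtain ⟨-, -, P, h1, h2, h3⟩ := (hx t (hAD t ht)).1
    rw [(hx t (hAD t ht)).2.1] at h2
    exact ⟨P, h1, h2, h3⟩
  choose! Q hQB hQ hQc using hcut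
  set s := A.erase (A.min' hne)
  have hs : s ⊆ A := Finset.erase_subset _ _
  have hPmem : s.biUnion Q ∈ familyOp (schreierFam (C.s (j + 1))) B := by
    refine AdmOn.biUnion_mem ⟨fun t => (x t).lo,
      hw.strictMonoOn_lo.mono (by exact_mod_cast hs),
      hw.image_lo_mem hne (isLowerSet_schreierFam (C.s_ne_zero j)) (isSpreading_schreierFam _) hbF,
      fun t ht p hp => (hQ t (hs ht) p hp).1, fun t ht t' ht' htt p hp =>
        (hQ t (hs ht) p hp).2.trans_le (hw.le_lo t (hs ht) t' (hs ht') htt)⟩ fun t ht =>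
      hQB t (hs ht)
  have hpiece : c / 2 ≤ C.data.pieceSum (s.biUnion Q) z := by
    refine le_trans ?_ (sum_mul_pieceSum_le C.isLowerSet_fam hw hb0 hs fun t ht => hQ t (hs ht))
    calc c / 2 ≤ ∑ t ∈ s, b t * c := by
          rw [← Finset.sum_mul]
          have := mul_le_mul_of_nonneg_right hhalf hc.le
          linarith
      _ ≤ _ := Finset.sum_le_sum fun t ht =>
          mul_le_mul_of_nonneg_left (hQc t (hs ht)) (hb0 t)
  have hzpos : 0 < C.data.tnorm z := by
    refine C.data.tnorm_pos fun h0 => ?_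
    have : C.data.pieceSum (s.biUnion Q) z = 0 := by
      have := pieceSum_smul (T := C.data) (s.biUnion Q) 0 z
      rwa [zero_smul, abs_zero, zero_mul, ← h0] at this
    linarith
  obtain ⟨N', hN'⟩ := exists_forall_mem_lt (insert (max N N₀) A)
  have hltN' : ∀ t ∈ A, t < N' := fun t ht => hN' t (Finset.mem_insert_of_mem ht)
  refine ⟨⟨max N N₀, N', (C.data.tnorm z)⁻¹ • z, hN' _ (Finset.mem_insert_self _ _),
    fun a ha => ⟨hzN a (Finsupp.support_smul ha), ?_⟩⟩, le_max_left _ _, V.smul_mem _ hzV, ?_,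
    s.biUnion Q, hPmem, fun p hp => ?_, ?_⟩
  · refine support_combo (p := fun a => a < N') (fun t ht a ha => ?_) a (Finsupp.support_smul ha)
    exact (hw.supp t ht a ha).2.trans (hltN' t ht)
  · rw [tnorm_smul, abs_of_pos (inv_pos.2 hzpos), inv_mul_cancel₀ hzpos.ne']
  · obtain ⟨t, ht, hp⟩ := Finset.mem_biUnion.1 hp
    exact ⟨(hlo t (hs ht)).trans (hQ t (hs ht) p hp).1,
      (hQ t (hs ht) p hp).2.trans (hltN' t (hs ht))⟩
  · rw [pieceSum_smul, abs_of_pos (inv_pos.2 hzpos), ← div_eq_inv_mul, le_div_iff₀ hzpos]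
    have := mul_le_mul_of_nonneg_left hz4 hc.le
    linarith

variable (C) in
/-- Block subspaces contain averages of level `j + 1` whose norm is bounded below: otherwise the
iteration produces a normalized vector with an `M_{j+1}`-admissible system of pieces whose norms sum
up to more than `m_{j+1}`. -/
theorem exists_average (hV : HasTails V) (j : ℕ) (N₀ : ℕ+) :
    ∃ v ∈ V, (∀ a ∈ v.support, N₀ ≤ a) ∧ C.data.tnorm v ≤ 1 ∧ 1 / 4 < C.data.tnorm v ∧
      ∀ i ≤ j, ∀ f ∈ C.data.Composite i, |pairing f v| ≤ 2 / C.m i := by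
  by_contra! hno
  have hsmall : ∀ v ∈ V, (∀ a ∈ v.support, N₀ ≤ a) → C.data.tnorm v ≤ 1 →
      (∀ i ≤ j, ∀ f ∈ C.data.Composite i, |pairing f v| ≤ 2 / C.m i) →
      C.data.tnorm v ≤ 1 / 4 := by
    intro v hv hvN hv1 hf
    by_contra! h4
    obtain ⟨i, hi, f, hf', hlt⟩ := hno v hv hvN hv1 h4
    exact hlt.not_ge (hf i hi f hf')
  have hcut : ∀ l : ℕ, ∀ N : ℕ+, ∃ x : MarkedVector, N ≤ x.lo ∧
      C.IsCut V ((familyOp (schreierFam (C.s (j + 1))))^[l] (schreierFam 0)) (2 ^ l) x := by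
    intro l
    induction l with
    | zero =>
      rw [pow_zero]
      exact exists_isCut_zero hV
    | succ l ih =>
      rw [Function.iterate_succ_apply', pow_succ']
      exact exists_isCut_succ (by positivity) ih hsmall
  have hl := C.l_large j
  have hm := C.two_le_m (j + 1)
  have hl0 : C.l (j + 1) ≠ 0 := fun h => by
    rw [h, pow_zero, div_lt_div_iff₀ one_pos (by linarith)] at hl
    linarith
  obtain ⟨x, -, -, hx1, P, hP, -, hPc⟩ := hcut (C.l (j + 1)) 1
  have hPM : P ∈ C.data.fam (j + 1) := by
    change P ∈ C.M (j + 1)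
    rw [C.M_succ]
    exact iterate_familyOp_schreierFam_zero_subset (isLowerSet_schreierFam (C.s_ne_zero j))
      (isSpreading_schreierFam _) hl0 hP
  have h1 := weight_mul_pieceSum_le C.isLowerSet_fam hPM x.vec
  rw [hx1, C.weight_eq, one_div_mul_eq_div, div_le_one (C.m_pos _)] at h1
  rw [one_div_lt_one_div (by positivity) (by linarith)] at hl
  linarith

end XuChoice

/-! ### Averages of rapidly increasing sequences -/

namespace XuChoice

open TsirelsonData

variable (C : XuChoice) {V : Submodule ℝ (ℕ+ →₀ ℝ)}

theorem self_le_m (j : ℕ) : (j : ℝ) ≤ C.m j := by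
  exact_mod_cast C.m_strictMono.le_apply

/-- Successive averages of increasing levels in `V`, together with coefficients of level `j + 1`,
such that every composite functional of index larger than `j` is small on all averages but one. -/
theorem exists_rapid_system (hV : HasTails V) (j : ℕ) :
    ∃ (b : ℕ+ →₀ ℝ) (lo : ℕ+ → ℕ+) (w : ℕ+ → ℕ+ →₀ ℝ), Marked b.support lo w ∧ (∀ t, 0 ≤ b t) ∧
      ∑ t ∈ b.support, b t = 1 ∧ b.support ∈ C.M (j + 1) ∧
      (schreierHalf (C.k j)).tnorm (restr b.support b) ≤ 1 / (C.m (j + 2) : ℝ) ^ 4 ∧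
      (∃ hne : b.support.Nonempty, 1 / 2 ≤ ∑ t ∈ b.support.erase (b.support.min' hne), b t) ∧
      (∀ t ∈ b.support, w t ∈ V ∧ C.data.tnorm (w t) ≤ 1 ∧ 1 / 4 < C.data.tnorm (w t)) ∧
      ∀ i, ¬ i ≤ j → ∀ f ∈ C.data.Composite i, ∃ t₀, ∀ t ∈ b.support, t ≠ t₀ →
        |pairing f (w t)| ≤ 2 / C.m (j + 1) := by
  classical
  obtain ⟨v₀, hv₀V, hv₀N, hv₀⟩ := C.exists_average hV j 1
  obtain ⟨x₀, -, rfl⟩ := exists_markedVector hv₀N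
  have hMj := C.m_pos (j + 1)
  obtain ⟨D, x, hD, hx⟩ := exists_infinite_markers (α := MarkedVector × ℕ)
    (lo := fun x => x.1.lo) (hi := fun x => x.1.hi)
    (I := fun x => x.1.vec ∈ V ∧ C.data.tnorm x.1.vec ≤ 1 ∧ 1 / 4 < C.data.tnorm x.1.vec ∧
      ∀ i ≤ x.2, ∀ f ∈ C.data.Composite i, |pairing f x.1.vec| ≤ 2 / C.m i)
    (R := fun x y => x.1.hi ≤ y.1.lo ∧ x.2 ≤ y.2 ∧
      C.m (j + 1) * ∑ n ∈ x.1.vec.support, |x.1.vec n| ≤ C.m y.2)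
    (fun x _ => x.1.lo_lt_hi) (fun _ _ h => h.1)
    (fun x y z _ h h' => ⟨(h.1.trans y.1.lo_lt_hi.le).trans h'.1, h.2.1.trans h'.2.1,
      h.2.2.trans (C.m_le h'.2.1)⟩) (a₀ := (x₀, j)) ⟨hv₀V, hv₀⟩ (by
      rintro ⟨y, J⟩ -
      obtain ⟨J', hJJ', hJ'⟩ : ∃ J', J ≤ J' ∧
          C.m (j + 1) * ∑ n ∈ y.vec.support, |y.vec n| ≤ C.m J' := by
        refine ⟨max J ⌈C.m (j + 1) * ∑ n ∈ y.vec.support, |y.vec n|⌉₊, le_max_left _ _, ?_⟩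
        refine (Nat.le_ceil _).trans (le_trans ?_ (C.self_le_m _))
        exact_mod_cast le_max_right _ _
      obtain ⟨v, hvV, hvN, hv⟩ := C.exists_average hV J' y.hi
      obtain ⟨z, hz, rfl⟩ := exists_markedVector hvN
      exact ⟨(z, J'), ⟨hvV, hv⟩, hz.ge, hJJ', hJ'⟩)
  obtain ⟨b, hb0, hb1, hbD, hbF, haux, hhalf⟩ := C.small_coefficients j hD
  have hbD' : ∀ t ∈ b.support, t ∈ D := fun t ht => hbD ht
  refine ⟨b, fun t => (x t).1.lo, fun t => (x t).1.vec, ⟨fun t ht => ?_, fun t ht t' ht' h => ?_,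
    fun t ht a ha => ?_⟩, hb0, hb1, C.schreierFam_s_subset j hbF, haux, hhalf, fun t ht => ?_,
    fun i hi f hf => ?_⟩
  · have := (x t).1.lo_lt_hi
    rwa [(hx t (hbD' t ht)).2.1] at this
  · have := ((hx t (hbD' t ht)).2.2.2 t' (hbD' t' ht') h).1
    rwa [(hx t (hbD' t ht)).2.1] at this
  · have := (x t).1.supp a ha
    rwa [(hx t (hbD' t ht)).2.1] at this
  · obtain ⟨h1, h2, h3, -⟩ := (hx t (hbD' t ht)).1
    exact ⟨h1, h2, h3⟩
  · have hji : C.m (j + 1) ≤ (C.m i : ℝ) := C.m_le (by omega)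
    have hgood : ∀ t ∈ b.support, i ≤ (x t).2 → |pairing f (x t).1.vec| ≤ 2 / C.m (j + 1) :=
      fun t ht h => ((hx t (hbD' t ht)).1.2.2.2 i h f hf).trans
        (div_le_div_of_nonneg_left two_pos.le hMj hji)
    obtain ⟨F, hF⟩ : ∃ F : Finset ℕ+, ∀ t, t ∈ F ↔ t ∈ b.support ∧ (x t).2 < i :=
      ⟨b.support.filter fun t => (x t).2 < i, fun t => Finset.mem_filter⟩
    by_cases hne : F.Nonempty
    · -- The exceptional average is the last one whose level is smaller than the index `i`.
      obtain ⟨t₀, ht₀, hmax⟩ := F.exists_max_image id hne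
      obtain ⟨ht₀b, ht₀i⟩ := (hF t₀).1 ht₀
      refine ⟨t₀, fun t ht hne' => ?_⟩
      by_cases hti : i ≤ (x t).2
      · exact hgood t ht hti
      · have hlt : t < t₀ := lt_of_le_of_ne (hmax t ((hF t).2 ⟨ht, not_le.1 hti⟩)) hne'
        have h1 := ((hx t (hbD' t ht)).2.2.2 t₀ (hbD' _ ht₀b) hlt).2.2.trans (C.m_le ht₀i.le)
        have h2 := abs_pairing_le_weight_mul hf (x t).1.vec
        rw [C.weight_eq, one_div_mul_eq_div] at h2
        refine h2.trans ?_
        rw [div_le_div_iff₀ (C.m_pos i) hMj]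
        have h3 := C.m_pos i
        linarith
    · exact ⟨1, fun t ht _ => hgood t ht (by
        by_contra hlt
        exact hne ⟨t, (hF t).2 ⟨ht, not_le.1 hlt⟩⟩)⟩

/-- Averages of level `j + 1` of rapidly increasing sequences have norm of the order `1 / m_{j+1}`,
this order is attained by a member of `K_{j+1}`, and the members of `K_i` with `i ≤ j` act on them
by at most the order `1 / (m_i m_{j+1})`. -/
theorem exists_rapid_average (hV : HasTails V) (j : ℕ) :
    ∃ z ∈ V, C.data.tnorm z ≤ 4 / C.m (j + 1) ∧
      (∀ i ≤ j, ∀ f ∈ C.data.K i, |pairing f z| ≤ 4 / (C.m i * C.m (j + 1))) ∧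
      ∃ φ ∈ C.data.K (j + 1), 1 / (16 * C.m (j + 1)) < pairing φ z := by
  obtain ⟨b, lo, w, hw, hb0, hb1, hbM, haux, ⟨hne, hhalf⟩, hwV, hrapid⟩ :=
    C.exists_rapid_system hV j
  have hnorm : ∀ t ∈ b.support, C.data.tnorm (w t) ≤ 1 := fun t ht => (hwV t ht).2.1
  set M : ℝ := (C.m (j + 1) : ℝ) with hM
  have hM2 : 2 ≤ M := C.two_le_m _
  have hM0 : 0 < M := C.m_pos _
  have hpow : (1 / 2 : ℝ) ^ C.m (j + 1) ≤ 1 / M := by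
    rw [one_div_pow]
    refine one_div_le_one_div_of_le hM0 ?_
    have : C.m (j + 1) < 2 ^ C.m (j + 1) := Nat.lt_two_pow_self
    rw [hM]
    exact_mod_cast this.le
  set ε := (schreierHalf (C.k j)).tnorm (restr b.support b) with hε
  have hε0 : 0 ≤ ε := tnorm_nonneg _ _
  have hεM : (2 * M + 2) * ε ≤ 1 / (M * M) := by
    have h1 : ε ≤ 1 / M ^ 8 := by
      refine haux.trans (one_div_le_one_div_of_le (by positivity) ?_)
      calc M ^ 8 = (M ^ 2) ^ 4 := by ring
        _ ≤ _ := pow_le_pow_left₀ (by positivity) (C.sq_le_m_succ (j + 1)) 4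
    refine (mul_le_mul_of_nonneg_left h1 (by positivity)).trans ?_
    rw [mul_one_div, div_le_div_iff₀ (by positivity) (by positivity)]
    have h2 : (2 : ℝ) ^ 5 ≤ M ^ 5 := pow_le_pow_left₀ two_pos.le hM2 5
    have h3 : (2 * M + 2) * (M * M) ≤ 2 ^ 5 * M * (M * M) :=
      mul_le_mul_of_nonneg_right (by linarith) (by positivity)
    have h4 : 2 ^ 5 * M * (M * M) ≤ M ^ 5 * M * (M * M) := by gcongr
    calc (2 * M + 2) * (M * M) ≤ M ^ 5 * M * (M * M) := h3.trans h4
      _ = 1 * M ^ 8 := by ring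
  have hMM : 1 / (M * M) ≤ 1 / M := by
    refine one_div_le_one_div_of_le hM0 ?_
    nlinarith
  have hfam : ∀ i ∈ {i : ℕ | i ≤ j}, C.data.fam i ⊆ schreierFam (C.k j) := fun i hi =>
    C.M_subset_of_le hi
  have hmain := abs_pairing_combo_le_of_rapid (C.k_ne_zero j) (L := {i : ℕ | i ≤ j}) hfam
    (fun i _ => C.weight_le_half i) hw hb0 hnorm (η := 2 / M) (by positivity) hrapid
    (C.m (j + 1))
  refine ⟨combo b w b.support, combo_mem (fun t ht => (hwV t ht).1) b, ?_, fun i hi f hf => ?_, ?_⟩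
  · refine C.data.tnorm_le fun f hf => (le_abs_self _).trans ?_
    have h1 := hmain f hf b.support subset_rfl
    rw [hb1, mul_one, ← hM, ← hε] at h1
    have h2 : (4 : ℝ) / M = 2 / M + 1 / M + 1 / M := by ring
    linarith
  · have hmi : 1 / (M * M) ≤ 1 / (C.m i * M) := by
      refine one_div_le_one_div_of_le (mul_pos (C.m_pos i) hM0) ?_
      exact mul_le_mul_of_nonneg_right (C.m_le (by omega)) hM0.le
    have hsplit : 4 / (C.m i * M) = 1 / C.m i * (3 / M) + 1 / (C.m i * M) := by
      have := C.m_pos i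
      field_simp
      norm_num
    have hmi0 : 0 ≤ 1 / (C.m i : ℝ) * (3 / M) := by
      have := C.m_pos i
      positivity
    rcases C.data.K_cases hf with ⟨k, c, hc, rfl⟩ | hcomp
    · have h1 := abs_pairing_single_combo_le (κ := C.k j) hw hb0 hnorm (k := k) hc
      have h2 := mul_le_mul_of_nonneg_right (show (1 : ℝ) ≤ 2 * M + 2 by linarith) hε0
      linarith
    · have h1 := abs_pairing_combo_le_step (C.k_ne_zero j) (hfam i hi) (C.weight_le_half i) hw hb0
        hnorm (by positivity) (by positivity) hmain hcomp subset_rfl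
      rw [hb1, mul_one, ← hM, ← hε, C.weight_eq] at h1
      have h2 : 1 / (C.m i : ℝ) * (2 / M + (1 / 2) ^ C.m (j + 1)) ≤ 1 / C.m i * (3 / M) := by
        refine mul_le_mul_of_nonneg_left ?_ (one_div_nonneg.2 (C.m_pos i).le)
        have : (3 : ℝ) / M = 2 / M + 1 / M := by ring
        linarith
      linarith
  · obtain ⟨φ, hφ, hlt⟩ := exists_composite_lt_combo (c := 1 / 16) C.isLowerSet_fam
      (C.isSpreading_M (j + 1)) hw hb0 hne hbM (by norm_num) (by
        have : ∑ t ∈ b.support.erase (b.support.min' hne), b t * (1 / 4) ≤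
            ∑ t ∈ b.support.erase (b.support.min' hne), b t * C.data.tnorm (w t) :=
          Finset.sum_le_sum fun t ht =>
            mul_le_mul_of_nonneg_left (hwV t (Finset.mem_of_mem_erase ht)).2.2.le (hb0 t)
        rw [← Finset.sum_mul] at this
        linarith)
    refine ⟨φ, C.data.composite_subset_K _ hφ, lt_of_eq_of_lt ?_ hlt⟩
    rw [C.weight_eq, ← hM]
    field_simp

/-! ### Distortion of block subspaces -/

theorem _root_.TsirelsonData.tnorm_normalize {ι : Type} (T : TsirelsonData ι) [Nonempty ι]
    {z : ℕ+ →₀ ℝ}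
    (hz : 0 < T.tnorm z) : T.tnorm ((T.tnorm z)⁻¹ • z) = 1 := by
  rw [tnorm_smul, abs_of_pos (inv_pos.2 hz), inv_mul_cancel₀ hz.ne']

theorem _root_.TsirelsonData.seminorm_smul_ofFinsupp {ι : Type} (T : TsirelsonData ι) [Nonempty ι]
    (p : Seminorm ℝ T.Space) {c : ℝ} (hc : 0 < c) (z : ℕ+ →₀ ℝ) :
    p (T.ofFinsupp (c • z)) = c * p (T.ofFinsupp z) := by
  rw [← ofFinsuppₗ_apply, map_smul, map_smul_eq_mul, Real.norm_eq_abs, abs_of_pos hc,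
    ofFinsuppₗ_apply]

theorem weight_mul_norm_le_distortingNorm (i : ℕ) (x : C.data.Space) :
    1 / (C.m i : ℝ) * ‖x‖ ≤ C.data.distortingNorm i x :=
  le_add_of_nonneg_right (apply_nonneg (C.data.supSeminorm i) x)

theorem distortingNorm_le (i : ℕ) (x : C.data.Space) :
    C.data.distortingNorm i x ≤ (1 / (C.m i : ℝ) + 1) * ‖x‖ := by
  rw [distortingNorm_apply, add_mul, one_mul, C.weight_eq]
  refine add_le_add_right (csSup_le (Set.Nonempty.image _ ⟨_, C.data.single_mem_K i 1⟩) ?_) _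
  rintro _ ⟨f, hf, rfl⟩
  exact (le_abs_self _).trans (C.data.abs_functional_le (C.data.K_subset i hf) x)

/-- In a subspace of `c₀₀` with vectors arbitrarily far to the right, the normalized averages of
rapidly increasing sequences of levels `i₀` and `i₀ + 1` witness the distortion. -/
theorem exists_distorted (hV : HasTails V) (i₀ : ℕ) :
    ∃ u ∈ V, ∃ v ∈ V, C.data.tnorm u = 1 ∧ C.data.tnorm v = 1 ∧ 1 / 5000 * (C.m i₀ : ℝ) ≤
      C.data.distortingNorm i₀ (C.data.ofFinsupp u) /
        C.data.distortingNorm i₀ (C.data.ofFinsupp v) := by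
  cases i₀ with
  | zero =>
    obtain ⟨v, hvV, hv0, -⟩ := hV 1
    have hv1 := tnorm_normalize C.data (C.data.tnorm_pos hv0)
    refine ⟨_, V.smul_mem _ hvV, _, V.smul_mem _ hvV, hv1, hv1, ?_⟩
    rw [div_self, C.fast.zero]
    · norm_num
    · refine ne_of_gt (lt_of_lt_of_le ?_ (C.weight_mul_norm_le_distortingNorm 0 _))
      rw [norm_ofFinsupp, hv1, mul_one]
      exact one_div_pos.2 (C.m_pos 0)
  | succ j =>
    obtain ⟨z, hzV, hz1, -, φ, hφ, hz2⟩ := C.exists_rapid_average hV j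
    obtain ⟨y, hyV, -, hy1, ψ, hψ, hy2⟩ := C.exists_rapid_average hV (j + 1)
    set M : ℝ := (C.m (j + 1) : ℝ) with hM
    set M' : ℝ := (C.m (j + 1 + 1) : ℝ) with hM'
    have hM0 : 0 < M := C.m_pos _
    have hM'0 : 0 < M' := C.m_pos _
    have hφz := C.data.pairing_le_tnorm (C.data.K_subset _ hφ) z
    have hψy := C.data.pairing_le_tnorm (C.data.K_subset _ hψ) y
    have hzpos : 0 < C.data.tnorm z := lt_of_lt_of_le (lt_trans (by positivity) hz2) hφz
    have hypos : 0 < C.data.tnorm y := lt_of_lt_of_le (lt_trans (by positivity) hy2) hψy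
    refine ⟨_, V.smul_mem (C.data.tnorm z)⁻¹ hzV, _, V.smul_mem (C.data.tnorm y)⁻¹ hyV,
      tnorm_normalize _ hzpos, tnorm_normalize _ hypos, ?_⟩
    rw [seminorm_smul_ofFinsupp _ _ (inv_pos.2 hzpos),
      seminorm_smul_ofFinsupp _ _ (inv_pos.2 hypos), ← div_eq_inv_mul, ← div_eq_inv_mul]
    have hpz : 1 / 64 ≤ C.data.distortingNorm (j + 1) (C.data.ofFinsupp z) / C.data.tnorm z := by
      rw [le_div_iff₀ hzpos]
      have h1 : pairing φ z ≤ C.data.distortingNorm (j + 1) (C.data.ofFinsupp z) := by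
        rw [← functional_ofFinsupp C.data]
        refine (le_csSup (C.data.bddAbove_functional (j + 1) _) ⟨φ, hφ, rfl⟩).trans ?_
        exact le_add_of_nonneg_left (mul_nonneg (C.data.weight_pos _).le (norm_nonneg _))
      have h2 : 1 / 64 * (4 / M) = 1 / (16 * M) := by
        field_simp
        norm_num
      linarith
    have hpy : C.data.distortingNorm (j + 1) (C.data.ofFinsupp y) / C.data.tnorm y ≤ 65 / M := by
      rw [div_le_iff₀ hypos, distortingNorm_apply, norm_ofFinsupp, C.weight_eq, ← hM]
      have h1 : sSup ((fun f => C.data.functional f (C.data.ofFinsupp y)) '' C.data.K (j + 1)) ≤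
          4 / (M * M') := by
        refine csSup_le (Set.Nonempty.image _ ⟨_, C.data.single_mem_K (j + 1) 1⟩) ?_
        rintro _ ⟨f, hf, rfl⟩
        simp only [functional_ofFinsupp]
        exact (le_abs_self _).trans (hy1 (j + 1) le_rfl f hf)
      have h2 : 4 / (M * M') = 64 / M * (1 / (16 * M')) := by
        field_simp
        norm_num
      have h3 := mul_le_mul_of_nonneg_left (hy2.le.trans hψy) (show 0 ≤ 64 / M by positivity)
      have h4 : 65 / M * C.data.tnorm y = 1 / M * C.data.tnorm y + 64 / M * C.data.tnorm y := by
        ring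
      linarith
    have hpy0 : 0 < C.data.distortingNorm (j + 1) (C.data.ofFinsupp y) / C.data.tnorm y := by
      refine div_pos (lt_of_lt_of_le ?_ (C.weight_mul_norm_le_distortingNorm (j + 1) _)) hypos
      rw [norm_ofFinsupp]
      exact mul_pos (by positivity) hypos
    rw [le_div_iff₀ hpy0]
    have h1 := mul_le_mul_of_nonneg_left hpy (show 0 ≤ 1 / 5000 * M by positivity)
    have h2 : 1 / 5000 * M * (65 / M) = 65 / 5000 := by field_simp
    linarith

theorem _root_.IsBlockSeq.hasTails_span {x : ℕ → ℕ+ →₀ ℝ} (hx : IsBlockSeq x) :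
    HasTails (Submodule.span ℝ (Set.range x)) := by
  have hge : ∀ k, ∀ a ∈ (x k).support, k < (a : ℕ) := by
    intro k
    induction k with
    | zero => exact fun a _ => a.pos
    | succ k ih =>
      intro a ha
      obtain ⟨a', ha'⟩ := Finsupp.support_nonempty_iff.2 (hx.1 k)
      have h1 : (a' : ℕ) < a := hx.2 k (k + 1) (Nat.lt_succ_self k) a' ha' a ha
      have h2 := ih a' ha'
      omega
  refine fun N => ⟨x N, Submodule.subset_span ⟨_, rfl⟩, hx.1 _, fun a ha => ?_⟩
  exact_mod_cast (hge N a ha).le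

theorem distortsBy_closedSpan {x : ℕ → ℕ+ →₀ ℝ} (hx : IsBlockSeq x) (i₀ : ℕ) :
    DistortsBy (C.data.distortingNorm i₀) (1 / 5000 * C.m i₀) (C.data.closedSpan x) := by
  obtain ⟨u, hu, v, hv, hu1, hv1, hle⟩ := C.exists_distorted hx.hasTails_span i₀
  have hmem : ∀ u ∈ Submodule.span ℝ (Set.range x), C.data.ofFinsupp u ∈ C.data.closedSpan x := by
    intro u hu
    refine Submodule.le_topologicalClosure _ ?_
    have := Submodule.mem_map_of_mem (f := C.data.ofFinsuppₗ) hu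
    rwa [Submodule.map_span, ← Set.range_comp] at this
  exact fun r hr => ⟨_, hmem u hu, _, hmem v hv, by rw [norm_ofFinsupp, hu1],
    by rw [norm_ofFinsupp, hv1], hr.trans_le hle⟩

end XuChoice

/-! ### Perturbation of block sequences -/

namespace TsirelsonData

variable {ι : Type} {T : TsirelsonData ι} [Nonempty ι]

/-- An infinite-dimensional subspace contains norm-one vectors close to vectors supported
arbitrarily far to the right. -/
theorem exists_norm_sub_lt_of_not_finiteDimensional (hA : ∀ j, IsLowerSet (T.fam j))
    {Y : Submodule ℝ T.Space} (hY : ¬ FiniteDimensional ℝ Y) (N : ℕ+) {δ : ℝ} (hδ : 0 < δ) :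
    ∃ y ∈ Y, ‖y‖ = 1 ∧ ∃ x : ℕ+ →₀ ℝ, (∀ a ∈ x.support, N ≤ a) ∧ ‖T.ofFinsupp x - y‖ < δ := by
  classical
  set F : Finset ℕ+ := Finset.Ico 1 N
  let L : Y →ₗ[ℝ] (F → ℝ) := LinearMap.pi fun n =>
    (T.functional (Finsupp.single (n : ℕ+) 1)).toLinearMap ∘ₗ Y.subtype
  -- A nonzero element of `Y` with vanishing first coordinates.
  have hker : LinearMap.ker L ≠ ⊥ := fun h =>
    hY (FiniteDimensional.of_injective L (LinearMap.ker_eq_bot.1 h))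
  obtain ⟨y, hyL, hy0⟩ := Submodule.exists_mem_ne_zero_of_ne_bot hker
  have hyn : ∀ n ∈ F, T.functional (Finsupp.single n 1) (y : T.Space) = 0 := fun n hn =>
    congrFun (LinearMap.mem_ker.1 hyL) ⟨n, hn⟩
  have hy0' : (y : T.Space) ≠ 0 := by simpa using hy0
  set u : T.Space := ‖(y : T.Space)‖⁻¹ • (y : T.Space) with hu
  have hu1 : ‖u‖ = 1 := norm_smul_inv_norm (𝕜 := ℝ) hy0'
  have hproj : T.coordProj F u = 0 := by
    refine Finset.sum_eq_zero fun n hn => ?_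
    rw [hu, map_smul, hyn n hn, smul_zero, zero_smul]
  obtain ⟨x, hx⟩ := T.exists_norm_sub_ofFinsupp_lt u (half_pos hδ)
  refine ⟨u, Y.smul_mem _ y.2, hu1, restr (Set.Ici N) x, fun a ha => ?_, ?_⟩
  · exact support_restr_subset (Set.Ici N) x (by exact_mod_cast ha)
  · have h1 : restr (Set.Ici N) x = x - restr F x := by
      ext n
      by_cases hn : N ≤ n
      · have : n ∉ (F : Set ℕ+) := by simp [F, hn]
        rw [restr_apply_of_mem (Set.mem_Ici.2 hn), Finsupp.sub_apply, restr_apply_of_notMem this,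
          sub_zero]
      · have : n ∈ (F : Set ℕ+) := by simpa [F] using hn
        rw [restr_apply_of_notMem (by simpa using hn), Finsupp.sub_apply, restr_apply_of_mem this,
          sub_self]
    have h2 : T.ofFinsupp (restr (Set.Ici N) x) - u =
        T.coordProj F (u - T.ofFinsupp x) - (u - T.ofFinsupp x) := by
      rw [coordProj_sub, hproj, coordProj_ofFinsupp, h1, ← ofFinsuppₗ_apply, map_sub,
        ofFinsuppₗ_apply, ofFinsuppₗ_apply]
      abel
    rw [h2]
    have h3 := norm_sub_le (T.coordProj F (u - T.ofFinsupp x)) (u - T.ofFinsupp x)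
    have h4 := norm_coordProj_le hA F (u - T.ofFinsupp x)
    linarith

/-- Every infinite-dimensional subspace is approximated by a subspace of `c₀₀` with vectors
arbitrarily far to the right. -/
theorem exists_hasTails_near (hA : ∀ j, IsLowerSet (T.fam j)) {Y : Submodule ℝ T.Space}
    (hY : ¬ FiniteDimensional ℝ Y) {δ : ℝ} (hδ : 0 < δ) (hδ1 : δ ≤ 1) :
    ∃ V : Submodule ℝ (ℕ+ →₀ ℝ), HasTails V ∧
      ∀ u ∈ V, T.tnorm u = 1 → ∃ y ∈ Y, ‖T.ofFinsupp u - y‖ ≤ δ := by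
  classical
  have hnext : ∀ N : ℕ+, ∀ k : ℕ, ∃ (x : MarkedVector) (y : T.Space), N ≤ x.lo ∧ y ∈ Y ∧ ‖y‖ = 1 ∧
      ‖T.ofFinsupp x.vec - y‖ < δ / 4 * (1 / 2) ^ k := fun N k => by
    obtain ⟨y, hyY, hy1, v, hvN, hv⟩ := exists_norm_sub_lt_of_not_finiteDimensional hA hY N
      (show 0 < δ / 4 * (1 / 2) ^ k by positivity)
    obtain ⟨x, hxN, rfl⟩ := exists_markedVector hvN
    exact ⟨x, y, hxN.ge, hyY, hy1, hv⟩
  obtain ⟨x₀, y₀, -, h₀⟩ := hnext 1 0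
  obtain ⟨f, hf0, hfI, hfR⟩ := exists_seq_of_invariant
    (α := MarkedVector × T.Space × ℕ) (I := fun s => s.2.1 ∈ Y ∧ ‖s.2.1‖ = 1 ∧
      ‖T.ofFinsupp s.1.vec - s.2.1‖ < δ / 4 * (1 / 2) ^ s.2.2)
    (R := fun s s' => s.1.hi ≤ s'.1.lo ∧ s'.2.2 = s.2.2 + 1) (a₀ := (x₀, y₀, 0)) h₀ (by
      rintro ⟨x, y, k⟩ -
      obtain ⟨x', y', hx', h⟩ := hnext x.hi (k + 1)
      exact ⟨(x', y', k + 1), h, hx', rfl⟩)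
  have hidx : ∀ n, (f n).2.2 = n := fun n => by
    induction n with
    | zero => rw [hf0]
    | succ n ih => rw [(hfR n).2, ih]
  set x : ℕ → ℕ+ →₀ ℝ := fun n => (f n).1.vec with hx
  set y : ℕ → T.Space := fun n => (f n).2.1 with hy
  have hyY : ∀ n, y n ∈ Y := fun n => (hfI n).1
  have hxy : ∀ n, ‖T.ofFinsupp (x n) - y n‖ < δ / 4 * (1 / 2) ^ n := fun n => by
    have := (hfI n).2.2
    rwa [hidx] at this
  have hxnorm : ∀ n, 1 / 2 ≤ T.tnorm (x n) := fun n => by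
    have h1 := norm_sub_norm_le (y n) (T.ofFinsupp (x n))
    rw [norm_sub_rev, norm_ofFinsupp, show ‖y n‖ = 1 from (hfI n).2.1] at h1
    have h2 : (1 / 2 : ℝ) ^ n ≤ 1 := pow_le_one₀ (by norm_num) (by norm_num)
    have h3 := hxy n
    nlinarith
  have hmono : Monotone fun n => (f n).1.lo := monotone_nat_of_le_succ fun n =>
    ((f n).1.lo_lt_hi.le).trans (hfR n).1
  have hsucc : ∀ n n', n < n' → (f n).1.hi ≤ (f n').1.lo := fun n n' h =>
    (hfR n).1.trans (hmono h)
  have hblock : IsBlockSeq x := by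
    refine ⟨fun n h0 => ?_, fun n n' h a ha a' ha' => ?_⟩
    · have := hxnorm n
      rw [h0, tnorm_zero] at this
      norm_num at this
    · exact ((f n).1.supp a ha).2.trans_le ((hsucc n n' h).trans ((f n').1.supp a' ha').1)
  refine ⟨Submodule.span ℝ (Set.range x), hblock.hasTails_span, fun u hu hu1 => ?_⟩
  obtain ⟨c, rfl⟩ := (Finsupp.mem_span_range_iff_exists_finsupp).1 hu
  rw [Finsupp.sum] at hu1 ⊢
  have hcoeff : ∀ n ∈ c.support, |c n| ≤ 2 := by
    intro n hn
    have h1 : restr (Set.Ico (f n).1.lo (f n).1.hi) (∑ k ∈ c.support, c k • x k) = c n • x n := by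
      rw [restr_sum, Finset.sum_eq_single n]
      · refine restr_eq_self fun a ha => ?_
        have ha' : a ∈ (c n • x n).support := ha
        exact (f n).1.supp a (Finsupp.support_smul ha')
      · intro k _ hk
        ext a
        by_cases ha : a ∈ Set.Ico (f n).1.lo (f n).1.hi
        · rw [restr_apply_of_mem ha]
          have : x k a = 0 := by
            by_contra hc
            obtain ⟨h1, h2⟩ := (f k).1.supp a (Finsupp.mem_support_iff.2 hc)
            rcases lt_or_gt_of_ne hk with h | h
            · exact absurd (h2.trans_le (hsucc k n h)) (not_lt.2 ha.1)
            · exact absurd (ha.2.trans_le (hsucc n k h)) (not_lt.2 h1)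
          simp [this]
        · rw [restr_apply_of_notMem ha, Finsupp.zero_apply]
      · exact fun h => absurd hn h
    have h2 := tnorm_restr_le hA (Set.Ico (f n).1.lo (f n).1.hi) (∑ k ∈ c.support, c k • x k)
    rw [h1, hu1, tnorm_smul] at h2
    have h3 := mul_le_mul_of_nonneg_left (hxnorm n) (abs_nonneg (c n))
    linarith
  refine ⟨∑ n ∈ c.support, c n • y n, Y.sum_mem fun n _ => Y.smul_mem _ (hyY n), ?_⟩
  rw [← ofFinsuppₗ_apply, map_sum, ← Finset.sum_sub_distrib]
  simp only [map_smul, ← smul_sub, ofFinsuppₗ_apply]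
  have hgeom : ∑ n ∈ c.support, (1 / 2 : ℝ) ^ n ≤ 2 :=
    (summable_geometric_two.sum_le_tsum _ fun n _ => by positivity).trans_eq tsum_geometric_two
  calc ‖∑ n ∈ c.support, c n • (T.ofFinsupp (x n) - y n)‖
      ≤ ∑ n ∈ c.support, δ / 2 * (1 / 2) ^ n := by
        refine norm_sum_le_of_le _ fun n hn => ?_
        rw [norm_smul, Real.norm_eq_abs]
        calc |c n| * ‖T.ofFinsupp (x n) - y n‖ ≤ 2 * (δ / 4 * (1 / 2) ^ n) :=
              mul_le_mul (hcoeff n hn) (hxy n).le (norm_nonneg _) two_pos.le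
          _ = δ / 2 * (1 / 2) ^ n := by ring
    _ = δ / 2 * ∑ n ∈ c.support, (1 / 2 : ℝ) ^ n := by rw [Finset.mul_sum]
    _ ≤ δ / 2 * 2 := mul_le_mul_of_nonneg_left hgeom (by positivity)
    _ = δ := by ring

end TsirelsonData

/-- The norm `|||·|||` for a large index `i₀` distorts every infinite-dimensional subspace:
witnesses of the distortion in a nearby block subspace are moved into the given subspace. -/
theorem XuChoice.arbitrarilyDistortable (C : XuChoice) : ArbitrarilyDistortable C.data.Space := by
  intro t ht
  obtain ⟨i₀, hi₀⟩ := exists_nat_ge (16 * 5000 * t)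
  have hm : 16 * t ≤ 1 / 5000 * (C.m i₀ : ℝ) := by
    have := C.self_le_m i₀
    linarith
  set p := C.data.distortingNorm i₀ with hp
  have hm0 := C.m_pos i₀
  have hm2 := C.two_le_m i₀
  set θ : ℝ := 1 / (C.m i₀ : ℝ) with hθ
  have hθ0 : 0 < θ := one_div_pos.2 hm0
  have hθ1 : θ ≤ 1 := by
    rw [hθ, div_le_one hm0]
    linarith
  have hplow : ∀ x, θ * ‖x‖ ≤ p x := C.weight_mul_norm_le_distortingNorm i₀
  have hpup : ∀ x, p x ≤ (θ + 1) * ‖x‖ := C.distortingNorm_le i₀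
  refine ⟨p, ⟨θ, θ + 1, hθ0, by linarith, fun x => ⟨hplow x, hpup x⟩⟩, fun Y hY r hr => ?_⟩
  obtain ⟨V, hV, hVY⟩ := TsirelsonData.exists_hasTails_near C.isLowerSet_fam hY
    (show 0 < θ / 8 by positivity) (by linarith)
  obtain ⟨u, hu, v, hv, hu1, hv1, hle⟩ := C.exists_distorted hV i₀
  obtain ⟨u', hu'Y, hu'⟩ := hVY u hu hu1
  obtain ⟨v', hv'Y, hv'⟩ := hVY v hv hv1
  rw [← TsirelsonData.norm_ofFinsupp] at hu1 hv1
  set a := C.data.ofFinsupp u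
  set b := C.data.ofFinsupp v
  -- Small perturbations of normalized vectors change `p` and the norm by small factors.
  have hpert : ∀ a a' : C.data.Space, ‖a‖ = 1 → ‖a - a'‖ ≤ θ / 8 →
      3 / 4 * p a ≤ p a' ∧ p a' ≤ 5 / 4 * p a ∧ 1 / 2 ≤ ‖a'‖ ∧ ‖a'‖ ≤ 2 := by
    intro a a' ha haa
    have h1 := hplow a
    rw [ha, mul_one] at h1
    have h2 : p (a - a') ≤ θ / 4 := by
      refine (hpup _).trans ?_
      have := mul_le_mul (show θ + 1 ≤ 2 by linarith) haa (norm_nonneg _) two_pos.le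
      linarith
    have h3 : p a ≤ p (a - a') + p a' := by simpa using map_add_le_add p (a - a') a'
    have h4 : p a' ≤ p (a' - a) + p a := by simpa using map_add_le_add p (a' - a) a
    rw [map_sub_rev] at h4
    have h5 := norm_sub_norm_le a a'
    have h6 := norm_sub_norm_le a' a
    rw [norm_sub_rev] at h6
    refine ⟨by linarith, by linarith, by linarith, by linarith⟩
  obtain ⟨ha1, -, ha3, ha4⟩ := hpert a u' hu1 hu'
  obtain ⟨-, hb2, hb3, hb4⟩ := hpert b v' hv1 hv'
  have hu0 : u' ≠ 0 := fun h => by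
    rw [h, norm_zero] at ha3
    norm_num at ha3
  have hv0 : v' ≠ 0 := fun h => by
    rw [h, norm_zero] at hb3
    norm_num at hb3
  have hupos := norm_pos_iff.2 hu0
  have hvpos := norm_pos_iff.2 hv0
  have hpv : 0 < p v' := (mul_pos hθ0 hvpos).trans_le (hplow v')
  have hpb : 0 < p b := by
    have := hplow b
    rw [hv1, mul_one] at this
    linarith
  refine ⟨_, Y.smul_mem ‖u'‖⁻¹ hu'Y, _, Y.smul_mem ‖v'‖⁻¹ hv'Y, norm_smul_inv_norm (𝕜 := ℝ) hu0,
    norm_smul_inv_norm (𝕜 := ℝ) hv0, ?_⟩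
  rw [map_smul_eq_mul, map_smul_eq_mul, norm_inv, norm_inv, norm_norm, norm_norm, ← div_eq_inv_mul,
    ← div_eq_inv_mul, lt_div_iff₀ (div_pos hpv hvpos)]
  refine (mul_lt_mul_of_pos_right hr (div_pos hpv hvpos)).trans_le ?_
  have h1 : p v' / ‖v'‖ ≤ 5 / 2 * p b := by
    rw [div_le_iff₀ hvpos]
    have := mul_le_mul_of_nonneg_left hb3 (show 0 ≤ 5 / 2 * p b by positivity)
    linarith
  have h2 : 3 / 8 * p a ≤ p u' / ‖u'‖ := by
    rw [le_div_iff₀ hupos]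
    have := mul_le_mul_of_nonneg_left ha4 (show 0 ≤ 3 / 8 * p a from
      mul_nonneg (by norm_num) (apply_nonneg p a))
    linarith
  have h3 : 16 * t * p b ≤ p a := (le_div_iff₀ hpb).1 (hm.trans hle)
  have h4 := mul_le_mul_of_nonneg_left h1 (show 0 ≤ t by linarith)
  have h5 : 0 < t * p b := mul_pos (by linarith) hpb
  linarith

theorem mainTheorem2 :
    (∀ m : ℕ → ℕ, IsFastSeq m → ∃ C : XuChoice, C.m = m) ∧
    (∀ (C : XuChoice) (x : ℕ+ →₀ ℝ),
      IsLUB (C.data.implicitValues (fun y => ‖C.data.ofFinsupp y‖) x) ‖C.data.ofFinsupp x‖) ∧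
    (∀ C : XuChoice, IsOneUnconditionalBasis C.data.e) ∧
    (∀ C : XuChoice, ArbitrarilyDistortable C.data.Space) ∧
    (∃ c : ℝ, 0 < c ∧ ∀ (C : XuChoice) (i₀ : ℕ),
      (∀ x : C.data.Space, 1 / (C.m i₀ : ℝ) * ‖x‖ ≤ C.data.distortingNorm i₀ x ∧
        C.data.distortingNorm i₀ x ≤ (1 / (C.m i₀ : ℝ) + 1) * ‖x‖) ∧
      ∀ x : ℕ → ℕ+ →₀ ℝ, IsBlockSeq x →
        DistortsBy (C.data.distortingNorm i₀) (c * C.m i₀) (C.data.closedSpan x)) := by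
  refine ⟨fun m hm => exists_xuChoice hm,
    fun C x => TsirelsonData.isLUB_implicitValues C.isLowerSet_fam x,
    fun C => TsirelsonData.isOneUnconditionalBasis C.isLowerSet_fam,
    fun C => C.arbitrarilyDistortable, 1 / 5000, by norm_num, fun C i₀ => ⟨fun x => ?_, ?_⟩⟩
  · exact ⟨C.weight_mul_norm_le_distortingNorm i₀ x, C.distortingNorm_le i₀ x⟩
  · exact fun x hx => C.distortsBy_closedSpan hx i₀
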